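/- Let $R$ be a commutative ring and $r\ge 0$ an integer. **Multicomplexes.** A multicomplex $A$ is a $\mathbb Z\times\mathbb Z$-bigraded $R$-module with maps $d_i$, $i\ge 0$, of bidegree $(-i,1-i)$ such that $\sum_{i+j=l}(-1)^i d_id_j=0$ for all $l\ge 0$. For $2\le n\le\infty$ an $n$-multicomplex is a multicomplex with $d_i=0$ for all $i\ge n$. A strict morphism is a map of bidegree $(0,0)$ commuting with all $d_i$. An $\infty$-morphism $f:A\to B$ is a family of maps $f_m$, $m\ge 0$, of bidegree $(-m,-m)$ with $\sum_{i+j=l}d_if_j=\sum_{i+j=l}(-1)^if_id_j$ for all $l$; composition is $(gf)_l=\sum_{i+j=l}g_if_j$, and a strict morphism $f$ is an $\infty$-morphism concentrated in $f_0$. On a tensor product, $d_m(b\otimes x)=d_mb\otimes x+(-1)^{\langle b,d_m\rangle}b\otimes d_mx$, where $\langle b,d_m\rangle=-am+a'(1-m)$ for $b$ of bidegree $(a,a')$. **Paths and homotopies of multicomplexes.** $\Lambda_r$ is the multicomplex $Re_-\oplus Re_+\oplus Ru$ with $e_\pm$ in bidegree $(0,0)$, $u$ in bidegree $(-r,1-r)$,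 $d_re_-=-u$, $d_re_+=u$ and no other differentials; $P_r(A)=\Lambda_r\otimes A$. For $2\le n<\infty$ put $N=n-1$, $k=\lfloor (r-1)/N\rfloor$ if $r\geq 1$ and $k=0$ if $r=0$, $t_j=(j+1)N$ for $0\le j<k$, and $t_k=r$. Then $\Lambda_r^n$ is the free $n$-multicomplex on $e_\pm$ in bidegree $(0,0)$, $x_0,\dots,x_k$ with $x_j$ in bidegree $(-t_j,1-t_j)$, and $z_1,\dots,z_k$ with $z_i$ in bidegree $(-iN,-iN)$, whose nonzero differentials are $d_{t_0}e_-=-x_0$, $d_{t_0}e_+=x_0$, $d_0z_i=x_{i-1}$ and $d_{t_i-iN}z_i=x_i$ (so $\Lambda^n_r=\Lambda_r$ if $r<n$); and $P_r^n(A)=\Lambda_r^n\otimes A$. The morphisms $\partial^\mp$ from $P_r(A)$ or $P_r^n(A)$ to $A$ are the projections onto the summands of $e_\mp$. Two $\infty$-morphisms $f,g:C\to D$ of multicomplexes (for example two strict morphisms) are $r$-homotopic if there is an $\infty$-morphism $h:C\to P_r(D)$ with $\partial^-h=f$, $\partial^+h=g$. For $n<\infty$, two strict morphisms $f,g:C\to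 D$ of $n$-multicomplexes are $r$-homotopic if there is a strict morphism $h:C\to P_r^n(D)$ with $\partial^-h=f$, $\partial^+h=g$. **The spectral sequence.** $\mathrm{Tot}(A)^n=\prod_{p\le 0}A^{p,n+p}\oplus\bigoplus_{p>0}A^{p,n+p}$, with $(da)_j=\sum_m(-1)^{mn}d_m(a_{j+m})$ and $F_p\mathrm{Tot}(A)=\{a: a_i=0 \text{ for all } i>p\}$; an $\infty$-morphism $f$ induces $(\mathrm{Tot}(f)a)_j=\sum_m(-1)^{mn}f_m(a_{j+m})$. $E$ is the functor from filtered complexes to spectral sequences, with pages $E_m$, $m\ge 0$, differential $\delta_m[a]=[da]$ of bidegree $(-m,1-m)$, and total degree $n=q-p$ in bidegree $(p,q)$. Put $E'=E\circ\mathrm{Tot}$. **Paths and homotopies of spectral sequences.** Let $A=(A_m,d_m)$ be a spectral sequence with these bidegrees and let $s=(s_m)_{m}$ be signs with $s_r=-1$. The $r$-path $P(r;A)$ with signs $s$ has the pages $P_m(r;A)^{p,q}=A_m^{p,q}\oplus A_m^{p+r,q+r-1}\oplus A_m^{p,q}$ for $m\le r$ with $$D_m(x,y,z)=(d_mx,\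 s_md_my,\ d_mz)\ (m<r),\qquad D_r(x,y,z)=(d_rx,\ -x-d_ry+z,\ d_rz),$$ and $P_m(r;A)=A_m$ for $m>r$; the characteristic maps are those of $A$ on each summand from page $m<r$ to $m+1$, the map induced by $(x,y,z)\mapsto x$ (equivalently by $z$) from page $r$ to $r+1$, and those of $A$ afterwards. The morphisms $\partial^-,\partial^+:P(r;A)\to A$ are $(x,y,z)\mapsto x$ and $(x,y,z)\mapsto z$ on the pages $m\le r$ and the identity for $m>r$. An $r$-homotopy from $f$ to $g:A\to B$ is a morphism $h:A\to P(r;B)$ with $\partial^-h=f$, $\partial^+h=g$. It is called *total* if $s_m=-1$ for all $m$ (the Koszul sign of the total degrees of $u$ and $d_m$) and *bigraded* if $s_m=(-1)^{m+r+1}$ for all $m$ (the Koszul sign of their bidegrees). Let $T$ be the involution of the category of spectral sequences that multiplies $d_m$ in total degree $n$ by $(-1)^{mn}$ and changes nothing else, so that $T E'$ is the spectral sequence with the signs $(-1)^{mn}$ of the totalization removed. **Proposition.** The spectral sequence functor from $n$-multicomplexes preserves $r$-homotopy: 1. ($n=\infty$) If $f,g:C\to D$ are $r$-homotopic $\infty$-morphisms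 of multicomplexes, and in particular if they are $r$-homotopic strict morphisms, then $E'(f)$ and $E'(g)$ are totally $r$-homotopic, and $TE'(f)$ and $TE'(g)$ are bigraded $r$-homotopic. 2. ($2\le n<\infty$) There are $\infty$-morphisms $\alpha_D:P_r^n(D)\to P_r(D)$ for all $n$-multicomplexes $D$, natural in $D$ for strict morphisms, with $\partial^-\alpha_D=\partial^-$ and $\partial^+\alpha_D=\partial^+$. If $f,g:C\to D$ are $r$-homotopic strict morphisms of $n$-multicomplexes, then they are $r$-homotopic as $\infty$-morphisms of multicomplexes, $E'(f)$ and $E'(g)$ are totally $r$-homotopic, and $TE'(f)$ and $TE'(g)$ are bigraded $r$-homotopic. -/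

import Mathlib

open CategoryTheory

universe u v

noncomputable section

/-! ### Multicomplexes -/

section Families

variable {R : Type u} [CommRing R]

/-- Families of linear maps `X p q → Y p' q'`, indexed by `ℕ`. -/
abbrev BiFamily (X Y : ℤ → ℤ → ModuleCat.{v} R) : Type (max 0 v) :=
  ℕ → ∀ p q p' q' : ℤ, X p q →ₗ[R] Y p' q'

namespace BiFamily

variable {X Y Z W : ℤ → ℤ → ModuleCat.{v} R}

/-- `f m` vanishes except on the components of bidegree `(-m, b - m)`. -/
def HasShift (b : ℤ) (f : BiFamily X Y) : Prop :=
  ∀ (m : ℕ) (p q p' q' : ℤ), ¬ (p' = p - m ∧ q' = q + b - m) → f m p q p' q' = 0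

/-- The convolution `(g * f) l = ∑_{i + j = l} g i ∘ f j`,
where `f j` is of bidegree `(-j, b - j)`. -/
def conv (b : ℤ) (g : BiFamily Y Z) (f : BiFamily X Y) : BiFamily X Z :=
  fun l p q p' q' => ∑ ij ∈ Finset.HasAntidiagonal.antidiagonal l,
    g ij.1 (p - ij.2) (q + b - ij.2) p' q' ∘ₗ f ij.2 p q (p - ij.2) (q + b - ij.2)

/-- The family `(-1)^i f i`. -/
def alt (f : BiFamily X Y) : BiFamily X Y := fun i p q p' q' => (-1 : ℤ) ^ i • f i p q p' q'

lemma comp_index (g : BiFamily Y Z) (f : BiFamily X Y) (i j : ℕ) (p q a b a' b' p' q' : ℤ)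
    (ha : a = a') (hb : b = b') :
    g i a b p' q' ∘ₗ f j p q a b = g i a' b' p' q' ∘ₗ f j p q a' b' := by
  subst ha hb; rfl

lemma comp_index₂ (h : BiFamily Z W) (g : BiFamily Y Z) (f : BiFamily X Y) (i j k : ℕ)
    (p q a b c d a' b' c' d' p' q' : ℤ)
    (ha : a = a') (hb : b = b') (hc : c = c') (hd : d = d') :
    h i c d p' q' ∘ₗ g j a b c d ∘ₗ f k p q a b =
      h i c' d' p' q' ∘ₗ g j a' b' c' d' ∘ₗ f k p q a' b' := by
  subst ha hb hc hd; rfl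

lemma conv_assoc (b b' : ℤ) (h : BiFamily Z W) (g : BiFamily Y Z) (f : BiFamily X Y) :
    conv b (conv b' h g) f = conv (b + b') h (conv b g f) := by
  funext l p q p' q'
  ext x
  simp only [conv, LinearMap.sum_apply, LinearMap.comp_apply, map_sum]
  rw [Finset.sum_sigma', Finset.sum_sigma']
  refine Finset.sum_nbij' (fun s => ⟨(s.2.1, s.2.2 + s.1.2), (s.2.2, s.1.2)⟩)
    (fun s => ⟨(s.1.1 + s.2.1, s.2.2), (s.1.1, s.2.1)⟩) ?_ ?_ ?_ ?_ ?_
  · rintro ⟨⟨a, b⟩, ⟨c, d⟩⟩ hh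
    simp at hh ⊢; omega
  · rintro ⟨⟨a, b⟩, ⟨c, d⟩⟩ hh
    simp at hh ⊢; omega
  · rintro ⟨⟨a, b⟩, ⟨c, d⟩⟩ hh
    simp at hh ⊢; omega
  · rintro ⟨⟨a, b⟩, ⟨c, d⟩⟩ hh
    simp at hh ⊢; omega
  · rintro ⟨⟨i, j⟩, ⟨k, m⟩⟩ hh
    exact LinearMap.congr_fun (comp_index₂ h g f k m j p q (p - j) (q + b - j)
      (p - j - m) (q + b - j + b' - m) (p - j) (q + b - j) (p - (m + j : ℕ))
      (q + (b + b') - (m + j : ℕ)) p' q' rfl rfl (by push_cast; ring) (by push_cast; ring)) x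

lemma alt_conv (b : ℤ) (g : BiFamily Y Z) (f : BiFamily X Y) :
    alt (conv b g f) = conv b (alt g) (alt f) := by
  funext l p q p' q'
  ext x
  simp only [conv, alt, Finset.smul_sum, LinearMap.sum_apply, LinearMap.comp_apply,
    LinearMap.smul_apply, map_zsmul, smul_smul]
  refine Finset.sum_congr rfl fun ij hij => ?_
  rw [← pow_add, add_comm ij.2, Finset.HasAntidiagonal.mem_antidiagonal.mp hij]

lemma alt_hasShift {b : ℤ} {f : BiFamily X Y} (hf : HasShift b f) : HasShift b (alt f) := by
  intro m p q p' q' h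
  simp [alt, hf m p q p' q' h]

lemma conv_hasShift {b b' : ℤ} {g : BiFamily Y Z} {f : BiFamily X Y} (hg : HasShift b' g) :
    HasShift (b + b') (conv b g f) := by
  intro m p q p' q' h
  refine Finset.sum_eq_zero fun ij hij => ?_
  rw [hg, LinearMap.zero_comp]
  have := Finset.HasAntidiagonal.mem_antidiagonal.mp hij
  omega

end BiFamily

end Families

/-- The identity `X p q → X p' q'` if the two bidegrees agree, and zero otherwise. -/
def bigradedId {R : Type u} [CommRing R] (X : ℤ → ℤ → ModuleCat.{v} R) (p q p' q' : ℤ) :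
    X p q →ₗ[R] X p' q' :=
  if h : p = p' ∧ q = q' then by rw [h.1, h.2]; exact LinearMap.id else 0

section
variable {R : Type u} [CommRing R] {X Y : ℤ → ℤ → ModuleCat.{v} R}

@[simp] lemma bigradedId_self (p q : ℤ) : bigradedId X p q p q = LinearMap.id := by
  simp [bigradedId]

lemma bigradedId_ne (p q p' q' : ℤ) (h : ¬ (p = p' ∧ q = q')) : bigradedId X p q p' q' = 0 := by
  simp [bigradedId, h]

end

/-- A multicomplex: a bigraded module with maps `d i` of bidegree `(-i, 1 - i)` such that
`∑_{i + j = l} (-1)^i d_i d_j = 0` for all `l`. As for Mathlib's complexes, `d i` has a component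
`X p q → X p' q'` for all bidegrees, which vanishes unless `(p', q') = (p - i, q + 1 - i)`. -/
structure Multicomplex (R : Type u) [CommRing R] where
  X : ℤ → ℤ → ModuleCat.{v} R
  d (i : ℕ) (p q p' q' : ℤ) : X p q →ₗ[R] X p' q'
  shape (i : ℕ) (p q p' q' : ℤ) (h : ¬ (p' = p - i ∧ q' = q + 1 - i)) : d i p q p' q' = 0
  rel (l : ℕ) (p q p' q' : ℤ) :
    ∑ ij ∈ Finset.HasAntidiagonal.antidiagonal l, (-1 : ℤ) ^ ij.1 •
      (d ij.1 (p - ij.2) (q + 1 - ij.2) p' q' ∘ₗ d ij.2 p q (p - ij.2) (q + 1 - ij.2)) = 0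

namespace Multicomplex

variable {R : Type u} [CommRing R]

lemma d_hasShift (A : Multicomplex.{u, v} R) : BiFamily.HasShift 1 A.d := A.shape

lemma conv_d (A : Multicomplex.{u, v} R) : BiFamily.conv 1 (BiFamily.alt A.d) A.d = 0 := by
  funext l p q p' q'
  simpa [BiFamily.conv, BiFamily.alt, LinearMap.smul_comp] using A.rel l p q p' q'

/-- An `∞`-morphism of multicomplexes: maps `f m` of bidegree `(-m, -m)` such that
`∑_{i + j = l} d_i f_j = ∑_{i + j = l} (-1)^i f_i d_j` for all `l`. -/
@[ext]
structure Hom (A B : Multicomplex.{u, v} R) where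
  f (m : ℕ) (p q p' q' : ℤ) : A.X p q →ₗ[R] B.X p' q'
  shape (m : ℕ) (p q p' q' : ℤ) (h : ¬ (p' = p - m ∧ q' = q - m)) : f m p q p' q' = 0
  comm (l : ℕ) (p q p' q' : ℤ) :
    ∑ ij ∈ Finset.HasAntidiagonal.antidiagonal l,
      B.d ij.1 (p - ij.2) (q - ij.2) p' q' ∘ₗ f ij.2 p q (p - ij.2) (q - ij.2) =
    ∑ ij ∈ Finset.HasAntidiagonal.antidiagonal l, (-1 : ℤ) ^ ij.1 •
      (f ij.1 (p - ij.2) (q + 1 - ij.2) p' q' ∘ₗ A.d ij.2 p q (p - ij.2) (q + 1 - ij.2))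

lemma Hom.f_hasShift {A B : Multicomplex.{u, v} R} (f : Hom A B) :
    BiFamily.HasShift 0 f.f := by
  intro m p q p' q' h
  exact f.shape m p q p' q' (by simpa using h)

lemma comm_iff_conv {A B : Multicomplex.{u, v} R}
    (f : ∀ (m : ℕ) (p q p' q' : ℤ), A.X p q →ₗ[R] B.X p' q') :
    (BiFamily.conv 0 B.d f = BiFamily.conv 1 (BiFamily.alt f) A.d) ↔ ∀ (l : ℕ) (p q p' q' : ℤ),
    ∑ ij ∈ Finset.HasAntidiagonal.antidiagonal l,
      B.d ij.1 (p - ij.2) (q - ij.2) p' q' ∘ₗ f ij.2 p q (p - ij.2) (q - ij.2) =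
    ∑ ij ∈ Finset.HasAntidiagonal.antidiagonal l, (-1 : ℤ) ^ ij.1 •
      (f ij.1 (p - ij.2) (q + 1 - ij.2) p' q' ∘ₗ A.d ij.2 p q (p - ij.2) (q + 1 - ij.2)) := by
  have key : ∀ (l : ℕ) (p q p' q' : ℤ),
      ∑ ij ∈ Finset.HasAntidiagonal.antidiagonal l,
        B.d ij.1 (p - ij.2) (q - ij.2) p' q' ∘ₗ f ij.2 p q (p - ij.2) (q - ij.2) =
      BiFamily.conv 0 B.d f l p q p' q' := by
    intro l p q p' q'
    refine Finset.sum_congr rfl fun ij _ => ?_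
    exact BiFamily.comp_index B.d f _ _ _ _ _ _ _ _ _ _ rfl (by ring)
  constructor
  · intro h l p q p' q'
    rw [key, h]
    simp [BiFamily.conv, BiFamily.alt, LinearMap.smul_comp]
  · intro h
    funext l p q p' q'
    rw [← key, h]
    simp [BiFamily.conv, BiFamily.alt, LinearMap.smul_comp]

lemma Hom.conv_comm {A B : Multicomplex.{u, v} R} (f : Hom A B) :
    BiFamily.conv 0 B.d f.f = BiFamily.conv 1 (BiFamily.alt f.f) A.d :=
  (comm_iff_conv f.f).2 f.comm

lemma conv_zero_index {X Y Z : ℤ → ℤ → ModuleCat.{v} R} (g : BiFamily Y Z) (f : BiFamily X Y)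
    (l : ℕ) (p q p' q' : ℤ) : BiFamily.conv 0 g f l p q p' q' = ∑ ij ∈ Finset.HasAntidiagonal.antidiagonal l,
      g ij.1 (p - ij.2) (q - ij.2) p' q' ∘ₗ f ij.2 p q (p - ij.2) (q - ij.2) := by
  refine Finset.sum_congr rfl fun ij _ => ?_
  exact BiFamily.comp_index g f _ _ _ _ _ _ _ _ _ _ rfl (by ring)

/-- The identity, as an `∞`-morphism. -/
def Hom.id (A : Multicomplex.{u, v} R) : Hom A A where
  f m p q p' q' := if m = 0 then bigradedId A.X p q p' q' else 0
  shape m p q p' q' h := by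
    split_ifs with hm
    · subst hm; exact bigradedId_ne _ _ _ _ (by simpa [eq_comm] using h)
    · rfl
  comm l p q p' q' := by
    rw [Finset.sum_eq_single (l, 0), Finset.sum_eq_single (0, l)]
    · by_cases h : p' = p - l ∧ q' = q + 1 - l
      · obtain ⟨rfl, rfl⟩ := h
        simp
        have := BiFamily.comp_index A.d (fun _ => bigradedId A.X) l 0 p q (p - (0 : ℕ)) (q - (0 : ℕ)) p q (p - l) (q + 1 - l)
          (by simp) (by simp)
        simpa using this
      · rw [A.shape]
        · simp [bigradedId_ne (X := A.X) (p - l) (q + 1 - l) p' q' (by simpa [eq_comm] using h)]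
        · simpa using h
    · rintro ⟨a, b⟩ h1 h2
      have : a ≠ 0 := by rintro rfl; simp at h1 h2; omega
      simp [this]
    · simp
    · rintro ⟨a, b⟩ h1 h2
      have : b ≠ 0 := by rintro rfl; simp at h1 h2; omega
      simp [this]
    · simp

lemma conv_comm_comp {A B C : Multicomplex.{u, v} R} (f : Hom A B) (g : Hom B C) :
    BiFamily.conv 0 C.d (BiFamily.conv 0 g.f f.f) =
      BiFamily.conv 1 (BiFamily.alt (BiFamily.conv 0 g.f f.f)) A.d := by
  rw [BiFamily.alt_conv, BiFamily.conv_assoc 1 0]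
  refine (BiFamily.conv_assoc 0 0 C.d _ _).symm.trans ?_
  rw [g.conv_comm]
  refine (BiFamily.conv_assoc 0 1 _ _ _).trans ?_
  rw [f.conv_comm]
  rfl

/-- The composition of `∞`-morphisms, `(g f)_l = ∑_{i + j = l} g_i f_j`. -/
def Hom.comp {A B C : Multicomplex.{u, v} R} (f : Hom A B) (g : Hom B C) : Hom A C where
  f l p q p' q' := ∑ ij ∈ Finset.HasAntidiagonal.antidiagonal l,
    g.f ij.1 (p - ij.2) (q - ij.2) p' q' ∘ₗ f.f ij.2 p q (p - ij.2) (q - ij.2)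
  shape l p q p' q' h := by
    refine Finset.sum_eq_zero fun ij hij => ?_
    rw [g.shape, LinearMap.zero_comp]
    have := Finset.HasAntidiagonal.mem_antidiagonal.mp hij
    omega
  comm := by
    have h := (comm_iff_conv _).1 (conv_comm_comp f g)
    simpa only [conv_zero_index] using h

lemma Hom.comp_f {A B C : Multicomplex.{u, v} R} (f : Hom A B) (g : Hom B C) :
    (f.comp g).f = BiFamily.conv 0 g.f f.f := by
  funext l p q p' q'
  rw [conv_zero_index]; rfl

lemma conv_id {A : Multicomplex.{u, v} R} {Y : ℤ → ℤ → ModuleCat.{v} R} (g : BiFamily A.X Y) :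
    BiFamily.conv 0 g (Hom.id A).f = g := by
  funext l p q p' q'
  rw [conv_zero_index, Finset.sum_eq_single (l, 0)]
  · have := BiFamily.comp_index g (fun _ => bigradedId A.X) l 0 p q (p - (0 : ℕ)) (q - (0 : ℕ)) p q p' q'
      (by simp) (by simp)
    simpa [Hom.id] using this
  · rintro ⟨a, b⟩ h1 h2
    have : b ≠ 0 := by rintro rfl; simp at h1 h2; omega
    simp [this, Hom.id]
  · simp

lemma id_conv {A : Multicomplex.{u, v} R} {Y : ℤ → ℤ → ModuleCat.{v} R} (g : BiFamily Y A.X)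
    (hg : BiFamily.HasShift 0 g) : BiFamily.conv 0 (Hom.id A).f g = g := by
  funext l p q p' q'
  rw [conv_zero_index, Finset.sum_eq_single (0, l)]
  · by_cases h : p' = p - l ∧ q' = q - l
    · obtain ⟨rfl, rfl⟩ := h
      simp [Hom.id]
    · rw [hg l p q p' q' (by simpa using h)]
      simp [Hom.id, bigradedId_ne (X := A.X) (p - l) (q - l) p' q' (by simpa [eq_comm] using h)]
  · rintro ⟨a, b⟩ h1 h2
    have : a ≠ 0 := by rintro rfl; simp at h1 h2; omega
    simp [this, Hom.id]
  · simp

/-- The category of multicomplexes and `∞`-morphisms. -/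
instance : Category (Multicomplex.{u, v} R) where
  Hom := Hom
  id := Hom.id
  comp := Hom.comp
  id_comp f := by
    apply Hom.ext
    rw [Hom.comp_f, conv_id]
  comp_id f := by
    apply Hom.ext
    rw [Hom.comp_f, id_conv _ f.f_hasShift]
  assoc f g h := by
    apply Hom.ext
    simp only [Hom.comp_f]
    exact (BiFamily.conv_assoc 0 0 _ _ _).symm

end Multicomplex

/-! ### `n`-multicomplexes and strict morphisms -/

section NMulticomplex

variable {R : Type u} [CommRing R]

/-- A strict morphism of multicomplexes: a map of bidegree `(0, 0)` which commutes with
all `d i`. -/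
@[ext]
structure Multicomplex.StrictHom (A B : Multicomplex.{u, v} R) where
  f (p q : ℤ) : A.X p q →ₗ[R] B.X p q
  comm (i : ℕ) (p q p' q' : ℤ) : B.d i p q p' q' ∘ₗ f p q = f p' q' ∘ₗ A.d i p q p' q'

/-- A strict morphism `f`, regarded as the `∞`-morphism with `f_0 = f` and `f_m = 0` for
`m > 0`. -/
def Multicomplex.StrictHom.toHom {A B : Multicomplex.{u, v} R} (f : A.StrictHom B) : A ⟶ B where
  f m p q p' q' := if m = 0 then bigradedId B.X p q p' q' ∘ₗ f.f p q else 0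
  shape m p q p' q' h := by
    split_ifs with hm
    · subst hm
      rw [bigradedId_ne _ _ _ _ (by simpa [eq_comm] using h), LinearMap.zero_comp]
    · rfl
  comm l p q p' q' := by
    rw [Finset.sum_eq_single (l, 0), Finset.sum_eq_single (0, l)]
    · by_cases h : p' = p - l ∧ q' = q + 1 - l
      · obtain ⟨rfl, rfl⟩ := h
        have h1 := BiFamily.comp_index B.d (fun _ => bigradedId B.X) l 0 p q (p - (0 : ℕ))
          (q - (0 : ℕ)) p q (p - l) (q + 1 - l) (by simp) (by simp)
        simp only [if_true, bigradedId_self, pow_zero, one_smul, LinearMap.id_comp]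
        rw [← LinearMap.comp_assoc, h1, bigradedId_self, LinearMap.comp_id, f.comm]
      · rw [B.shape _ _ _ _ _ (by simpa using h)]
        have h2 := bigradedId_ne (X := B.X) (p - l) (q + 1 - l) p' q'
          (by simpa [eq_comm] using h)
        simp [h2]
    · rintro ⟨a, b⟩ h1 h2
      have : a ≠ 0 := by rintro rfl; simp at h1 h2; omega
      simp [this]
    · simp
    · rintro ⟨a, b⟩ h1 h2
      have : b ≠ 0 := by rintro rfl; simp at h1 h2; omega
      simp [this]
    · simp

/-- An `n`-multicomplex, `n ≤ ∞`: a multicomplex with `d i = 0` for all `i ≥ n`. -/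
structure NMulticomplex (R : Type u) [CommRing R] (n : ℕ∞) extends Multicomplex.{u, v} R where
  trunc (i : ℕ) (hi : n ≤ i) (p q p' q' : ℤ) : d i p q p' q' = 0

namespace NMulticomplex

/-- The category of `n`-multicomplexes and strict morphisms. -/
instance (n : ℕ∞) : Category (NMulticomplex.{u, v} R n) where
  Hom A B := A.toMulticomplex.StrictHom B.toMulticomplex
  id A := { f p q := LinearMap.id, comm _ _ _ _ _ := rfl }
  comp f g :=
    { f p q := g.f p q ∘ₗ f.f p q
      comm i p q p' q' := by
        rw [← LinearMap.comp_assoc, g.comm, LinearMap.comp_assoc, f.comm, LinearMap.comp_assoc] }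

/-- The inclusion of `n`-multicomplexes and strict morphisms into multicomplexes and
`∞`-morphisms. -/
def incl (n : ℕ∞) : NMulticomplex.{u, v} R n ⥤ Multicomplex.{u, v} R where
  obj A := A.toMulticomplex
  map f := Multicomplex.StrictHom.toHom f
  map_id A := by
    apply Multicomplex.Hom.ext
    funext m p q p' q'
    change (if m = 0 then bigradedId A.X p q p' q' ∘ₗ LinearMap.id else 0) =
      if m = 0 then bigradedId A.X p q p' q' else 0
    simp
  map_comp {A B C} f g := by
    apply Multicomplex.Hom.ext
    refine Eq.trans ?_ (Multicomplex.Hom.comp_f (Multicomplex.StrictHom.toHom f)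
      (Multicomplex.StrictHom.toHom g)).symm
    funext m p q p' q'
    rw [Multicomplex.conv_zero_index, Finset.sum_eq_single (m, 0)]
    · by_cases hm : m = 0
      · subst hm
        have h1 := BiFamily.comp_index (fun _ => bigradedId C.X)
          (fun _ a b c d => g.f c d ∘ₗ bigradedId B.X a b c d) 0 0 p q (p - (0 : ℕ))
          (q - (0 : ℕ)) p q p' q' (by simp) (by simp)
        simp only [Multicomplex.StrictHom.toHom, if_true]
        rw [LinearMap.comp_assoc, ← LinearMap.comp_assoc (f.f p q), ← LinearMap.comp_assoc (f.f p q),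
          h1, bigradedId_self]
        rfl
      · simp [Multicomplex.StrictHom.toHom, hm]
    · rintro ⟨a, b⟩ h1 h2
      have : b ≠ 0 := by rintro rfl; simp at h1 h2; omega
      simp [this, Multicomplex.StrictHom.toHom]
    · simp

/-- The inclusion of `n`-multicomplexes into `∞`-multicomplexes, with strict morphisms. -/
def inclTop (n : ℕ∞) : NMulticomplex.{u, v} R n ⥤ NMulticomplex.{u, v} R ⊤ where
  obj A := { A.toMulticomplex with trunc i hi := by simp at hi }
  map f := f
  map_id _ := rfl
  map_comp _ _ := rfl

end NMulticomplex

end NMulticomplex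

/-! ### Tensor products with finite free multicomplexes, and path objects -/

/-- A multicomplex of free modules of finite rank, given by a finite homogeneous basis `B` and
the integral matrices of its differentials: `d_m b = ∑ b', c m b b' • b'`. -/
structure FreeMulticomplex where
  B : Type
  [fin : Fintype B]
  degP : B → ℤ
  degQ : B → ℤ
  c : ℕ → B → B → ℤ
  shape (m : ℕ) (b b' : B) (h : ¬ (degP b' = degP b - m ∧ degQ b' = degQ b + 1 - m)) :
    c m b b' = 0
  rel (l : ℕ) (b b'' : B) : ∑ ij ∈ Finset.HasAntidiagonal.antidiagonal l,
    (-1 : ℤ) ^ ij.1 * ∑ b', c ij.2 b b' * c ij.1 b' b'' = 0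

namespace FreeMulticomplex

attribute [instance] FreeMulticomplex.fin

variable {R : Type u} [CommRing R] (Λ : FreeMulticomplex)

/-- The Koszul sign `(-1)^⟨b, d_m⟩`, where `d_m` is of bidegree `(-m, 1 - m)` and
`⟨(a, a'), (b, b')⟩ = a b + a' b'`. -/
def sign (m : ℕ) (b : Λ.B) : ℤ := (Int.negOnePow (Λ.degP b * (-m) + Λ.degQ b * (1 - m)) : ℤˣ)

/-- The differential of `Λ ⊗ A`:
`d_m (b ⊗ x) = d_m b ⊗ x + (-1)^⟨b, d_m⟩ b ⊗ d_m x`. -/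
def tensorD (A : Multicomplex.{u, v} R) (m : ℕ) (p q p' q' : ℤ) :
    (∀ b, A.X (p - Λ.degP b) (q - Λ.degQ b)) →ₗ[R] (∀ b, A.X (p' - Λ.degP b) (q' - Λ.degQ b)) :=
  LinearMap.pi fun b' =>
    Λ.sign m b' • (A.d m (p - Λ.degP b') (q - Λ.degQ b') (p' - Λ.degP b') (q' - Λ.degQ b') ∘ₗ
      LinearMap.proj b') +
    ∑ b, Λ.c m b b' • (bigradedId A.X (p - Λ.degP b) (q - Λ.degQ b)
      (p' - Λ.degP b') (q' - Λ.degQ b') ∘ₗ LinearMap.proj b)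

lemma sign_mul (l : ℕ) (b : Λ.B) (i j : ℕ) (h : i + j = l) : Λ.sign i b * Λ.sign j b =
    (Int.negOnePow (-(Λ.degP b * l) + Λ.degQ b * (2 - l)) : ℤˣ) := by
  simp only [sign]
  rw [← Units.val_mul, ← Int.negOnePow_add]
  congr 2
  subst h
  push_cast
  ring

lemma sign_cross (i j : ℕ) (b b' : Λ.B) (h : Λ.degP b' = Λ.degP b - j)
    (h' : Λ.degQ b' = Λ.degQ b + 1 - j) :
    (-1 : ℤ) ^ i * Λ.sign i b' + (-1) ^ j * Λ.sign i b = 0 := by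
  have e : ∀ k : ℕ, (-1 : ℤ) ^ k = (Int.negOnePow k : ℤˣ) := fun k => by
    simp [Int.negOnePow_def]
  rw [e, e]
  simp only [sign]
  rw [← Units.val_mul, ← Units.val_mul, ← Int.negOnePow_add, ← Int.negOnePow_add]
  rw [show (i : ℤ) + (Λ.degP b' * (-i) + Λ.degQ b' * (1 - i)) =
    (j + (Λ.degP b * (-i) + Λ.degQ b * (1 - i))) + 1 + 2 * ((j : ℤ) * (i - 1)) by
      rw [h, h']; ring]
  rw [Int.negOnePow_add, Int.negOnePow_succ]
  have : Int.negOnePow (2 * ((j : ℤ) * (i - 1))) = 1 := Int.negOnePow_even _ (by simp)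
  rw [this]
  simp

lemma tensorD_apply (A : Multicomplex.{u, v} R) (m : ℕ) (p q p' q' : ℤ)
    (x : ∀ b, A.X (p - Λ.degP b) (q - Λ.degQ b)) (b' : Λ.B) :
    Λ.tensorD A m p q p' q' x b' =
      Λ.sign m b' • A.d m (p - Λ.degP b') (q - Λ.degQ b') (p' - Λ.degP b') (q' - Λ.degQ b')
        (x b') +
      ∑ b, Λ.c m b b' • bigradedId A.X (p - Λ.degP b) (q - Λ.degQ b)
        (p' - Λ.degP b') (q' - Λ.degQ b') (x b) := by
  simp [tensorD]

lemma bigradedId_trans {X : ℤ → ℤ → ModuleCat.{v} R} (p q a b p' q' : ℤ)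
    (h : p = a ∧ q = b) (x : X p q) :
    bigradedId X a b p' q' (bigradedId X p q a b x) = bigradedId X p q p' q' x := by
  obtain ⟨rfl, rfl⟩ := h
  simp

lemma d_bigradedId (A : Multicomplex.{u, v} R) (m : ℕ) (p q a b p' q' a' b' : ℤ)
    (h : p = a ∧ q = b) (h' : p' = a' ∧ q' = b') (x : A.X p q) :
    A.d m a b a' b' (bigradedId A.X p q a b x) =
      bigradedId A.X p' q' a' b' (A.d m p q p' q' x) := by
  obtain ⟨rfl, rfl⟩ := h
  obtain ⟨rfl, rfl⟩ := h'
  simp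

lemma d_d_index (A : Multicomplex.{u, v} R) (i j : ℕ) (p q a b a' b' p' q' : ℤ)
    (h : a = a') (h' : b = b') (x : A.X p q) :
    A.d i a b p' q' (A.d j p q a b x) = A.d i a' b' p' q' (A.d j p q a' b' x) := by
  subst h h'; rfl

lemma tensorD_rel (A : Multicomplex.{u, v} R) (l : ℕ) (p q p' q' : ℤ)
    (x : ∀ b, A.X (p - Λ.degP b) (q - Λ.degQ b)) (b'' : Λ.B) :
    ∑ ij ∈ Finset.HasAntidiagonal.antidiagonal l, (-1 : ℤ) ^ ij.1 •
      (Λ.tensorD A ij.1 (p - ij.2) (q + 1 - ij.2) p' q'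
        (Λ.tensorD A ij.2 p q (p - ij.2) (q + 1 - ij.2) x) b'') = 0 := by
  simp only [tensorD_apply, map_add, map_sum, map_zsmul, smul_add, Finset.smul_sum, smul_smul,
    Finset.sum_add_distrib]
  -- the four kinds of terms
  have T1 : ∑ ij ∈ Finset.HasAntidiagonal.antidiagonal l,
      ((-1 : ℤ) ^ ij.1 * (Λ.sign ij.1 b'' * Λ.sign ij.2 b'')) •
        A.d ij.1 (p - ij.2 - Λ.degP b'') (q + 1 - ij.2 - Λ.degQ b'') (p' - Λ.degP b'')
          (q' - Λ.degQ b'')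
          (A.d ij.2 (p - Λ.degP b'') (q - Λ.degQ b'') (p - ij.2 - Λ.degP b'')
            (q + 1 - ij.2 - Λ.degQ b'') (x b'')) = 0 := by
    have h := LinearMap.congr_fun (A.rel l (p - Λ.degP b'') (q - Λ.degQ b'') (p' - Λ.degP b'')
      (q' - Λ.degQ b'')) (x b'')
    have h2 := congrArg (fun y => ((Int.negOnePow (-(Λ.degP b'' * l) + Λ.degQ b'' * (2 - l)) :
      ℤˣ) : ℤ) • y) h
    simp only [LinearMap.sum_apply, LinearMap.smul_apply, LinearMap.comp_apply,
      LinearMap.zero_apply, smul_zero, Finset.smul_sum, smul_smul] at h2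
    rw [← h2]
    refine Finset.sum_congr rfl fun ij hij => ?_
    rw [Λ.sign_mul l b'' ij.1 ij.2 (Finset.HasAntidiagonal.mem_antidiagonal.mp hij), mul_comm]
    congr 1
    exact d_d_index A _ _ _ _ _ _ _ _ _ _ (by ring) (by ring) _
  have T4 : ∑ ij ∈ Finset.HasAntidiagonal.antidiagonal l, ∑ b', ∑ b,
      ((-1 : ℤ) ^ ij.1 * (Λ.c ij.1 b' b'' * Λ.c ij.2 b b')) •
        bigradedId A.X (p - ij.2 - Λ.degP b') (q + 1 - ij.2 - Λ.degQ b') (p' - Λ.degP b'')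
          (q' - Λ.degQ b'') (bigradedId A.X (p - Λ.degP b) (q - Λ.degQ b)
            (p - ij.2 - Λ.degP b') (q + 1 - ij.2 - Λ.degQ b') (x b)) = 0 := by
    have h : ∀ ij ∈ Finset.HasAntidiagonal.antidiagonal l, (∑ b', ∑ b,
      ((-1 : ℤ) ^ ij.1 * (Λ.c ij.1 b' b'' * Λ.c ij.2 b b')) •
        bigradedId A.X (p - ij.2 - Λ.degP b') (q + 1 - ij.2 - Λ.degQ b') (p' - Λ.degP b'')
          (q' - Λ.degQ b'') (bigradedId A.X (p - Λ.degP b) (q - Λ.degQ b)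
            (p - ij.2 - Λ.degP b') (q + 1 - ij.2 - Λ.degQ b') (x b))) =
      ∑ b, ((-1 : ℤ) ^ ij.1 * ∑ b', Λ.c ij.2 b b' * Λ.c ij.1 b' b'') •
        bigradedId A.X (p - Λ.degP b) (q - Λ.degQ b) (p' - Λ.degP b'')
          (q' - Λ.degQ b'') (x b) := by
      intro ij _
      rw [Finset.sum_comm]
      refine Finset.sum_congr rfl fun b _ => ?_
      rw [Finset.mul_sum, Finset.sum_smul]
      refine Finset.sum_congr rfl fun b' _ => ?_
      by_cases hc : Λ.degP b' = Λ.degP b - ij.2 ∧ Λ.degQ b' = Λ.degQ b + 1 - ij.2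
      · rw [bigradedId_trans _ _ _ _ _ _ (by omega), mul_comm (Λ.c ij.2 b b')]
      · rw [Λ.shape _ _ _ hc]; simp
    rw [Finset.sum_congr rfl h, Finset.sum_comm]
    refine Finset.sum_eq_zero fun b _ => ?_
    rw [← Finset.sum_smul, Λ.rel, zero_smul]
  have T23 : ∑ ij ∈ Finset.HasAntidiagonal.antidiagonal l, ∑ b,
      ((-1 : ℤ) ^ ij.1 * (Λ.sign ij.1 b'' * Λ.c ij.2 b b'')) •
        A.d ij.1 (p - ij.2 - Λ.degP b'') (q + 1 - ij.2 - Λ.degQ b'') (p' - Λ.degP b'')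
          (q' - Λ.degQ b'') (bigradedId A.X (p - Λ.degP b) (q - Λ.degQ b)
            (p - ij.2 - Λ.degP b'') (q + 1 - ij.2 - Λ.degQ b'') (x b)) +
      ∑ ij ∈ Finset.HasAntidiagonal.antidiagonal l, ∑ b,
      ((-1 : ℤ) ^ ij.1 * (Λ.c ij.1 b b'' * Λ.sign ij.2 b)) •
        bigradedId A.X (p - ij.2 - Λ.degP b) (q + 1 - ij.2 - Λ.degQ b) (p' - Λ.degP b'')
          (q' - Λ.degQ b'') (A.d ij.2 (p - Λ.degP b) (q - Λ.degQ b)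
            (p - ij.2 - Λ.degP b) (q + 1 - ij.2 - Λ.degQ b) (x b)) = 0 := by
    rw [← Finset.Nat.sum_antidiagonal_swap (n := l) (f := fun ij => ∑ b,
      ((-1 : ℤ) ^ ij.1 * (Λ.c ij.1 b b'' * Λ.sign ij.2 b)) •
        bigradedId A.X (p - ij.2 - Λ.degP b) (q + 1 - ij.2 - Λ.degQ b) (p' - Λ.degP b'')
          (q' - Λ.degQ b'') (A.d ij.2 (p - Λ.degP b) (q - Λ.degQ b)
            (p - ij.2 - Λ.degP b) (q + 1 - ij.2 - Λ.degQ b) (x b))), ← Finset.sum_add_distrib]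
    refine Finset.sum_eq_zero fun ij _ => ?_
    rw [← Finset.sum_add_distrib]
    refine Finset.sum_eq_zero fun b _ => ?_
    simp only [Prod.fst_swap, Prod.snd_swap]
    by_cases hc : Λ.degP b'' = Λ.degP b - ij.2 ∧ Λ.degQ b'' = Λ.degQ b + 1 - ij.2
    · by_cases hd : p' = p - ij.1 - ij.2 ∧ q' = q + 2 - ij.1 - ij.2
      · rw [d_bigradedId A ij.1 _ _ _ _ (p - ij.1 - Λ.degP b) (q + 1 - ij.1 - Λ.degQ b) _ _
          (by omega) (by omega), ← add_smul]
        have := Λ.sign_cross ij.1 ij.2 b b'' hc.1 hc.2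
        rw [show (-1 : ℤ) ^ ij.1 * (Λ.sign ij.1 b'' * Λ.c ij.2 b b'') +
          (-1) ^ ij.2 * (Λ.c ij.2 b b'' * Λ.sign ij.1 b) = ((-1 : ℤ) ^ ij.1 * Λ.sign ij.1 b'' +
          (-1) ^ ij.2 * Λ.sign ij.1 b) * Λ.c ij.2 b b'' by ring, this]
        simp
      · rw [A.shape ij.1 _ _ _ _ (by omega),
          bigradedId_ne (p - ij.1 - Λ.degP b) (q + 1 - ij.1 - Λ.degQ b) _ _ (by omega)]
        simp
    · rw [Λ.shape _ _ _ hc]; simp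
  rw [T1, zero_add, T4, add_zero]
  exact T23

/-- The tensor product `Λ ⊗ A`. -/
def tensor (A : Multicomplex.{u, v} R) : Multicomplex.{u, v} R where
  X p q := ModuleCat.of R (∀ b, A.X (p - Λ.degP b) (q - Λ.degQ b))
  d m p q p' q' := Λ.tensorD A m p q p' q'
  shape m p q p' q' h := by
    ext x b'
    simp only [tensorD, LinearMap.pi_apply, LinearMap.add_apply, LinearMap.smul_apply,
      LinearMap.sum_apply, LinearMap.comp_apply, LinearMap.proj_apply, LinearMap.zero_apply]
    rw [A.shape _ _ _ _ _ (by omega)]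
    simp only [LinearMap.zero_apply, smul_zero, zero_add]
    refine Finset.sum_eq_zero fun b _ => ?_
    by_cases hc : Λ.degP b' = Λ.degP b - m ∧ Λ.degQ b' = Λ.degQ b + 1 - m
    · rw [bigradedId_ne _ _ _ _ (by omega)]; simp
    · rw [Λ.shape _ _ _ hc]; simp
  rel l p q p' q' := by
    ext x b''
    have h := Λ.tensorD_rel A l p q p' q' x b''
    simp only [LinearMap.sum_apply, Finset.sum_apply]
    exact h

end FreeMulticomplex

namespace FreeMulticomplex

variable {R : Type u} [CommRing R] (Λ : FreeMulticomplex)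

/-- The strict morphism `Λ ⊗ f`. -/
def tensorMap {A B : Multicomplex.{u, v} R} (f : A.StrictHom B) :
    (Λ.tensor A).StrictHom (Λ.tensor B) where
  f p q := LinearMap.pi fun b => f.f (p - Λ.degP b) (q - Λ.degQ b) ∘ₗ LinearMap.proj b
  comm m p q p' q' := by
    refine LinearMap.ext fun (x : ∀ b, A.X (p - Λ.degP b) (q - Λ.degQ b)) => ?_
    refine funext fun b' => ?_
    change Λ.tensorD B m p q p' q' (fun b => f.f (p - Λ.degP b) (q - Λ.degQ b) (x b)) b' =
      f.f (p' - Λ.degP b') (q' - Λ.degQ b') (Λ.tensorD A m p q p' q' x b')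
    rw [tensorD_apply, tensorD_apply, map_add, map_sum, map_zsmul]
    congr 1
    · congr 1
      exact LinearMap.congr_fun (f.comm _ _ _ _ _) _
    · refine Finset.sum_congr rfl fun b _ => ?_
      rw [map_zsmul]
      congr 1
      by_cases h : p - Λ.degP b = p' - Λ.degP b' ∧ q - Λ.degQ b = q' - Λ.degQ b'
      · generalize p' - Λ.degP b' = s at *
        generalize q' - Λ.degQ b' = t at *
        obtain ⟨rfl, rfl⟩ := h
        simp
      · simp [bigradedId_ne _ _ _ _ h]

/-- All differentials `d m` of `Λ` with `m ≥ n` vanish. -/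
def IsTruncated (n : ℕ∞) : Prop := ∀ m : ℕ, n ≤ m → ∀ b b', Λ.c m b b' = 0

/-- The functor `Λ ⊗ -` on `n`-multicomplexes, for an `n`-multicomplex `Λ`. -/
def tensorFunctor {n : ℕ∞} (hΛ : Λ.IsTruncated n) :
    NMulticomplex.{u, v} R n ⥤ NMulticomplex.{u, v} R n where
  obj A :=
    { Λ.tensor A.toMulticomplex with
      trunc := by
        intro m hm p q p' q'
        refine LinearMap.ext fun x => funext fun b' => ?_
        refine (tensorD_apply Λ A.toMulticomplex m p q p' q' x b').trans ?_
        rw [A.trunc m hm]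
        simp only [hΛ m hm, zero_smul, Finset.sum_const_zero, LinearMap.zero_apply, smul_zero,
          add_zero]
        rfl }
  map f := Λ.tensorMap f
  map_id _ := rfl
  map_comp _ _ := rfl

/-- The projection `Λ ⊗ A → A` onto the summand of a basis element of bidegree `(0, 0)` which
does not occur in any differential. -/
def proj (e : Λ.B) (hp : Λ.degP e = 0) (hq : Λ.degQ e = 0) (hc : ∀ m b, Λ.c m b e = 0)
    (A : Multicomplex.{u, v} R) : (Λ.tensor A).StrictHom A where
  f p q := bigradedId A.X (p - Λ.degP e) (q - Λ.degQ e) p q ∘ₗ LinearMap.proj e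
  comm m p q p' q' := by
    refine LinearMap.ext fun (x : ∀ b, A.X (p - Λ.degP b) (q - Λ.degQ b)) => ?_
    change A.d m p q p' q' (bigradedId A.X (p - Λ.degP e) (q - Λ.degQ e) p q (x e)) =
      bigradedId A.X (p' - Λ.degP e) (q' - Λ.degQ e) p' q' (Λ.tensorD A m p q p' q' x e)
    rw [tensorD_apply, d_bigradedId A m _ _ _ _ (p' - Λ.degP e) (q' - Λ.degQ e) _ _
      (by omega) (by omega)]
    simp [hc, sign, hp, hq]

/-- `Λ_r`: generated by `e_-` (`inl false`) and `e_+` (`inl true`) in bidegree `(0, 0)` and `u`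
(`inr ()`) in bidegree `(-r, 1 - r)`, with `d_r e_- = -u`, `d_r e_+ = u` and all other
differentials zero. -/
def interval (r : ℕ) : FreeMulticomplex where
  B := Bool ⊕ Unit
  degP := Sum.elim (fun _ => 0) (fun _ => -r)
  degQ := Sum.elim (fun _ => 0) (fun _ => 1 - r)
  c m b b' := match b, b' with
    | .inl ε, .inr _ => if m = r then (if ε then 1 else -1) else 0
    | _, _ => 0
  shape m b b' h := by
    rcases b with ε | _ <;> rcases b' with ε' | _ <;> simp
    rintro rfl
    simp at h
  rel l b b'' := by
    refine Finset.sum_eq_zero fun ij _ => ?_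
    rw [Finset.sum_eq_zero, mul_zero]
    rintro b' -
    rcases b with ε | _ <;> rcases b' with ε' | _ <;> rcases b'' with ε'' | _ <;> simp

/-- The position of the `j`-th element of total degree one in `Λ_r^n`. -/
def stairPos (n r j : ℕ) : ℕ := min ((j + 1) * (n - 1)) r

/-- `Λ_r^n`, for `2 ≤ n < ∞`: the version of `Λ_r` in which `d_r` is replaced by a staircase of
`n`-multicomplex differentials. With `N = n - 1` and `k = ⌊(r - 1) / N⌋`, it is generated by
`e_-` (`inl false`) and `e_+` (`inl true`) in bidegree `(0, 0)`, by `z_1, …, z_k`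
(`inr (inl _)`) with `z_i` in bidegree `(-iN, -iN)`, and by `x_0, …, x_k` (`inr (inr _)`) with
`x_j` in bidegree `(-t_j, 1 - t_j)`, where `t_j = (j + 1)N` for `j < k` and `t_k = r`. The
nonzero differentials are `d_{t_0} e_- = -x_0`, `d_{t_0} e_+ = x_0`, `d_0 z_i = x_{i - 1}` and
`d_{t_i - iN} z_i = x_i`; thus each step is made by `d_N`, except possibly the last one.
For `r < n` this is `Λ_r`, with `x_0 = u`. -/
def staircase (n r : ℕ) : FreeMulticomplex where
  B := Bool ⊕ Fin ((r - 1) / (n - 1)) ⊕ Fin ((r - 1) / (n - 1) + 1)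
  degP := Sum.elim (fun _ => 0)
    (Sum.elim (fun i => -((i + 1) * (n - 1) : ℕ)) (fun j => -stairPos n r j))
  degQ := Sum.elim (fun _ => 0)
    (Sum.elim (fun i => -((i + 1) * (n - 1) : ℕ)) (fun j => 1 - stairPos n r j))
  c m b b' := match b, b' with
    | .inl ε, .inr (.inr j) =>
      if j.1 = 0 ∧ m = stairPos n r 0 then (if ε then 1 else -1) else 0
    | .inr (.inl i), .inr (.inr j) =>
      if (j.1 = i.1 ∧ m = 0) ∨
        (j.1 = i.1 + 1 ∧ m = stairPos n r (i.1 + 1) - (i.1 + 1) * (n - 1)) then 1 else 0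
    | _, _ => 0
  shape m b b' h := by
    rcases b with ε | i | j <;> rcases b' with ε' | i' | j' <;> simp only
    · rw [if_neg]
      rintro ⟨h1, rfl⟩
      simp [h1] at h
    · rw [if_neg]
      have hi : (i.1 + 1) * (n - 1) ≤ r - 1 :=
        (Nat.mul_le_mul_right _ i.2).trans (Nat.div_mul_le_self _ _)
      rintro (⟨h1, rfl⟩ | ⟨h1, rfl⟩)
      · simp only [Sum.elim_inr, Sum.elim_inl, h1, stairPos] at h
        omega
      · simp only [Sum.elim_inr, Sum.elim_inl, h1, stairPos] at h
        have : (i.1 + 1) * (n - 1) ≤ (i.1 + 1 + 1) * (n - 1) :=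
          Nat.mul_le_mul_right _ (Nat.le_succ _)
        omega
  rel l b b'' := by
    refine Finset.sum_eq_zero fun ij _ => ?_
    rw [Finset.sum_eq_zero, mul_zero]
    rintro b' -
    rcases b with ε | i | j <;> rcases b' with ε' | i' | j' <;>
      rcases b'' with ε'' | i'' | j'' <;> simp

lemma interval_isTruncated_top (r : ℕ) : (interval r).IsTruncated ⊤ := by
  intro m hm
  simp at hm

lemma staircase_isTruncated (n r : ℕ) (hn : 2 ≤ n) : (staircase n r).IsTruncated n := by
  intro m hm b b'
  have hm' : n ≤ m := by exact_mod_cast hm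
  rcases b with ε | i | j <;> rcases b' with ε' | i' | j' <;> simp only [staircase]
  · rw [if_neg]
    rintro ⟨-, h⟩
    simp only [stairPos] at h
    omega
  · rw [if_neg]
    rintro (⟨-, h⟩ | ⟨-, h⟩)
    · omega
    · have : (i.1 + 1 + 1) * (n - 1) = (i.1 + 1) * (n - 1) + (n - 1) := by ring
      simp only [stairPos] at h
      omega

end FreeMulticomplex

namespace Multicomplex

variable {R : Type u} [CommRing R]

/-- The `r`-path `P_r(A) = Λ_r ⊗ A` of a multicomplex. -/
def path (r : ℕ) (A : Multicomplex.{u, v} R) : Multicomplex.{u, v} R :=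
  (FreeMulticomplex.interval r).tensor A

/-- The morphisms `∂^-` (for `ε = false`) and `∂^+` (for `ε = true`) from `P_r(A)` to `A`. -/
def pathEnd (r : ℕ) (ε : Bool) (A : Multicomplex.{u, v} R) : path r A ⟶ A :=
  ((FreeMulticomplex.interval r).proj (.inl ε) rfl rfl (fun _ b => by
    rcases b with _ | _ <;> rfl) A).toHom

/-- `f` and `g` are `r`-homotopic in multicomplexes: there is an `∞`-morphism `h : A → P_r(B)`
with `∂^- h = f` and `∂^+ h = g`. -/
def RHomotopic (r : ℕ) {A B : Multicomplex.{u, v} R} (f g : A ⟶ B) : Prop :=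
  ∃ h : A ⟶ path r B, h ≫ pathEnd r false B = f ∧ h ≫ pathEnd r true B = g

end Multicomplex

namespace NMulticomplex

variable {R : Type u} [CommRing R]

/-- The `r`-path functor `P_r = Λ_r ⊗ -` on multicomplexes and strict morphisms. -/
def pathTop (r : ℕ) : NMulticomplex.{u, v} R ⊤ ⥤ NMulticomplex.{u, v} R ⊤ :=
  (FreeMulticomplex.interval r).tensorFunctor (FreeMulticomplex.interval_isTruncated_top r)

/-- The `r`-path functor `P_r^n = Λ_r^n ⊗ -` on `n`-multicomplexes, `2 ≤ n < ∞`. -/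
def path (n : ℕ) (hn : 2 ≤ n) (r : ℕ) : NMulticomplex.{u, v} R n ⥤ NMulticomplex.{u, v} R n :=
  (FreeMulticomplex.staircase n r).tensorFunctor
    (FreeMulticomplex.staircase_isTruncated n r hn)

/-- The morphisms `∂^-` (for `ε = false`) and `∂^+` (for `ε = true`) from `P_r^n(A)` to `A`. -/
def pathEnd (n : ℕ) (hn : 2 ≤ n) (r : ℕ) (ε : Bool) (A : NMulticomplex.{u, v} R n) :
    (path n hn r).obj A ⟶ A :=
  (FreeMulticomplex.staircase n r).proj (.inl ε) rfl rfl (fun _ b => by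
    rcases b with _ | _ | _ <;> rfl) A.toMulticomplex

/-- `f` and `g` are `r`-homotopic in `n`-multicomplexes, `2 ≤ n < ∞`: there is a strict morphism
`h : A → P_r^n(B)` with `∂^- h = f` and `∂^+ h = g`. -/
def RHomotopic (n : ℕ) (hn : 2 ≤ n) (r : ℕ) {A B : NMulticomplex.{u, v} R n} (f g : A ⟶ B) :
    Prop :=
  ∃ h : A ⟶ (path n hn r).obj B,
    h ≫ pathEnd n hn r false B = f ∧ h ≫ pathEnd n hn r true B = g

end NMulticomplex

/-! ### Filtered complexes and totalization -/

/-- A filtered complex: a cochain complex of `R`-modules with an increasing filtration `F p n` of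
each `K.X n`, indexed by `p : ℤ` and preserved by the differential. -/
structure FilteredComplex (R : Type u) [CommRing R] where
  K : CochainComplex (ModuleCat.{v} R) ℤ
  F (p n : ℤ) : Submodule R (K.X n)
  mono (p n : ℤ) : F (p - 1) n ≤ F p n
  d_mem (p n : ℤ) (x : K.X n) (hx : x ∈ F p n) : (K.d n (n + 1)).hom x ∈ F p (n + 1)

namespace FilteredComplex

variable {R : Type u} [CommRing R]

/-- Morphisms of filtered complexes. -/
@[ext]
structure Hom (A B : FilteredComplex.{u, v} R) where
  f : A.K ⟶ B.K
  map_mem (p n : ℤ) (x : A.K.X n) (hx : x ∈ A.F p n) : (f.f n).hom x ∈ B.F p n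

instance : Category (FilteredComplex.{u, v} R) where
  Hom := Hom
  id A := { f := 𝟙 _, map_mem _ _ _ hx := hx }
  comp f g :=
    { f := f.f ≫ g.f
      map_mem p n x hx := g.map_mem p n _ (f.map_mem p n x hx) }

@[ext]
lemma hom_ext {A B : FilteredComplex.{u, v} R} {f g : A ⟶ B} (h : f.f = g.f) : f = g :=
  Hom.ext h

lemma mono_of_le (A : FilteredComplex.{u, v} R) {p p' : ℤ} (h : p ≤ p') (n : ℤ) :
    A.F p n ≤ A.F p' n := by
  obtain ⟨k, rfl⟩ := Int.le.dest h
  induction k with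
  | zero => simp
  | succ k ih =>
    refine (ih (by omega)).trans ?_
    have := A.mono (p + (k + 1 : ℕ)) n
    rwa [show p + ((k + 1 : ℕ) : ℤ) - 1 = p + k by push_cast; ring] at this

end FilteredComplex

section Tot

variable {R : Type u} [CommRing R]

/-- `Tot(X)^n = ∏_{p ≤ 0} X^{p, n + p} ⊕ ⨁_{p > 0} X^{p, n + p}`: the families
`(a_p)_{p ∈ ℤ}`, with `a_p ∈ X^{p, n + p}`, such that `a_p = 0` for all sufficiently large `p`. -/
def totModule (X : ℤ → ℤ → ModuleCat.{v} R) (n : ℤ) : Submodule R (∀ p, X p (n + p)) where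
  carrier := {a | ∃ N : ℤ, ∀ p, N < p → a p = 0}
  zero_mem' := ⟨0, fun _ _ => rfl⟩
  add_mem' := by
    rintro a b ⟨N, hN⟩ ⟨M, hM⟩
    refine ⟨max N M, fun p hp => ?_⟩
    rw [Pi.add_apply, hN p (by omega), hM p (by omega), add_zero]
  smul_mem' := by
    rintro c a ⟨N, hN⟩
    exact ⟨N, fun p hp => by rw [Pi.smul_apply, hN p hp, smul_zero]⟩

variable {X Y Z : ℤ → ℤ → ModuleCat.{v} R}

/-- The terms `(-1)^{mn} f_m (a_{j + m})`. -/
def totTerm (f : BiFamily X Y) (n n' : ℤ) (a : ∀ p, X p (n + p)) (j : ℤ) (m : ℕ) :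
    Y j (n' + j) :=
  ((Int.negOnePow (m * n) : ℤˣ) : ℤ) • f m (j + m) (n + (j + m)) j (n' + j) (a (j + m))

lemma finsum_totTerm (f : BiFamily X Y) (n n' : ℤ) (a : ∀ p, X p (n + p)) (j N : ℤ)
    (hN : ∀ p, N < p → a p = 0) (M : ℕ) (hM : N < j + M) :
    ∑ᶠ m, totTerm f n n' a j m = ∑ m ∈ Finset.range M, totTerm f n n' a j m := by
  refine finsum_eq_sum_of_support_subset _ fun m hm => ?_
  by_contra hc
  simp only [Finset.coe_range, Set.mem_Iio, not_lt] at hc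
  refine hm ?_
  simp [totTerm, hN (j + m) (by omega)]

lemma exists_bound (N j : ℤ) : ∃ M : ℕ, N < j + M := ⟨(N - j + 1).toNat, by omega⟩

/-- The map `Tot(X)^n → Tot(Y)^{n'}` induced by a family `f`:
`a ↦ (∑_m (-1)^{mn} f_m (a_{j + m}))_j`, where all sums are finite. -/
def totMap (f : BiFamily X Y) (n n' : ℤ) : totModule X n →ₗ[R] totModule Y n' where
  toFun a := ⟨fun j => ∑ᶠ m, totTerm f n n' a.1 j m, by
    obtain ⟨a, N, hN⟩ := a
    refine ⟨N, fun p hp => ?_⟩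
    simp only
    rw [finsum_totTerm f n n' a p N hN 0 (by simpa using hp)]
    simp⟩
  map_add' := by
    rintro ⟨a, N, hN⟩ ⟨b, N', hN'⟩
    ext j
    obtain ⟨M, hM⟩ := exists_bound (max N N') j
    simp only [Submodule.coe_add, Pi.add_apply]
    rw [finsum_totTerm f n n' a j N hN M (by omega),
      finsum_totTerm f n n' b j N' hN' M (by omega),
      finsum_totTerm f n n' _ j (max N N') (fun p hp => by
        rw [Pi.add_apply, hN p (by omega), hN' p (by omega), add_zero]) M hM,
      ← Finset.sum_add_distrib]
    simp [totTerm]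
  map_smul' := by
    rintro c ⟨a, N, hN⟩
    ext j
    obtain ⟨M, hM⟩ := exists_bound N j
    simp only [Submodule.coe_smul, Pi.smul_apply, RingHom.id_apply]
    rw [finsum_totTerm f n n' a j N hN M hM,
      finsum_totTerm f n n' _ j N (fun p hp => by
        rw [Pi.smul_apply, hN p hp, smul_zero]) M hM, Finset.smul_sum]
    refine Finset.sum_congr rfl fun m _ => ?_
    simp only [totTerm, Pi.smul_apply, map_smul]
    rw [smul_comm]

lemma totMap_apply (f : BiFamily X Y) (n n' : ℤ) (a : totModule X n) (j : ℤ) :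
    (totMap f n n' a).1 j = ∑ᶠ m, totTerm f n n' a.1 j m := rfl

lemma totMap_shape {b : ℤ} {f : BiFamily X Y} (hf : BiFamily.HasShift b f) (n n' : ℤ)
    (h : n' ≠ n + b) : totMap f n n' = 0 := by
  ext a j
  rw [totMap_apply]
  have : ∀ m, totTerm f n n' a.1 j m = 0 := fun m => by
    rw [totTerm, hf _ _ _ _ _ (by omega)]
    simp
  simp [this]

lemma totMap_apply_eq_zero (f : BiFamily X Y) (n n' : ℤ) (a : totModule X n) (p : ℤ)
    (ha : ∀ i, p < i → a.1 i = 0) (i : ℤ) (hi : p < i) : (totMap f n n' a).1 i = 0 := by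
  rw [totMap_apply, finsum_totTerm f n n' a.1 i p ha 0 (by simpa using hi)]
  simp

lemma totMap_comp (b : ℤ) (g : BiFamily Y Z) (f : BiFamily X Y) (n n' n'' : ℤ) (h : n' = n + b) :
    totMap g n' n'' ∘ₗ totMap f n n' = totMap (BiFamily.conv b
      (fun i p q p' q' => ((Int.negOnePow (i * b) : ℤˣ) : ℤ) • g i p q p' q') f) n n'' := by
  subst h
  ext ⟨a, N, hN⟩ j
  obtain ⟨M, hM⟩ := exists_bound N j
  rw [LinearMap.comp_apply, totMap_apply, totMap_apply,
    finsum_totTerm g _ _ _ j N (fun p hp => totMap_apply_eq_zero f n _ _ N hN p hp) M hM,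
    finsum_totTerm _ _ _ _ j N hN M hM]
  have h1 : ∀ i ∈ Finset.range M,
      totTerm g (n + b) n'' (totMap f n (n + b) ⟨a, N, hN⟩).1 j i =
      ∑ k ∈ Finset.range (M - i), ((Int.negOnePow (i * (n + b)) : ℤˣ) : ℤ) •
        g i (j + i) (n + b + (j + i)) j (n'' + j) (totTerm f n (n + b) a (j + i) k) := by
    intro i hi
    rw [totTerm, totMap_apply, finsum_totTerm f _ _ _ (j + i) N hN (M - i) (by
      have := Finset.mem_range.mp hi
      omega), map_sum, Finset.smul_sum]
  rw [Finset.sum_congr rfl h1, ← Finset.sum_range_diag_flip M (fun i k =>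
    ((Int.negOnePow (i * (n + b)) : ℤˣ) : ℤ) •
        g i (j + i) (n + b + (j + i)) j (n'' + j) (totTerm f n (n + b) a (j + i) k))]
  refine Finset.sum_congr rfl fun m _ => ?_
  rw [totTerm, BiFamily.conv, LinearMap.sum_apply, Finset.smul_sum,
    Finset.Nat.sum_antidiagonal_eq_sum_range_succ_mk]
  refine Finset.sum_congr rfl fun i hi => ?_
  have hi' : i ≤ m := by have := Finset.mem_range.mp hi; omega
  obtain ⟨k, rfl⟩ := Nat.exists_eq_add_of_le hi'
  simp only [Nat.add_sub_cancel_left, LinearMap.comp_apply, LinearMap.smul_apply, smul_smul]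
  rw [totTerm, map_zsmul, smul_smul]
  have e : ((Int.negOnePow (i * (n + b)) : ℤˣ) : ℤ) * ((Int.negOnePow (k * n) : ℤˣ) : ℤ) =
      ((Int.negOnePow ((i + k : ℕ) * n) : ℤˣ) : ℤ) * ((Int.negOnePow (i * b) : ℤˣ) : ℤ) := by
    rw [← Units.val_mul, ← Units.val_mul, ← Int.negOnePow_add, ← Int.negOnePow_add]
    congr 2
    push_cast
    ring
  rw [e]
  congr 1
  have key : ∀ (s t s' t' w : ℤ), s = s' → t = t' → w = j + (i + k : ℕ) →
      g i s t j (n'' + j) (f k w (n + w) s t (a w)) =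
      g i s' t' j (n'' + j) (f k (j + (i + k : ℕ)) (n + (j + (i + k : ℕ))) s' t'
        (a (j + (i + k : ℕ)))) := by
    rintro s t s' t' w rfl rfl rfl
    rfl
  exact key _ _ _ _ _ (by omega) (by omega) (by omega)

end Tot

namespace Multicomplex

variable {R : Type u} [CommRing R]

/-- The filtered complex `Tot(A)`, with `(d a)_j = ∑_m (-1)^{mn} d_m (a_{j + m})` for
`a ∈ Tot(A)^n`, and with the filtration `F_p Tot(A) = {a | a_i = 0 for all i > p}`. -/
def totObj (A : Multicomplex.{u, v} R) : FilteredComplex.{u, v} R where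
  K :=
    { X n := ModuleCat.of R (totModule A.X n)
      d n n' := ModuleCat.ofHom (totMap A.d n n')
      shape n n' h := by
        rw [totMap_shape A.d_hasShift n n' (fun e => h e.symm)]
        rfl
      d_comp_d' n n' n'' h _ := by
        rw [← ModuleCat.ofHom_comp, totMap_comp 1 A.d A.d n n' n'' h.symm]
        have e : (fun (i : ℕ) (p q p' q' : ℤ) =>
            ((Int.negOnePow (i * 1) : ℤˣ) : ℤ) • A.d i p q p' q') = BiFamily.alt A.d := by
          funext i p q p' q'
          simp [BiFamily.alt, Int.negOnePow_def]
        rw [e, A.conv_d]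
        have : totMap (0 : BiFamily A.X A.X) n n'' = 0 :=
          by ext a j; simp [totMap_apply, totTerm]
        rw [this]
        rfl }
  F p n :=
    { carrier := {a : totModule A.X n | ∀ i, p < i → a.1 i = 0}
      zero_mem' := fun _ _ => rfl
      add_mem' := fun {a b} ha hb i hi => by
        change a.1 i + b.1 i = 0
        rw [ha i hi, hb i hi, add_zero]
      smul_mem' := fun c a ha i hi => by
        change c • a.1 i = 0
        rw [ha i hi, smul_zero] }
  mono p n a ha i hi := ha i (by omega)
  d_mem p n a ha i hi := totMap_apply_eq_zero A.d n (n + 1) a p ha i hi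

lemma totMap_id (A : Multicomplex.{u, v} R) (n : ℤ) : totMap (Hom.id A).f n n = LinearMap.id := by
  ext a j
  rw [totMap_apply, finsum_eq_single _ 0 fun m hm => by simp [totTerm, hm, Hom.id]]
  have key : ∀ w, w = j → bigradedId A.X w (n + w) j (n + j) (a.1 w) = a.1 j := by
    rintro w rfl
    simp
  simpa [totTerm, Hom.id] using key (j + (0 : ℕ)) (by simp)

/-- The totalization functor from multicomplexes and `∞`-morphisms to filtered complexes, with
`(Tot(f) a)_j = ∑_m (-1)^{mn} f_m (a_{j + m})` for `a ∈ Tot(A)^n`. -/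
def tot : Multicomplex.{u, v} R ⥤ FilteredComplex.{u, v} R where
  obj A := A.totObj
  map {A B} f :=
    { f :=
        { f n := ModuleCat.ofHom (totMap (Hom.f f) n n)
          comm' n n' h := by
            change ModuleCat.ofHom _ ≫ ModuleCat.ofHom _ = ModuleCat.ofHom _ ≫ ModuleCat.ofHom _
            rw [← ModuleCat.ofHom_comp, ← ModuleCat.ofHom_comp,
              totMap_comp 0 _ _ n n n' (by simp), totMap_comp 1 _ _ n n' n' h.symm]
            have e : (fun (i : ℕ) (p q p' q' : ℤ) =>
                ((Int.negOnePow (i * 1) : ℤˣ) : ℤ) • Hom.f f i p q p' q') =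
                BiFamily.alt (Hom.f f) := by
              funext i p q p' q'
              simp [BiFamily.alt, Int.negOnePow_def]
            simp only [mul_zero, Int.negOnePow_zero, Units.val_one, one_smul]
            rw [e, ← Hom.conv_comm f] }
      map_mem p n a ha i hi := totMap_apply_eq_zero (Hom.f f) n n a p ha i hi }
  map_id A := by
    apply FilteredComplex.hom_ext
    ext n : 2
    exact totMap_id A n
  map_comp {A B C} f g := by
    apply FilteredComplex.hom_ext
    ext n : 2
    change totMap (Hom.comp f g).f n n = totMap (Hom.f g) n n ∘ₗ totMap (Hom.f f) n n
    rw [totMap_comp 0 _ _ n n n (by simp), Hom.comp_f]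
    simp

end Multicomplex

/-! ### Spectral sequences -/

section Homology

open HomologicalComplex

variable {R : Type u} [CommRing R] {κ : Type*} {c : ComplexShape κ}

/-- The homology class of a cycle. -/
def homologyClass (K : HomologicalComplex (ModuleCat.{v} R) c) (i j : κ) (hij : c.Rel i j) :
    LinearMap.ker (K.d i j).hom →ₗ[R] K.homology i :=
  (K.liftCycles (ModuleCat.ofHom (LinearMap.ker (K.d i j).hom).subtype) j (c.next_eq' hij)
    (by ext x; exact x.2) ≫ K.homologyπ i).hom

lemma homologyClass_surjective (K : HomologicalComplex (ModuleCat.{v} R) c) (i j : κ)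
    (hij : c.Rel i j) : Function.Surjective (homologyClass K i j hij) := by
  intro y
  obtain ⟨z, rfl⟩ := (ModuleCat.epi_iff_surjective (K.homologyπ i)).1 inferInstance y
  have hz : (K.d i j).hom ((K.iCycles i).hom z) = 0 := by
    exact congrArg (fun φ => φ.hom z) (K.iCycles_d i j)
  refine ⟨⟨_, hz⟩, ?_⟩
  change (K.homologyπ i).hom ((K.liftCycles _ j _ _).hom _) = _
  congr 1
  apply (ModuleCat.mono_iff_injective (K.iCycles i)).1 inferInstance
  have := congrArg (fun φ => φ.hom ⟨_, hz⟩)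
    (K.liftCycles_i (ModuleCat.ofHom (LinearMap.ker (K.d i j).hom).subtype) j (c.next_eq' hij)
      (by ext x; exact x.2))
  exact this

lemma homologyClass_eq_zero_iff (K : HomologicalComplex (ModuleCat.{v} R) c) (k i j : κ)
    (hki : c.Rel k i) (hij : c.Rel i j) (x : LinearMap.ker (K.d i j).hom) :
    homologyClass K i j hij x = 0 ↔ ∃ y : K.X k, (K.d k i).hom y = x.1 := by
  have hex : (ShortComplex.mk (K.toCycles k i) (K.homologyπ i) (by simp)).Exact :=
    ShortComplex.exact_of_g_is_cokernel _ (K.homologyIsCokernel k i (c.prev_eq' hki))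
  rw [ShortComplex.moduleCat_exact_iff] at hex
  have hi : ∀ x : LinearMap.ker (K.d i j).hom, (K.iCycles i).hom ((K.liftCycles
      (ModuleCat.ofHom (LinearMap.ker (K.d i j).hom).subtype) j (c.next_eq' hij)
      (by ext x; exact x.2)).hom x) = x.1 := fun x =>
    congrArg (fun φ => φ.hom x)
      (K.liftCycles_i (ModuleCat.ofHom (LinearMap.ker (K.d i j).hom).subtype) j (c.next_eq' hij)
        (by ext x; exact x.2))
  have hd : ∀ y, (K.iCycles i).hom ((K.toCycles k i).hom y) = (K.d k i).hom y := fun y =>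
    congrArg (fun φ => φ.hom y) (K.toCycles_i k i)
  constructor
  · intro h
    obtain ⟨y, hy⟩ := hex _ h
    exact ⟨y, by rw [← hi, ← hd]; exact congrArg _ hy⟩
  · rintro ⟨y, hy⟩
    have : (K.liftCycles (ModuleCat.ofHom (LinearMap.ker (K.d i j).hom).subtype) j
        (c.next_eq' hij) (by ext x; exact x.2)).hom x = (K.toCycles k i).hom y := by
      apply (ModuleCat.mono_iff_injective (K.iCycles i)).1 inferInstance
      exact (hi x).trans (hy.symm.trans (hd y).symm)
    change (K.homologyπ i).hom ((K.liftCycles _ j _ _).hom _) = _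
    rw [this]
    exact congrArg (fun φ => φ.hom y) (K.toCycles_comp_homologyπ k i)

lemma homologyMap_homologyClass {K L : HomologicalComplex (ModuleCat.{v} R) c} (f : K ⟶ L)
    (i j : κ) (hij : c.Rel i j) (x : LinearMap.ker (K.d i j).hom)
    (hx : (f.f i).hom x.1 ∈ LinearMap.ker (L.d i j).hom) :
    (homologyMap f i).hom (homologyClass K i j hij x) =
      homologyClass L i j hij ⟨(f.f i).hom x.1, hx⟩ := by
  have h1 : ∀ z, (homologyMap f i).hom ((K.homologyπ i).hom z) =
      (L.homologyπ i).hom ((cyclesMap f i).hom z) := fun z =>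
    congrArg (fun φ => φ.hom z) (homologyπ_naturality f i)
  change (homologyMap f i).hom ((K.homologyπ i).hom _) = (L.homologyπ i).hom _
  rw [h1]
  congr 1
  apply (ModuleCat.mono_iff_injective (L.iCycles i)).1 inferInstance
  have h2 : ∀ z, (L.iCycles i).hom ((cyclesMap f i).hom z) = (f.f i).hom ((K.iCycles i).hom z) :=
    fun z => congrArg (fun φ => φ.hom z) (cyclesMap_i f i)
  refine (h2 _).trans ?_
  have h3 := congrArg (fun φ => φ.hom x)
      (K.liftCycles_i (ModuleCat.ofHom (LinearMap.ker (K.d i j).hom).subtype) j (c.next_eq' hij)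
        (by ext x; exact x.2))
  have h4 := congrArg (fun φ => φ.hom ⟨(f.f i).hom x.1, hx⟩)
      (L.liftCycles_i (ModuleCat.ofHom (LinearMap.ker (L.d i j).hom).subtype) j (c.next_eq' hij)
        (by ext x; exact x.2))
  exact (congrArg (f.f i).hom h3).trans h4.symm

/-- Two quotients of a module by the same submodule are isomorphic. -/
def isoOfSurjective {A : Type v} [AddCommGroup A] [Module R A] {M N : ModuleCat.{v} R}
    (f : A →ₗ[R] M) (g : A →ₗ[R] N) (hf : Function.Surjective f) (hg : Function.Surjective g)
    (h : ∀ x, f x = 0 ↔ g x = 0) : M ≅ N :=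
  ((f.quotKerEquivOfSurjective hf).symm ≪≫ₗ
    Submodule.quotEquivOfEq _ _ (by ext x; exact h x) ≪≫ₗ
    g.quotKerEquivOfSurjective hg).toModuleIso

lemma isoOfSurjective_hom_apply {A : Type v} [AddCommGroup A] [Module R A] {M N : ModuleCat.{v} R}
    (f : A →ₗ[R] M) (g : A →ₗ[R] N) (hf : Function.Surjective f) (hg : Function.Surjective g)
    (h : ∀ x, f x = 0 ↔ g x = 0) (x : A) :
    (isoOfSurjective f g hf hg h).hom.hom (f x) = g x := by
  have : (f.quotKerEquivOfSurjective hf).symm (f x) = Submodule.Quotient.mk x := by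
    rw [LinearEquiv.symm_apply_eq]; rfl
  change (g.quotKerEquivOfSurjective hg) (Submodule.quotEquivOfEq _ _ (by ext x; exact h x)
    ((f.quotKerEquivOfSurjective hf).symm (f x))) = g x
  rw [this]
  rfl

end Homology

/-- The category of spectral sequences of `R`-modules with pages `r ≥ 0`, where the differential
of the `r`-th page is of bidegree `(-r, 1 - r)`. -/
abbrev SpSe (R : Type u) [CommRing R] :=
  SpectralSequence (ModuleCat.{v} R) (fun r : ℤ => ComplexShape.up' ((-r, 1 - r) : ℤ × ℤ)) 0

namespace FilteredComplex

variable {R : Type u} [CommRing R] (A : FilteredComplex.{u, v} R)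

/-- The `r`-cycles `Z_r^{p, n + p} = F_p A^n ∩ d⁻¹(F_{p - r} A^{n + 1})`. -/
def Z (r p n : ℤ) : Submodule R (A.K.X n) :=
  A.F p n ⊓ (A.F (p - r) (n + 1)).comap (A.K.d n (n + 1)).hom

/-- The `r`-boundaries `B_r^{p, n + p} = Z_{r-1}^{p-1, n+p-1} + d Z_{r-1}^{p+r-1, n+p+r-2}`.
For `r = 0` this is `Z_0^{p-1, n+p-1} = F_{p-1} A^n`, see `B_zero`. -/
def B (r p n : ℤ) : Submodule R (A.K.X n) :=
  A.Z (r - 1) (p - 1) n ⊔ (A.Z (r - 1) (p + r - 1) (n - 1)).map (A.K.d (n - 1) n).hom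

/-- `E_r^{p, n + p} = Z_r^{p, n + p} / B_r^{p, n + p}`. -/
abbrev E (r p n : ℤ) : Type v := A.Z r p n ⧸ (A.B r p n).submoduleOf (A.Z r p n)

lemma mem_Z {r p n : ℤ} {x : A.K.X n} : x ∈ A.Z r p n ↔
    x ∈ A.F p n ∧ (A.K.d n (n + 1)).hom x ∈ A.F (p - r) (n + 1) := Iff.rfl

lemma d_mem' {p n n' : ℤ} (h : n + 1 = n') {x : A.K.X n} (hx : x ∈ A.F p n) :
    (A.K.d n n').hom x ∈ A.F p n' := by
  subst h; exact A.d_mem p n x hx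

lemma mem_Z' {r p n n' : ℤ} (h : n + 1 = n') {x : A.K.X n} : x ∈ A.Z r p n ↔
    x ∈ A.F p n ∧ (A.K.d n n').hom x ∈ A.F (p - r) n' := by
  subst h; rfl

lemma d_d {n n' n'' : ℤ} (x : A.K.X n) : (A.K.d n' n'').hom ((A.K.d n n').hom x) = 0 :=
  congrArg (fun φ => φ.hom x) (A.K.d_comp_d n n' n'')

lemma mem_B' {r p n n' : ℤ} (h : n' + 1 = n) {x : A.K.X n} : x ∈ A.B r p n ↔
    ∃ w ∈ A.Z (r - 1) (p - 1) n, ∃ v ∈ A.Z (r - 1) (p + r - 1) n',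
      w + (A.K.d n' n).hom v = x := by
  obtain rfl : n' = n - 1 := by omega
  simp only [B, Submodule.mem_sup, Submodule.mem_map]
  constructor
  · rintro ⟨w, hw, _, ⟨v, hv, rfl⟩, rfl⟩
    exact ⟨w, hw, v, hv, rfl⟩
  · rintro ⟨w, hw, v, hv, rfl⟩
    exact ⟨w, hw, _, ⟨v, hv, rfl⟩, rfl⟩

lemma B_zero (p n : ℤ) : A.B 0 p n = A.Z 0 (p - 1) n := by
  ext x
  rw [A.mem_B' (n' := n - 1) (by omega), mem_Z]
  constructor
  · rintro ⟨w, hw, v, hv, rfl⟩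
    have h : w + (A.K.d (n - 1) n).hom v ∈ A.F (p - 1) n :=
      Submodule.add_mem _ hw.1 (A.d_mem' (by omega) (by simpa using hv.1))
    exact ⟨h, by simpa using A.d_mem _ _ _ h⟩
  · rintro ⟨h, h'⟩
    refine ⟨x, ⟨h, A.mono_of_le (by omega) _ h'⟩, 0, Submodule.zero_mem _, by simp⟩

/-- The differential on `r`-cycles. -/
def dZ (r p n p' n' : ℤ) (hp : p' = p - r) (hn : n + 1 = n') : A.Z r p n →ₗ[R] A.Z r p' n' :=
  (A.K.d n n').hom.restrict fun x hx => by
    subst hp hn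
    exact ⟨hx.2, by rw [SetLike.mem_coe, Submodule.mem_comap, A.d_d]; exact Submodule.zero_mem _⟩

/-- The differential `δ_r [a] = [d a]` from `E_r^{p, n + p}` to `E_r^{p', n' + p'}` for
`p' = p - r` and `n' = n + 1`. -/
def dE (r p n p' n' : ℤ) (hp : p' = p - r) (hn : n + 1 = n') : A.E r p n →ₗ[R] A.E r p' n' :=
  Submodule.mapQ _ _ (A.dZ r p n p' n' hp hn) (by
    rintro ⟨x, hx⟩ hxB
    obtain ⟨w, hw, v, hv, rfl⟩ := (A.mem_B' (n' := n - 1) (by omega)).1 hxB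
    subst hp
    refine (A.mem_B' hn).2 ⟨0, Submodule.zero_mem _, w, ?_, ?_⟩
    · exact ⟨A.mono_of_le (by omega) _ hw.1, A.mono_of_le (by omega) _ hw.2⟩
    · change _ = (A.K.d n n').hom (w + (A.K.d (n - 1) n).hom v)
      rw [map_add, A.d_d]
      simp)

/-- The page `E_r(A)`. -/
def page (r : ℤ) :
    HomologicalComplex (ModuleCat.{v} R) (ComplexShape.up' ((-r, 1 - r) : ℤ × ℤ)) where
  X pq := ModuleCat.of R (A.E r pq.1 (pq.2 - pq.1))
  d pq pq' :=
    if h : pq'.1 = pq.1 - r ∧ pq.2 - pq.1 + 1 = pq'.2 - pq'.1 then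
      ModuleCat.ofHom (A.dE r pq.1 (pq.2 - pq.1) pq'.1 (pq'.2 - pq'.1) h.1 h.2)
    else 0
  shape pq pq' h := by
    rw [dif_neg]
    rintro ⟨h1, h2⟩
    refine h (Prod.ext ?_ ?_)
    · change pq.1 + -r = pq'.1
      omega
    · change pq.2 + (1 - r) = pq'.2
      omega
  d_comp_d' i j k _ _ := by
    split_ifs with h1 h2
    · ext x
      refine congrArg Submodule.Quotient.mk (Subtype.ext ?_)
      exact A.d_d x.1
    all_goals simp

lemma page_d (r p q p' q' : ℤ) (hp : p' = p - r) (hn : q - p + 1 = q' - p') :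
    (A.page r).d (p, q) (p', q') =
      ModuleCat.ofHom (A.dE r p (q - p) p' (q' - p') hp hn) :=
  dif_pos ⟨hp, hn⟩

lemma rel_up' (r p q : ℤ) :
    (ComplexShape.up' ((-r, 1 - r) : ℤ × ℤ)).Rel (p, q) (p - r, q + 1 - r) := by
  refine Prod.ext ?_ ?_
  · change p + -r = p - r
    omega
  · change q + (1 - r) = q + 1 - r
    omega

lemma rel_up'' (r p q : ℤ) :
    (ComplexShape.up' ((-r, 1 - r) : ℤ × ℤ)).Rel (p + r, q + r - 1) (p, q) := by
  refine Prod.ext ?_ ?_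
  · change p + r + -r = p
    omega
  · change q + r - 1 + (1 - r) = q
    omega

/-- The map from `(r + 1)`-cycles to the cycles of `E_r`. -/
def toKer (r r' p q : ℤ) (h : r + 1 = r') : A.Z r' p (q - p) →ₗ[R]
    LinearMap.ker ((A.page r).d (p, q) (p - r, q + 1 - r)).hom :=
  LinearMap.codRestrict _
    ((Submodule.mkQ ((A.B r p (q - p)).submoduleOf (A.Z r p (q - p)))) ∘ₗ
      Submodule.inclusion (fun x hx => ⟨hx.1, A.mono_of_le (by omega) _ hx.2⟩ :
        A.Z r' p (q - p) ≤ A.Z r p (q - p))) (by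
    rintro ⟨x, hx⟩
    rw [LinearMap.mem_ker, A.page_d r p q _ _ rfl (by omega)]
    refine (Submodule.Quotient.mk_eq_zero _).2 ?_
    refine (A.mem_B' (n' := q - p) (by omega)).2
      ⟨(A.K.d (q - p) (q + 1 - r - (p - r))).hom x, ?_, 0, Submodule.zero_mem _, by simp; rfl⟩
    refine ⟨?_, ?_⟩
    · have := ((A.mem_Z' (show q - p + 1 = q + 1 - r - (p - r) by omega)).1 hx).2
      exact A.mono_of_le (by omega) _ this
    · rw [SetLike.mem_coe, Submodule.mem_comap, A.d_d]
      exact Submodule.zero_mem _)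

/-- The class in the homology of `E_r` of an `(r + 1)`-cycle. -/
def toHomology (r r' p q : ℤ) (h : r + 1 = r') :
    A.Z r' p (q - p) →ₗ[R] (A.page r).homology (p, q) :=
  homologyClass (A.page r) (p, q) (p - r, q + 1 - r) (rel_up' r p q) ∘ₗ A.toKer r r' p q h

lemma toHomology_surjective (r r' p q : ℤ) (h : r + 1 = r') :
    Function.Surjective (A.toHomology r r' p q h) := by
  refine (homologyClass_surjective (A.page r) (p, q) (p - r, q + 1 - r)
    (rel_up' r p q)).comp (f := A.toKer r r' p q h) ?_
  rintro ⟨y, hy⟩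
  have hy' := LinearMap.mem_ker.1 hy
  rw [A.page_d r p q _ _ rfl (by omega)] at hy'
  obtain ⟨⟨x, hx⟩, rfl⟩ := Submodule.Quotient.mk_surjective _ y
  have hy := (Submodule.Quotient.mk_eq_zero _).1 hy'
  obtain ⟨w, hw, v, hv, hwv⟩ := (A.mem_B' (n' := q - p) (by omega)).1 hy
  change w + _ = (A.K.d (q - p) (q + 1 - r - (p - r))).hom x at hwv
  have hv1 : v ∈ A.F (p - 1) (q - p) := by
    have := hv.1
    rwa [show p - r + r - 1 = p - 1 by ring] at this
  have hv2 : (A.K.d (q - p) (q - p + 1)).hom v ∈ A.F (p - r) (q - p + 1) := by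
    have := hv.2
    rwa [show p - r + r - 1 - (r - 1) = p - r by ring] at this
  have hxv : x - v ∈ A.Z r' p (q - p) := by
    refine (A.mem_Z' (show q - p + 1 = q + 1 - r - (p - r) by omega)).2 ⟨?_, ?_⟩
    · exact Submodule.sub_mem _ hx.1 (A.mono_of_le (by omega) _ hv1)
    · rw [map_sub, ← hwv, add_sub_cancel_right]
      exact A.mono_of_le (by omega) _ hw.1
  refine ⟨⟨x - v, hxv⟩, Subtype.ext ?_⟩
  refine (Submodule.Quotient.eq _).2 ?_
  refine (A.mem_B' (n' := q - p - 1) (by omega)).2 ⟨-v, ?_, 0, Submodule.zero_mem _, ?_⟩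
  · refine Submodule.neg_mem _ ⟨hv1, ?_⟩
    rwa [show p - 1 - (r - 1) = p - r by ring]
  · change -v + _ = x - v - x
    simp

lemma toHomology_eq_zero_iff (r r' p q : ℤ) (h : r + 1 = r') (x : A.Z r' p (q - p)) :
    A.toHomology r r' p q h x = 0 ↔
      Submodule.mkQ ((A.B r' p (q - p)).submoduleOf (A.Z r' p (q - p))) x = 0 := by
  obtain ⟨x, hx⟩ := x
  rw [Submodule.mkQ_apply, Submodule.Quotient.mk_eq_zero]
  change homologyClass _ _ _ (rel_up' r p q) _ = 0 ↔ x ∈ A.B r' p (q - p)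
  rw [homologyClass_eq_zero_iff _ (p + r, q + r - 1) _ _ (rel_up'' r p q),
    A.mem_B' (n' := q + r - 1 - (p + r)) (by omega)]
  constructor
  · rintro ⟨y, hy⟩
    obtain ⟨⟨y, hyZ⟩, rfl⟩ := Submodule.Quotient.mk_surjective _ y
    rw [A.page_d r _ _ _ _ (by omega) (by omega)] at hy
    have hy := (Submodule.Quotient.eq _).1 hy
    obtain ⟨w, hw, v, hv, hwv⟩ := (A.mem_B' (n' := q + r - 1 - (p + r)) (by omega)).1 hy
    change w + _ = (A.K.d _ _).hom y - x at hwv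
    have hyv : y - v ∈ A.Z (r' - 1) (p + r' - 1) (q + r - 1 - (p + r)) := by
      refine Submodule.sub_mem _ ?_ ?_
      · rwa [show r' - 1 = r by omega, show p + r' - 1 = p + r by omega]
      · refine ⟨A.mono_of_le (by omega) _ hv.1, A.mono_of_le (by omega) _ hv.2⟩
    have hx' : -w + (A.K.d (q + r - 1 - (p + r)) (q - p)).hom (y - v) = x := by
      rw [map_sub]
      have : (A.K.d (q + r - 1 - (p + r)) (q - p)).hom y = w +
        (A.K.d (q + r - 1 - (p + r)) (q - p)).hom v + x := by rw [hwv]; simp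
      rw [this]
      abel
    refine ⟨-w, ⟨Submodule.neg_mem _ hw.1, ?_⟩, y - v, hyv, hx'⟩
    have h2 := congrArg (A.K.d (q - p) (q - p + 1)).hom hx'
    rw [map_add, A.d_d, add_zero] at h2
    rw [SetLike.mem_coe, Submodule.mem_comap, h2]
    exact A.mono_of_le (by omega) _ hx.2
  · rintro ⟨w, hw, v, hv, hwv⟩
    have hvZ : v ∈ A.Z r (p + r) (q + r - 1 - (p + r)) := by
      rwa [show r' - 1 = r by omega, show p + r' - 1 = p + r by omega] at hv
    refine ⟨Submodule.Quotient.mk ⟨v, hvZ⟩, ?_⟩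
    rw [A.page_d r _ _ _ _ (by omega) (by omega)]
    refine (Submodule.Quotient.eq _).2 ?_
    refine (A.mem_B' (n' := q + r - 1 - (p + r)) (by omega)).2
      ⟨-w, ?_, 0, Submodule.zero_mem _, ?_⟩
    · exact Submodule.neg_mem _ ⟨hw.1, A.mono_of_le (by omega) _ hw.2⟩
    · change -w + _ = (A.K.d _ _).hom v - x
      rw [← hwv]
      simp

/-- The spectral sequence of a filtered complex: the isomorphism from the homology of `E_r` to
`E_{r+1}` sends the class of the cycle `[a]_r`, for `a ∈ Z_{r+1}`, to `[a]_{r+1}`. -/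
def spectralSequence : SpSe.{u, v} R where
  page r _ := A.page r
  iso r r' pq h _ := isoOfSurjective (A.toHomology r r' pq.1 pq.2 h)
    (N := ModuleCat.of R (A.E r' pq.1 (pq.2 - pq.1)))
    (Submodule.mkQ ((A.B r' pq.1 (pq.2 - pq.1)).submoduleOf (A.Z r' pq.1 (pq.2 - pq.1))))
    (A.toHomology_surjective r r' pq.1 pq.2 h) (Submodule.mkQ_surjective _)
    (A.toHomology_eq_zero_iff r r' pq.1 pq.2 h)

variable {A} {A' : FilteredComplex.{u, v} R}

lemma Hom.map_d (f : Hom A A') (n n' : ℤ) (x : A.K.X n) :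
    (f.f.f n').hom ((A.K.d n n').hom x) = (A'.K.d n n').hom ((f.f.f n).hom x) :=
  (congrArg (fun φ => φ.hom x) (f.f.comm n n')).symm

lemma Hom.map_Z (f : Hom A A') {r p n : ℤ} {x : A.K.X n} (hx : x ∈ A.Z r p n) :
    (f.f.f n).hom x ∈ A'.Z r p n := by
  refine ⟨f.map_mem _ _ _ hx.1, ?_⟩
  have := f.map_mem _ _ _ hx.2
  rwa [f.map_d] at this

/-- The map induced by `f` on `r`-cycles. -/
def Hom.mapZ (f : Hom A A') (r p n : ℤ) : A.Z r p n →ₗ[R] A'.Z r p n :=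
  (f.f.f n).hom.restrict fun _ hx => f.map_Z hx

/-- The map `[a] ↦ [f a]` induced by `f` on `E_r`. -/
def Hom.mapE (f : Hom A A') (r p n : ℤ) : A.E r p n →ₗ[R] A'.E r p n :=
  Submodule.mapQ _ _ (f.mapZ r p n) (by
    rintro ⟨x, hx⟩ hxB
    obtain ⟨w, hw, v, hv, rfl⟩ := (A.mem_B' (n' := n - 1) (by omega)).1 hxB
    refine (A'.mem_B' (n' := n - 1) (by omega)).2 ⟨_, f.map_Z hw, _, f.map_Z hv, ?_⟩
    change _ = (f.f.f n).hom (w + _)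
    rw [map_add, f.map_d])

/-- The map induced by `f` on the page `E_r`. -/
def Hom.mapPage (f : Hom A A') (r : ℤ) : A.page r ⟶ A'.page r where
  f pq := ModuleCat.ofHom (f.mapE r pq.1 (pq.2 - pq.1))
  comm' pq pq' _ := by
    by_cases h : pq'.1 = pq.1 - r ∧ pq.2 - pq.1 + 1 = pq'.2 - pq'.1
    · rw [A.page_d r _ _ _ _ h.1 h.2, A'.page_d r _ _ _ _ h.1 h.2]
      ext x
      obtain ⟨x, rfl⟩ := Submodule.Quotient.mk_surjective _ x
      refine congrArg Submodule.Quotient.mk (Subtype.ext ?_)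
      exact (f.map_d _ _ x.1).symm
    · simp [page, h]

lemma mapPage_id (A : FilteredComplex.{u, v} R) (r : ℤ) :
    Hom.mapPage (𝟙 A : A ⟶ A) r = 𝟙 (A.page r) := by
  refine HomologicalComplex.hom_ext _ _ fun pq => ModuleCat.hom_ext (LinearMap.ext fun x => ?_)
  exact Submodule.Quotient.induction_on _ x fun _ => rfl

lemma mapPage_comp {A B C : FilteredComplex.{u, v} R} (f : A ⟶ B) (g : B ⟶ C) (r : ℤ) :
    Hom.mapPage (f ≫ g : A ⟶ C) r = Hom.mapPage f r ≫ Hom.mapPage g r := by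
  refine HomologicalComplex.hom_ext _ _ fun pq => ModuleCat.hom_ext (LinearMap.ext fun x => ?_)
  exact Submodule.Quotient.induction_on _ x fun _ => rfl

/-- The functor `E` from filtered complexes to spectral sequences. -/
def toSpSe : FilteredComplex.{u, v} R ⥤ SpSe.{u, v} R where
  obj A := A.spectralSequence
  map {A A'} f :=
    { hom r _ := Hom.mapPage f r
      comm r r' pq h _ := by
        obtain ⟨p, q⟩ := pq
        ext y
        obtain ⟨x, rfl⟩ := A.toHomology_surjective r r' p q h y
        have h1 : (A.spectralSequence.iso r r' (p, q) h).hom.hom (A.toHomology r r' p q h x) =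
            Submodule.Quotient.mk x := isoOfSurjective_hom_apply _ _ _ _ (A.toHomology_eq_zero_iff r r' p q h) x
        have h2 : (A'.spectralSequence.iso r r' (p, q) h).hom.hom
            (A'.toHomology r r' p q h (Hom.mapZ f r' p (q - p) x)) =
            Submodule.Quotient.mk (Hom.mapZ f r' p (q - p) x) :=
          isoOfSurjective_hom_apply _ _ _ _ (A'.toHomology_eq_zero_iff r r' p q h) _
        have h3 : (HomologicalComplex.homologyMap (Hom.mapPage f r) (p, q)).hom
            (A.toHomology r r' p q h x) =
            A'.toHomology r r' p q h (Hom.mapZ f r' p (q - p) x) :=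
          homologyMap_homologyClass (Hom.mapPage f r) (p, q) (p - r, q + 1 - r) (rel_up' r p q)
            (A.toKer r r' p q h x)
            (A'.toKer r r' p q h (Hom.mapZ f r' p (q - p) x)).2
        exact (congrArg (A'.spectralSequence.iso r r' (p, q) h).hom.hom h3).trans
          (h2.trans (congrArg ((Hom.mapPage f r').f (p, q)).hom h1).symm) }
  map_id A := SpectralSequence.hom_ext fun r _ => mapPage_id A r
  map_comp f g := SpectralSequence.hom_ext fun r _ => mapPage_comp f g r

end FilteredComplex

namespace SpSe

open FilteredComplex (rel_up' rel_up'')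

variable {R : Type u} [CommRing R]

/-- The composition of `ker d_r → H(A_r)` with the characteristic map `H(A_r) ≅ A_{r'}`,
`r' = r + 1`. -/
def charMap (A : SpSe.{u, v} R) (r r' : ℤ) (h : r + 1 = r') (hr : 0 ≤ r) (i j : ℤ × ℤ)
    (hij : (ComplexShape.up' ((-r, 1 - r) : ℤ × ℤ)).Rel i j) :
    LinearMap.ker ((A.page r).d i j).hom →ₗ[R] (A.page r' (by lia)).X i :=
  (A.iso r r' i h hr).hom.hom ∘ₗ homologyClass (A.page r) i j hij

lemma iso_injective (A : SpSe.{u, v} R) (r r' : ℤ) (h : r + 1 = r') (hr : 0 ≤ r) (i : ℤ × ℤ) :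
    Function.Injective (A.iso r r' i h hr).hom.hom :=
  (ModuleCat.mono_iff_injective (A.iso r r' i h hr).hom).1 inferInstance

lemma charMap_surjective (A : SpSe.{u, v} R) (r r' : ℤ) (h : r + 1 = r') (hr : 0 ≤ r)
    (i j : ℤ × ℤ) (hij : (ComplexShape.up' ((-r, 1 - r) : ℤ × ℤ)).Rel i j) :
    Function.Surjective (A.charMap r r' h hr i j hij) :=
  ((ModuleCat.epi_iff_surjective (A.iso r r' i h hr).hom).1 inferInstance).comp
    (homologyClass_surjective _ i j hij)

lemma charMap_eq_zero_iff (A : SpSe.{u, v} R) (r r' : ℤ) (h : r + 1 = r') (hr : 0 ≤ r)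
    (k i j : ℤ × ℤ) (hki : (ComplexShape.up' ((-r, 1 - r) : ℤ × ℤ)).Rel k i)
    (hij : (ComplexShape.up' ((-r, 1 - r) : ℤ × ℤ)).Rel i j)
    (x : LinearMap.ker ((A.page r).d i j).hom) :
    A.charMap r r' h hr i j hij x = 0 ↔ ∃ y, ((A.page r).d k i).hom y = x.1 := by
  rw [← homologyClass_eq_zero_iff _ k i j hki hij]
  exact map_eq_zero_iff _ (A.iso_injective r r' h hr i)

/-- The identity `K.X i → K.X j` if `i = j`, and zero otherwise. -/
def transport {κ : Type*} {c : ComplexShape κ} (K : HomologicalComplex (ModuleCat.{v} R) c)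
    [DecidableEq κ] (i j : κ) : K.X i →ₗ[R] K.X j :=
  if h : i = j then (K.XIsoOfEq h).hom.hom else 0

section
variable {κ : Type*} {c : ComplexShape κ} (K : HomologicalComplex (ModuleCat.{v} R) c)
    [DecidableEq κ]

@[simp] lemma transport_self (i : κ) : transport K i i = LinearMap.id := by
  simp [transport]

lemma transport_ne {i j : κ} (h : i ≠ j) : transport K i j = 0 := by
  simp [transport, h]

lemma d_transport {i j i' j' : κ} (h : i = j) (h' : i' = j') (x : K.X i) :
    (K.d j j').hom (transport K i j x) = transport K i' j' ((K.d i i').hom x) := by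
  subst h h'
  simp

end

/-- The shift of bidegrees by the bidegree of `u`. -/
abbrev shiftIdx (r : ℕ) (i : ℤ × ℤ) : ℤ × ℤ := (i.1 + r, i.2 + r - 1)

section PathComplex

variable (r : ℕ) (s : ℤˣ) {m : ℤ}
  (K : HomologicalComplex (ModuleCat.{v} R) (ComplexShape.up' ((-m, 1 - m) : ℤ × ℤ)))

/-- The differential `D_m` of the page `P_m(r; A)`, `m ≤ r`, from bidegree `i` to `i'`:
`D_m (x, y, z) = (d x, s d y, d z)` for `m < r`, where `s = ±1`, and
`D_r (x, y, z) = (d x, -x - d y + z, d z)`, i.e. `s = -1` for `m = r`. -/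
def pathD (i i' : ℤ × ℤ) : (K.X i × K.X (shiftIdx r i) × K.X i) →ₗ[R]
    (K.X i' × K.X (shiftIdx r i') × K.X i') :=
  ((K.d i i').hom ∘ₗ LinearMap.fst R _ _).prod
    (((s : ℤ) •
        ((K.d (shiftIdx r i) (shiftIdx r i')).hom ∘ₗ LinearMap.fst R _ _ ∘ₗ
          LinearMap.snd R _ _) +
      if m = r then transport K i (shiftIdx r i') ∘ₗ
        (LinearMap.snd R _ _ ∘ₗ LinearMap.snd R _ _ - LinearMap.fst R _ _) else 0).prod
    ((K.d i i').hom ∘ₗ LinearMap.snd R _ _ ∘ₗ LinearMap.snd R _ _))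

lemma pathD_apply (i i' : ℤ × ℤ) (w : K.X i × K.X (shiftIdx r i) × K.X i) :
    pathD r s K i i' w = ((K.d i i').hom w.1,
      (s : ℤ) • (K.d (shiftIdx r i) (shiftIdx r i')).hom w.2.1 +
        (if m = r then transport K i (shiftIdx r i') (w.2.2 - w.1) else 0),
      (K.d i i').hom w.2.2) := by
  unfold pathD
  split_ifs <;> simp

lemma rel_iff (i i' : ℤ × ℤ) : (ComplexShape.up' ((-m, 1 - m) : ℤ × ℤ)).Rel i i' ↔
    i'.1 = i.1 - m ∧ i'.2 = i.2 + 1 - m := by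
  change i + (-m, 1 - m) = i' ↔ _
  rw [Prod.ext_iff]
  simp only [Prod.fst_add, Prod.snd_add]
  omega

lemma rel_shift {i i' : ℤ × ℤ} (h : (ComplexShape.up' ((-m, 1 - m) : ℤ × ℤ)).Rel i i') :
    (ComplexShape.up' ((-m, 1 - m) : ℤ × ℤ)).Rel (shiftIdx r i) (shiftIdx r i') := by
  rw [rel_iff] at *
  simp only
  omega

lemma d_d {κ : Type*} {c : ComplexShape κ} (K : HomologicalComplex (ModuleCat.{v} R) c)
    (i j k : κ) (x : K.X i) : (K.d j k).hom ((K.d i j).hom x) = 0 :=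
  congrArg (fun φ => φ.hom x) (K.d_comp_d i j k)

lemma shiftIdx_eq {i i' : ℤ × ℤ} (h : (ComplexShape.up' ((-m, 1 - m) : ℤ × ℤ)).Rel i i')
    (hm : m = r) : i = shiftIdx r i' := by
  rw [rel_iff] at h
  refine Prod.ext ?_ ?_ <;> simp only <;> omega

/-- The page `P_m(r; A)` for `m ≤ r`. -/
def pathComplex (hs : m = r → s = -1) :
    HomologicalComplex (ModuleCat.{v} R) (ComplexShape.up' ((-m, 1 - m) : ℤ × ℤ)) where
  X i := ModuleCat.of R (K.X i × K.X (shiftIdx r i) × K.X i)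
  d i i' := ModuleCat.ofHom (pathD r s K i i')
  shape i i' h := by
    have h1 : K.d i i' = 0 := K.shape _ _ h
    have h2 : K.d (shiftIdx r i) (shiftIdx r i') = 0 := K.shape _ _ fun hh => h <| by
      rw [rel_iff] at *
      simp only at hh
      omega
    refine ModuleCat.hom_ext (LinearMap.ext fun w => ?_)
    refine (pathD_apply r s K i i' w).trans ?_
    rw [h1, h2]
    split_ifs with hm
    · rw [transport_ne K fun e => h <| by
        rw [rel_iff]
        rw [Prod.ext_iff] at e
        simp only at e
        omega]
      simp
    · simp
  d_comp_d' i j k hij hjk := by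
    refine ModuleCat.hom_ext (LinearMap.ext fun w => ?_)
    change pathD r s K j k (pathD r s K i j w) = 0
    rw [pathD_apply, pathD_apply]
    refine Prod.ext (d_d K _ _ _ _) (Prod.ext ?_ (d_d K _ _ _ _))
    simp only [map_add, map_zsmul, d_d, smul_zero, zero_add]
    split_ifs with hm
    · rw [d_transport K (shiftIdx_eq r hij hm) (shiftIdx_eq r hjk hm), map_sub]
      rw [hs hm, ← map_sub]
      simp
    · simp

/-- The projections `(x, y, z) ↦ x` (`ε = false`) and `(x, y, z) ↦ z` (`ε = true`). -/
def pathComplexEnd (hs : m = r → s = -1) (ε : Bool) : pathComplex r s K hs ⟶ K where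
  f i := ModuleCat.ofHom (if ε then LinearMap.snd R _ _ ∘ₗ LinearMap.snd R _ _
    else LinearMap.fst R _ _)
  comm' i i' _ := by
    refine ModuleCat.hom_ext (LinearMap.ext fun w => ?_)
    have h := pathD_apply r s K i i' w
    cases ε
    · exact (congrArg (fun a => a.1) h).symm
    · exact (congrArg (fun a => a.2.2) h).symm

/-- For `m < r`, triples of cycles of the page `K = A_m` form cycles of `P_m(r; A)`. -/
def pathCycles (hs : m = r → s = -1) (hr : m ≠ r) (i j : ℤ × ℤ) :
    (LinearMap.ker (K.d i j).hom ×
      LinearMap.ker (K.d (shiftIdx r i) (shiftIdx r j)).hom ×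
      LinearMap.ker (K.d i j).hom) →ₗ[R]
    LinearMap.ker ((pathComplex r s K hs).d i j).hom :=
  LinearMap.codRestrict _
    ((LinearMap.ker (K.d i j).hom).subtype.prodMap
      ((LinearMap.ker (K.d (shiftIdx r i) (shiftIdx r j)).hom).subtype.prodMap
        (LinearMap.ker (K.d i j).hom).subtype)) (by
    rintro ⟨⟨x, hx⟩, ⟨y, hy⟩, ⟨z, hz⟩⟩
    refine (pathD_apply r s K i j (x, y, z)).trans ?_
    rw [if_neg hr, LinearMap.mem_ker.1 hx, LinearMap.mem_ker.1 hy, LinearMap.mem_ker.1 hz]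
    simp
    rfl)

lemma pathCycles_surjective (hs : m = r → s = -1) (hr : m ≠ r) (i j : ℤ × ℤ) :
    Function.Surjective (pathCycles r s K hs hr i j) := by
  rintro ⟨⟨x, y, z⟩, hw⟩
  have hw : pathD r s K i j (x, y, z) = 0 := hw
  rw [pathD_apply, if_neg hr, Prod.ext_iff, Prod.ext_iff] at hw
  obtain ⟨h1, h2, h3⟩ := hw
  refine ⟨(⟨x, h1⟩, ⟨y, ?_⟩, ⟨z, h3⟩), rfl⟩
  simp only [add_zero] at h2
  have h2' := congrArg (fun a => (s : ℤ) • a) h2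
  simp only [smul_smul] at h2'
  rw [← Units.val_mul, Int.units_mul_self] at h2'
  simpa using h2'

/-- The first components of the cycles of `P_r(r; A)`. -/
def pathFst (hs : m = r → s = -1) (i j : ℤ × ℤ) : LinearMap.ker ((pathComplex r s K hs).d i j).hom →ₗ[R]
    LinearMap.ker (K.d i j).hom :=
  (LinearMap.fst R (K.X i) (K.X (shiftIdx r i) × K.X i)).restrict
    (fun w (hw : pathD r s K i j w = 0) => by
      rw [pathD_apply, Prod.ext_iff] at hw
      exact hw.1)

end PathComplex

section PathIso

variable (r : ℕ) (A : SpSe.{u, v} R) (m m' : ℤ) (h : m + 1 = m') (hm : 0 ≤ m)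
  (s s' : ℤˣ) (hs : m = r → s = -1) (hs' : m' = r → s' = -1)

/-- For `m < r`, the characteristic map of `P(r; A)` is that of `A` on each summand. -/
def pathIsoLT (hr : m ≠ r) (i : ℤ × ℤ) :
    (pathComplex r s (A.page m) hs).homology i ≅ (pathComplex r s' (A.page m' (by lia)) hs').X i :=
  isoOfSurjective (N := ModuleCat.of R ((A.page m' (by lia)).X i ×
      (A.page m' (by lia)).X (shiftIdx r i) × (A.page m' (by lia)).X i))
    (homologyClass (pathComplex r s (A.page m) hs) i (i.1 - m, i.2 + 1 - m) (rel_up' m i.1 i.2) ∘ₗ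
      pathCycles r s (A.page m) hs hr i (i.1 - m, i.2 + 1 - m))
    ((A.charMap m m' h hm i (i.1 - m, i.2 + 1 - m) (rel_up' m i.1 i.2)).prodMap
      ((A.charMap m m' h hm (shiftIdx r i) (shiftIdx r (i.1 - m, i.2 + 1 - m))
        (rel_shift r (rel_up' m i.1 i.2))).prodMap
      (A.charMap m m' h hm i (i.1 - m, i.2 + 1 - m) (rel_up' m i.1 i.2))))
    ((homologyClass_surjective _ _ _ (rel_up' m i.1 i.2)).comp (pathCycles_surjective r s (A.page m) hs hr i _))
    ((A.charMap_surjective _ _ _ _ _ _ _).prodMap ((A.charMap_surjective _ _ _ _ _ _ _).prodMap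
      (A.charMap_surjective _ _ _ _ _ _ _)))
    (by
      rintro ⟨x, y, z⟩
      refine (homologyClass_eq_zero_iff (pathComplex r s (A.page m) hs) (i.1 + m, i.2 + m - 1) i
        (i.1 - m, i.2 + 1 - m) (rel_up'' m i.1 i.2) (rel_up' m i.1 i.2)
        (pathCycles r s (A.page m) hs hr i (i.1 - m, i.2 + 1 - m) (x, y, z))).trans ?_
      rw [LinearMap.prodMap_apply, LinearMap.prodMap_apply, Prod.ext_iff, Prod.ext_iff]
      simp only [Prod.fst_zero, Prod.snd_zero]
      rw [A.charMap_eq_zero_iff m m' h hm (i.1 + m, i.2 + m - 1) i _ (rel_up'' m i.1 i.2),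
        A.charMap_eq_zero_iff m m' h hm (i.1 + m, i.2 + m - 1) i _ (rel_up'' m i.1 i.2),
        A.charMap_eq_zero_iff m m' h hm (shiftIdx r (i.1 + m, i.2 + m - 1)) _ _
          (rel_shift r (rel_up'' m i.1 i.2)) (rel_shift r (rel_up' m i.1 i.2))]
      have hs : (s : ℤ) * (s : ℤ) =
          1 := by
        rw [← Units.val_mul, Int.units_mul_self, Units.val_one]
      constructor
      · rintro ⟨w, hw⟩
        revert w
        change ∀ w : (A.page m).X (i.1 + m, i.2 + m - 1) ×
            (A.page m).X (shiftIdx r (i.1 + m, i.2 + m - 1)) ×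
            (A.page m).X (i.1 + m, i.2 + m - 1), _ → _
        intro w hw
        have hw : pathD r s (A.page m) (i.1 + m, i.2 + m - 1) i w = (x.1, y.1, z.1) := hw
        rw [pathD_apply, if_neg hr, Prod.ext_iff, Prod.ext_iff] at hw
        obtain ⟨h1, h2, h3⟩ := hw
        refine ⟨⟨_, h1⟩, ⟨(s : ℤ) • w.2.1, ?_⟩, ⟨_, h3⟩⟩
        rw [map_zsmul]
        simpa using h2
      · rintro ⟨⟨a, ha⟩, ⟨b, hb⟩, ⟨c, hc⟩⟩
        refine ⟨(a, (s : ℤ) • b, c), ?_⟩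
        refine (pathD_apply r s (A.page m) (i.1 + m, i.2 + m - 1) i _).trans ?_
        refine Prod.ext ha (Prod.ext ?_ hc)
        simp only [if_neg hr, add_zero, map_zsmul, smul_smul, hs, one_smul]
        exact hb)

/-- For `m = r`, the characteristic map of `P(r; A)` sends the class of `(x, y, z)` to the image
of the class of `x` (which is also that of `z`). -/
def pathIsoEQ (hr : m = r) (i : ℤ × ℤ) :
    (pathComplex r s (A.page m) hs).homology i ≅ (A.page m' (by lia)).X i :=
  isoOfSurjective
    (homologyClass (pathComplex r s (A.page m) hs) i (i.1 - m, i.2 + 1 - m) (rel_up' m i.1 i.2))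
    (A.charMap m m' h hm i (i.1 - m, i.2 + 1 - m) (rel_up' m i.1 i.2) ∘ₗ
      pathFst r s (A.page m) hs i (i.1 - m, i.2 + 1 - m))
    (homologyClass_surjective _ _ _ _)
    ((A.charMap_surjective _ _ _ _ _ _ _).comp (by
      rintro ⟨x, hx⟩
      have hx := LinearMap.mem_ker.1 hx
      refine ⟨⟨(x, 0, x), ?_⟩, rfl⟩
      refine (pathD_apply r s (A.page m) i _ (x, 0, x)).trans ?_
      simp [hx]
      rfl))
    (by
      rintro ⟨⟨x, y, z⟩, hw⟩
      rw [homologyClass_eq_zero_iff (pathComplex r s (A.page m) hs) (shiftIdx r i) _ _ (by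
        rw [rel_iff]; constructor <;> simp only <;> omega)]
      rw [LinearMap.comp_apply, A.charMap_eq_zero_iff m m' h hm (shiftIdx r i) _ _ (by
        rw [rel_iff]; constructor <;> simp only <;> omega)]
      have hw : pathD r s (A.page m) i (i.1 - m, i.2 + 1 - m) (x, y, z) = 0 := hw
      rw [pathD_apply, if_pos hr, Prod.ext_iff, Prod.ext_iff, hs hr] at hw
      obtain ⟨h1, h2, h3⟩ := hw
      constructor
      · rintro ⟨w, hw⟩
        revert w
        change ∀ w : (A.page m).X (shiftIdx r i) × (A.page m).X (shiftIdx r (shiftIdx r i)) ×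
            (A.page m).X (shiftIdx r i), _ → _
        intro w hw
        have hw : pathD r s (A.page m) (shiftIdx r i) i w = (x, y, z) := hw
        rw [pathD_apply, Prod.ext_iff] at hw
        exact ⟨w.1, hw.1⟩
      · rintro ⟨a, ha⟩
        have ha : ((A.page m).d (shiftIdx r i) i).hom a = x := ha
        refine ⟨(a, 0, a + y), ?_⟩
        refine (pathD_apply r s (A.page m) (shiftIdx r i) i _).trans ?_
        refine Prod.ext ha (Prod.ext ?_ ?_)
        · simp [hr]
        · simp only [map_add, ha]
          have e : i = shiftIdx r (i.1 - m, i.2 + 1 - m) := by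
            refine Prod.ext ?_ ?_ <;> simp only <;> omega
          simp only [Units.val_neg, Units.val_one, neg_smul, one_smul, Prod.snd_zero,
            Prod.fst_zero] at h2
          have key : ∀ j, i = j → -((A.page m hm).d (shiftIdx r i) j).hom y +
              transport (A.page m hm) i j (z - x) = 0 →
              x + ((A.page m hm).d (shiftIdx r i) i).hom y = z := by
            rintro j rfl hh
            rw [transport_self, LinearMap.id_apply] at hh
            rw [neg_add_eq_zero] at hh
            rw [hh]
            abel
          exact key _ e h2)

lemma pathIsoLT_comm (ε : Bool) (hr : m ≠ r) (i : ℤ × ℤ) :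
    HomologicalComplex.homologyMap (pathComplexEnd r s (A.page m) hs ε) i ≫ (A.iso m m' i h hm).hom =
      (A.pathIsoLT r m m' h hm s s' hs hs' hr i).hom ≫ (pathComplexEnd r s' (A.page m') hs' ε).f i := by
  refine ModuleCat.hom_ext (LinearMap.ext fun w => ?_)
  obtain ⟨w, rfl⟩ := homologyClass_surjective _ i (i.1 - m, i.2 + 1 - m) (rel_up' m i.1 i.2) w
  obtain ⟨⟨x, y, z⟩, rfl⟩ := pathCycles_surjective r s (A.page m) hs hr i _ w
  have h1 : (A.pathIsoLT r m m' h hm s s' hs hs' hr i).hom.hom (homologyClass (pathComplex r s (A.page m) hs) i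
      (i.1 - m, i.2 + 1 - m) (rel_up' m i.1 i.2)
      (pathCycles r s (A.page m) hs hr i (i.1 - m, i.2 + 1 - m) (x, y, z))) =
      (A.charMap m m' h hm i (i.1 - m, i.2 + 1 - m) (rel_up' m i.1 i.2) x,
       A.charMap m m' h hm (shiftIdx r i) (shiftIdx r (i.1 - m, i.2 + 1 - m))
        (rel_shift r (rel_up' m i.1 i.2)) y,
       A.charMap m m' h hm i (i.1 - m, i.2 + 1 - m) (rel_up' m i.1 i.2) z) :=
    isoOfSurjective_hom_apply _ _ _ _ _ (x, y, z)
  refine Eq.trans ?_ (congrArg ((pathComplexEnd r s' (A.page m') hs' ε).f i).hom h1).symm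
  cases ε
  · exact congrArg (A.iso m m' i h hm).hom.hom
      (homologyMap_homologyClass (pathComplexEnd r s (A.page m) hs false) i _ (rel_up' m i.1 i.2)
        (pathCycles r s (A.page m) hs hr i (i.1 - m, i.2 + 1 - m) (x, y, z)) x.2)
  · exact congrArg (A.iso m m' i h hm).hom.hom
      (homologyMap_homologyClass (pathComplexEnd r s (A.page m) hs true) i _ (rel_up' m i.1 i.2)
        (pathCycles r s (A.page m) hs hr i (i.1 - m, i.2 + 1 - m) (x, y, z)) z.2)

lemma charMap_eq (hs : m = r → s = -1) (hr : m = r) (i : ℤ × ℤ) (x z : (A.page m).X i) (y : (A.page m).X (shiftIdx r i))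
    (hx : ((A.page m).d i (i.1 - m, i.2 + 1 - m)).hom x = 0)
    (hz : ((A.page m).d i (i.1 - m, i.2 + 1 - m)).hom z = 0)
    (hw : pathD r s (A.page m) i (i.1 - m, i.2 + 1 - m) (x, y, z) = 0) :
    A.charMap m m' h hm i (i.1 - m, i.2 + 1 - m) (rel_up' m i.1 i.2) ⟨z, hz⟩ =
      A.charMap m m' h hm i (i.1 - m, i.2 + 1 - m) (rel_up' m i.1 i.2) ⟨x, hx⟩ := by
  rw [← sub_eq_zero, ← map_sub, A.charMap_eq_zero_iff m m' h hm (shiftIdx r i) _ _ (by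
        rw [rel_iff]; constructor <;> simp only <;> omega)]
  refine ⟨y, ?_⟩
  rw [pathD_apply, if_pos hr, Prod.ext_iff, Prod.ext_iff, hs hr] at hw
  obtain ⟨-, h2, -⟩ := hw
  have e : i = shiftIdx r (i.1 - m, i.2 + 1 - m) := by
    refine Prod.ext ?_ ?_ <;> simp only <;> omega
  simp only [Units.val_neg, Units.val_one, neg_smul, one_smul, Prod.snd_zero,
    Prod.fst_zero] at h2
  have key : ∀ j, i = j → -((A.page m hm).d (shiftIdx r i) j).hom y +
      transport (A.page m hm) i j (z - x) = 0 →
      ((A.page m hm).d (shiftIdx r i) i).hom y = z - x := by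
    rintro j rfl hh
    rw [transport_self, LinearMap.id_apply] at hh
    rwa [neg_add_eq_zero] at hh
  exact key _ e h2

lemma pathIsoEQ_class (hr : m = r) (i : ℤ × ℤ)
    (w : LinearMap.ker ((pathComplex r s (A.page m) hs).d i (i.1 - m, i.2 + 1 - m)).hom) :
    (A.pathIsoEQ r m m' h hm s hs hr i).hom.hom (homologyClass (pathComplex r s (A.page m) hs) i
      (i.1 - m, i.2 + 1 - m) (rel_up' m i.1 i.2) w) =
      A.charMap m m' h hm i (i.1 - m, i.2 + 1 - m) (rel_up' m i.1 i.2)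
        (pathFst r s (A.page m) hs i (i.1 - m, i.2 + 1 - m) w) :=
  isoOfSurjective_hom_apply _ _ _ _ _ w

lemma pathIsoEQ_comm_apply (ε : Bool) (hr : m = r) (i : ℤ × ℤ)
    (w : LinearMap.ker ((pathComplex r s (A.page m) hs).d i (i.1 - m, i.2 + 1 - m)).hom) :
    (A.iso m m' i h hm).hom.hom
      ((HomologicalComplex.homologyMap (pathComplexEnd r s (A.page m) hs ε) i).hom
        (homologyClass (pathComplex r s (A.page m) hs) i (i.1 - m, i.2 + 1 - m)
          (rel_up' m i.1 i.2) w)) =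
      A.charMap m m' h hm i (i.1 - m, i.2 + 1 - m) (rel_up' m i.1 i.2)
        (pathFst r s (A.page m) hs i (i.1 - m, i.2 + 1 - m) w) := by
  have hw : pathD r s (A.page m) i (i.1 - m, i.2 + 1 - m) w.1 = 0 := w.2
  have hd := (pathD_apply r s (A.page m) i (i.1 - m, i.2 + 1 - m) w.1).symm.trans hw
  have hd1 := congrArg (fun a => a.1) hd
  have hd2 := congrArg (fun a => a.2.2) hd
  cases ε
  · rw [homologyMap_homologyClass (pathComplexEnd r s (A.page m) hs false) i _ (rel_up' m i.1 i.2)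
      w hd1]
    rfl
  · rw [homologyMap_homologyClass (pathComplexEnd r s (A.page m) hs true) i _ (rel_up' m i.1 i.2)
      w hd2]
    exact A.charMap_eq r m m' h hm s hs hr i w.1.1 w.1.2.2 w.1.2.1 hd1 hd2 hw

lemma pathIsoEQ_comm (ε : Bool) (hr : m = r) (i : ℤ × ℤ) :
    HomologicalComplex.homologyMap (pathComplexEnd r s (A.page m) hs ε) i ≫ (A.iso m m' i h hm).hom =
      (A.pathIsoEQ r m m' h hm s hs hr i).hom := by
  refine ModuleCat.hom_ext (LinearMap.ext fun w => ?_)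
  obtain ⟨w, rfl⟩ := homologyClass_surjective (pathComplex r s (A.page m) hs) i
    (i.1 - m, i.2 + 1 - m) (rel_up' m i.1 i.2) w
  exact (A.pathIsoEQ_comm_apply r m m' h hm s hs ε hr i w).trans
    (A.pathIsoEQ_class r m m' h hm s hs hr i w).symm

end PathIso

section Path

variable (r : ℕ) (s : ℤ → ℤˣ) (hs : s r = -1) (A : SpSe.{u, v} R)

lemma sign_eq {r : ℕ} {s : ℤ → ℤˣ} (hs : s r = -1) {m : ℤ} (h : m = r) : s m = -1 := by
  rw [h, hs]

/-- The page `P_m(r; A)`: the complex `pathComplex` for `m ≤ r`, and `A_m` for `m > r`. -/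
def pathPage (m : ℤ) (hm : 0 ≤ m) : Decidable (m ≤ r) →
    HomologicalComplex (ModuleCat.{v} R) (ComplexShape.up' ((-m, 1 - m) : ℤ × ℤ))
  | .isTrue _ => pathComplex r (s m) (A.page m) (sign_eq hs)
  | .isFalse _ => A.page m

/-- The characteristic maps of `P(r; A)`. -/
def pathIso (m m' : ℤ) (h : m + 1 = m') (hm : 0 ≤ m) (i : ℤ × ℤ) :
    (δ : Decidable (m ≤ r)) → (δ' : Decidable (m' ≤ r)) →
      ((pathPage r s hs A m hm δ).homology i ≅ (pathPage r s hs A m' (by lia) δ').X i)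
  | .isTrue _, .isTrue _ => A.pathIsoLT r m m' h hm (s m) (s m') (sign_eq hs) (sign_eq hs) (by omega) i
  | .isTrue _, .isFalse _ => A.pathIsoEQ r m m' h hm (s m) (sign_eq hs) (by omega) i
  | .isFalse _, .isFalse _ => A.iso m m' i h hm
  | .isFalse h₁, .isTrue h₂ => absurd h₂ (by omega)

/-- The `r`-path `P(r; A) = Λ_r ⊗ A` of a spectral sequence `A`, where `s m` is the sign with
which `d_m` acts on the summand `u ⊗ A_m`, `m ≤ r`. -/
def path : SpSe.{u, v} R where
  page m hm := pathPage r s hs A m hm inferInstance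
  iso m m' i h hm := pathIso r s hs A m m' h hm i inferInstance inferInstance

/-- The components of `∂^-` and `∂^+`: a projection for `m ≤ r` and the identity for `m > r`. -/
def pathPageEnd (ε : Bool) (m : ℤ) (hm : 0 ≤ m) :
    (δ : Decidable (m ≤ r)) → (pathPage r s hs A m hm δ ⟶ A.page m)
  | .isTrue _ => pathComplexEnd r (s m) (A.page m) (sign_eq hs) ε
  | .isFalse _ => 𝟙 (A.page m)

/-- The morphisms `∂^-` (for `ε = false`) and `∂^+` (for `ε = true`) from `P(r; A)` to `A`. -/
def pathEnd (ε : Bool) : path r s hs A ⟶ A where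
  hom m hm := pathPageEnd r s hs A ε m hm inferInstance
  comm m m' i h hm := by
    have key : ∀ (δ : Decidable (m ≤ r)) (δ' : Decidable (m' ≤ r)),
        HomologicalComplex.homologyMap (pathPageEnd r s hs A ε m hm δ) i ≫
            (A.iso m m' i h hm).hom =
          (pathIso r s hs A m m' h hm i δ δ').hom ≫
            (pathPageEnd r s hs A ε m' (by lia) δ').f i := by
      rintro (h₁ | h₁) (h₂ | h₂)
      · change HomologicalComplex.homologyMap (𝟙 (A.page m)) i ≫ (A.iso m m' i h hm).hom =
          (A.iso m m' i h hm).hom ≫ 𝟙 _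
        rw [HomologicalComplex.homologyMap_id, Category.id_comp, Category.comp_id]
      · omega
      · exact (A.pathIsoEQ_comm r m m' h hm (s m) (sign_eq hs) ε (by omega) i).trans
          (Category.comp_id _).symm
      · exact A.pathIsoLT_comm r m m' h hm (s m) (s m') (sign_eq hs) (sign_eq hs) ε (by omega) i
    exact key _ _

variable {A} {B : SpSe.{u, v} R}

/-- There is a morphism `h : A → P(r; B)` of spectral sequences with `∂^- h = f` and
`∂^+ h = g`, where the path `P(r; B)` is formed with the signs `s`. -/
def RHomotopicWith (f g : A ⟶ B) : Prop :=
  ∃ h : A ⟶ path r s hs B, h ≫ pathEnd r s hs B false = f ∧ h ≫ pathEnd r s hs B true = g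

/-- `r`-homotopy of morphisms of spectral sequences, where `d_m` acts on the middle summand
`u ⊗ A_m` of the path by the Koszul sign of the total degrees `1` of `u` and of `d_m`:
the middle entry of `D_m` is `-d_m` for all `m ≤ r`. -/
def RHomotopic (f g : A ⟶ B) : Prop :=
  RHomotopicWith r (fun _ => -1) rfl f g

/-- `r`-homotopy of morphisms of spectral sequences, where `d_m` acts on the middle summand
`u ⊗ A_m` of the path by the Koszul sign of the bidegrees `(-r, 1 - r)` of `u` and `(-m, 1 - m)`
of `d_m`: the middle entry of `D_m` is `(-1)^{m + r + 1} d_m` for all `m ≤ r`. -/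
def BigradedRHomotopic (f g : A ⟶ B) : Prop :=
  RHomotopicWith r (fun m => Int.negOnePow (m + r + 1))
    (by rw [Int.negOnePow_succ, Int.negOnePow_even _ ⟨_, rfl⟩]) f g

end Path

section Twist

/-- The complex with the differential `(-1)^{m n} d` in total degree `n = q - p`. -/
def twistComplex {m : ℤ}
    (K : HomologicalComplex (ModuleCat.{v} R) (ComplexShape.up' ((-m, 1 - m) : ℤ × ℤ))) :
    HomologicalComplex (ModuleCat.{v} R) (ComplexShape.up' ((-m, 1 - m) : ℤ × ℤ)) where
  X i := K.X i
  d i j := Int.negOnePow (m * (i.2 - i.1)) • K.d i j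
  shape i j h := by rw [K.shape i j h, smul_zero]
  d_comp_d' i j k _ _ := by simp

/-- A map of complexes, regarded as a map of twisted complexes. -/
def twistComplexMap {m : ℤ}
    {K L : HomologicalComplex (ModuleCat.{v} R) (ComplexShape.up' ((-m, 1 - m) : ℤ × ℤ))}
    (f : K ⟶ L) : twistComplex K ⟶ twistComplex L where
  f i := f.f i
  comm' i j _ := by simp [twistComplex]

lemma twistComplex_d_apply {m : ℤ}
    (K : HomologicalComplex (ModuleCat.{v} R) (ComplexShape.up' ((-m, 1 - m) : ℤ × ℤ)))
    (i j : ℤ × ℤ) (x : K.X i) : ((twistComplex K).d i j).hom x =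
      (Int.negOnePow (m * (i.2 - i.1)) : ℤˣ) • (K.d i j).hom x := rfl

/-- Cycles of the twisted complex are cycles. -/
def untwistCycles {m : ℤ}
    (K : HomologicalComplex (ModuleCat.{v} R) (ComplexShape.up' ((-m, 1 - m) : ℤ × ℤ)))
    (i j : ℤ × ℤ) : LinearMap.ker ((twistComplex K).d i j).hom →ₗ[R]
      LinearMap.ker (K.d i j).hom where
  toFun x := ⟨x.1, (smul_eq_zero_iff_eq (Int.negOnePow (m * (i.2 - i.1)) : ℤˣ)).1 x.2⟩
  map_add' _ _ := rfl
  map_smul' _ _ := rfl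

lemma untwistCycles_surjective {m : ℤ}
    (K : HomologicalComplex (ModuleCat.{v} R) (ComplexShape.up' ((-m, 1 - m) : ℤ × ℤ)))
    (i j : ℤ × ℤ) : Function.Surjective (untwistCycles K i j) := by
  rintro ⟨x, hx⟩
  have hx : (K.d i j).hom x = 0 := hx
  exact ⟨⟨x, (smul_eq_zero_iff_eq (Int.negOnePow (m * (i.2 - i.1)) : ℤˣ)).2 hx⟩, rfl⟩

lemma twist_boundary_iff {m : ℤ}
    (K : HomologicalComplex (ModuleCat.{v} R) (ComplexShape.up' ((-m, 1 - m) : ℤ × ℤ)))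
    (k i : ℤ × ℤ) (x : K.X i) :
    (∃ y : K.X k, (Int.negOnePow (m * (k.2 - k.1)) : ℤˣ) • (K.d k i).hom y = x) ↔
      ∃ y, (K.d k i).hom y = x := by
  constructor
  · rintro ⟨y, hy⟩
    refine ⟨(Int.negOnePow (m * (k.2 - k.1)) : ℤˣ) • y, ?_⟩
    rwa [Units.smul_def, map_zsmul]
  · rintro ⟨y, hy⟩
    refine ⟨(Int.negOnePow (m * (k.2 - k.1)) : ℤˣ) • y, ?_⟩
    rw [Units.smul_def, Units.smul_def, map_zsmul, smul_smul, ← Units.val_mul,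
      Int.units_mul_self, Units.val_one, one_smul]
    exact hy

lemma homologyClass_twist_eq_zero_iff {m : ℤ}
    (K : HomologicalComplex (ModuleCat.{v} R) (ComplexShape.up' ((-m, 1 - m) : ℤ × ℤ)))
    (k i j : ℤ × ℤ) (hki : (ComplexShape.up' ((-m, 1 - m) : ℤ × ℤ)).Rel k i)
    (hij : (ComplexShape.up' ((-m, 1 - m) : ℤ × ℤ)).Rel i j)
    (x : LinearMap.ker ((twistComplex K).d i j).hom) :
    homologyClass (twistComplex K) i j hij x = 0 ↔
      ∃ y, (K.d k i).hom y = (untwistCycles K i j x).1 :=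
  (homologyClass_eq_zero_iff (twistComplex K) k i j hki hij x).trans
    (twist_boundary_iff K k i x.1)

/-- The composition of `ker d_m → H(A_m)` with the characteristic map, on the cycles of the
twisted complex. -/
def twistCharMap (A : SpSe.{u, v} R) (m m' : ℤ) (h : m + 1 = m') (hm : 0 ≤ m) (i j : ℤ × ℤ)
    (hij : (ComplexShape.up' ((-m, 1 - m) : ℤ × ℤ)).Rel i j) :
    LinearMap.ker ((twistComplex (A.page m)).d i j).hom →ₗ[R] (A.page m' (by lia)).X i :=
  A.charMap m m' h hm i j hij ∘ₗ untwistCycles (A.page m) i j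

lemma twistCharMap_surjective (A : SpSe.{u, v} R) (m m' : ℤ) (h : m + 1 = m') (hm : 0 ≤ m)
    (i j : ℤ × ℤ) (hij : (ComplexShape.up' ((-m, 1 - m) : ℤ × ℤ)).Rel i j) :
    Function.Surjective (A.twistCharMap m m' h hm i j hij) :=
  (A.charMap_surjective m m' h hm i j hij).comp (untwistCycles_surjective (A.page m) i j)

lemma twistCharMap_iff (A : SpSe.{u, v} R) (m m' : ℤ) (h : m + 1 = m') (hm : 0 ≤ m)
    (k i j : ℤ × ℤ) (hki : (ComplexShape.up' ((-m, 1 - m) : ℤ × ℤ)).Rel k i)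
    (hij : (ComplexShape.up' ((-m, 1 - m) : ℤ × ℤ)).Rel i j)
    (x : LinearMap.ker ((twistComplex (A.page m)).d i j).hom) :
    homologyClass (twistComplex (A.page m)) i j hij x = 0 ↔
      A.twistCharMap m m' h hm i j hij x = 0 :=
  (homologyClass_twist_eq_zero_iff (A.page m) k i j hki hij x).trans
    (A.charMap_eq_zero_iff m m' h hm k i j hki hij (untwistCycles (A.page m) i j x)).symm

/-- The homology of the twisted complex is the homology of the complex. -/
def twistIso (A : SpSe.{u, v} R) (m m' : ℤ) (h : m + 1 = m') (hm : 0 ≤ m) (i : ℤ × ℤ) :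
    (twistComplex (A.page m)).homology i ≅ (A.page m' (by lia)).X i :=
  isoOfSurjective
    (homologyClass (twistComplex (A.page m)) i (i.1 - m, i.2 + 1 - m) (rel_up' m i.1 i.2))
    (A.twistCharMap m m' h hm i (i.1 - m, i.2 + 1 - m) (rel_up' m i.1 i.2))
    (homologyClass_surjective _ _ _ _)
    (A.twistCharMap_surjective m m' h hm i (i.1 - m, i.2 + 1 - m) (rel_up' m i.1 i.2))
    (A.twistCharMap_iff m m' h hm (i.1 + m, i.2 + m - 1) i (i.1 - m, i.2 + 1 - m)
      (rel_up'' m i.1 i.2) (rel_up' m i.1 i.2))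

/-- The map induced on the cycles of the twisted complexes. -/
def twistCyclesMap {m : ℤ}
    {K L : HomologicalComplex (ModuleCat.{v} R) (ComplexShape.up' ((-m, 1 - m) : ℤ × ℤ))}
    (f : K ⟶ L) (i j : ℤ × ℤ) : LinearMap.ker ((twistComplex K).d i j).hom →ₗ[R]
      LinearMap.ker ((twistComplex L).d i j).hom :=
  ((twistComplexMap f).f i).hom.restrict fun x hx => by
    have e := congrArg (fun φ => φ.hom x) ((twistComplexMap f).comm i j)
    exact LinearMap.mem_ker.2 (e.trans
      ((congrArg ((twistComplexMap f).f j).hom (LinearMap.mem_ker.1 hx)).trans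
        (map_zero ((twistComplexMap f).f j).hom)))

lemma twistCharMap_comm {A B : SpSe.{u, v} R} (f : A ⟶ B) (m m' : ℤ) (h : m + 1 = m')
    (hm : 0 ≤ m) (i j : ℤ × ℤ) (hij : (ComplexShape.up' ((-m, 1 - m) : ℤ × ℤ)).Rel i j)
    (w : LinearMap.ker ((twistComplex (A.page m)).d i j).hom) :
    B.twistCharMap m m' h hm i j hij (twistCyclesMap (f.hom m hm) i j w) =
      ((f.hom m' (by lia)).f i).hom (A.twistCharMap m m' h hm i j hij w) := by
  have h4 := homologyMap_homologyClass (f.hom m hm) i j hij (untwistCycles (A.page m) i j w)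
    (untwistCycles (B.page m) i j (twistCyclesMap (f.hom m hm) i j w)).2
  have h5 := congrArg (fun φ => φ.hom (homologyClass (A.page m) i j hij
    (untwistCycles (A.page m) i j w))) (f.comm m m' i h hm)
  exact (congrArg (B.iso m m' i h hm).hom.hom h4).symm.trans h5

lemma twistIso_comm {A B : SpSe.{u, v} R} (f : A ⟶ B) (m m' : ℤ) (h : m + 1 = m') (hm : 0 ≤ m)
    (i : ℤ × ℤ) : HomologicalComplex.homologyMap (twistComplexMap (f.hom m hm)) i ≫
      (B.twistIso m m' h hm i).hom =
        (A.twistIso m m' h hm i).hom ≫ (f.hom m' (by lia)).f i := by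
  refine ModuleCat.hom_ext (LinearMap.ext fun w => ?_)
  obtain ⟨w, rfl⟩ := homologyClass_surjective (twistComplex (A.page m)) i
    (i.1 - m, i.2 + 1 - m) (rel_up' m i.1 i.2) w
  have h1 : (A.twistIso m m' h hm i).hom.hom (homologyClass (twistComplex (A.page m)) i
      (i.1 - m, i.2 + 1 - m) (rel_up' m i.1 i.2) w) =
      A.twistCharMap m m' h hm i (i.1 - m, i.2 + 1 - m) (rel_up' m i.1 i.2) w :=
    isoOfSurjective_hom_apply _ _ _ _ _ w
  have h2 : (B.twistIso m m' h hm i).hom.hom (homologyClass (twistComplex (B.page m)) i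
      (i.1 - m, i.2 + 1 - m) (rel_up' m i.1 i.2)
        (twistCyclesMap (f.hom m hm) i (i.1 - m, i.2 + 1 - m) w)) =
      B.twistCharMap m m' h hm i (i.1 - m, i.2 + 1 - m) (rel_up' m i.1 i.2)
        (twistCyclesMap (f.hom m hm) i (i.1 - m, i.2 + 1 - m) w) :=
    isoOfSurjective_hom_apply _ _ _ _ _ _
  have h3 := homologyMap_homologyClass (twistComplexMap (f.hom m hm)) i (i.1 - m, i.2 + 1 - m)
    (rel_up' m i.1 i.2) w (twistCyclesMap (f.hom m hm) i (i.1 - m, i.2 + 1 - m) w).2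
  exact (congrArg (B.twistIso m m' h hm i).hom.hom h3).trans (h2.trans
    ((twistCharMap_comm f m m' h hm i (i.1 - m, i.2 + 1 - m) (rel_up' m i.1 i.2) w).trans
      (congrArg ((f.hom m' (by lia)).f i).hom h1).symm))

/-- The functor from the category of spectral sequences to itself which multiplies the
differential `d_m` in total degree `n = q - p` by the sign `(-1)^{m n}`, and leaves the modules
on all pages, the characteristic maps and the morphisms unchanged. -/
def twist : SpSe.{u, v} R ⥤ SpSe.{u, v} R where
  obj A :=
    { page m hm := twistComplex (A.page m)
      iso m m' i h hm := A.twistIso m m' h hm i }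
  map f :=
    { hom m hm := twistComplexMap (f.hom m)
      comm m m' i h hm := twistIso_comm f m m' h hm i }

end Twist

end SpSe

namespace Multicomplex

variable {R : Type u} [CommRing R]

/-- The functor `Ẽ = E ∘ Tot` from multicomplexes and `∞`-morphisms to spectral sequences. -/
def toSpSe : Multicomplex.{u, v} R ⥤ SpSe.{u, v} R := tot ⋙ FilteredComplex.toSpSe

end Multicomplex

namespace NMulticomplex

variable {R : Type u} [CommRing R]

/-- The spectral sequence functor `E' = E ∘ Tot` on `n`-multicomplexes and strict morphisms. -/
def toSpSe (n : ℕ∞) : NMulticomplex.{u, v} R n ⥤ SpSe.{u, v} R :=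
  incl n ⋙ Multicomplex.tot ⋙ FilteredComplex.toSpSe

end NMulticomplex

end

/-! Everything reduces to one universal homotopy. A homotopy h : C → P_r(D) from f to g writes f =
∂^- h and g = ∂^+ h. By functoriality it therefore suffices to find a homotopy from E'(∂^-) to
E'(∂^+) on P_r(D) and to precompose it with E'(h) (`RHomotopicWith.precomp`).

That homotopy already exists on filtered complexes. For a in Tot(P_r(D))^n put (s a)_j =
(-1)^{r(n-1)} (a_{j-r})_u. Since u has bidegree (-r, 1-r), s has degree -1 and raises the filtration
by at most r. In ds + sd the terms with d_m on the u-components cancel, because the Koszul sign of u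
against d_m, which is (-1)^{m+r+1}, combines with the signs (-1)^{mn} of the totalization. What is
left comes from d_r e_± = ±u and equals Tot(∂^+) - Tot(∂^-) (`totPathHomotopy_comm`).

A filtered homotopy ds + sd = g - f of shift r acts on E_m for m ≤ r by [x] ↦ [s x]
(`Homotopy.map_Z`, `Homotopy.mapE`). For m < r the element (g - f)x lies too low in the filtration
of the target to be seen, so s anticommutes with the differential (`mapE_dE_lt`). On E_r the
identity ds + sd = g - f survives (`mapE_dE_eq`), and for m > r the maps f and g agree (`mapE_eq`).
These are exactly the conditions under which x ↦ (f x, s x, g x) is a morphism into the path object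
with middle signs -1 (`HomotopyData`), that is, a total homotopy. Multiplying its middle component
in total degree n by (-1)^{r(n-1)} turns it into a bigraded homotopy of the twisted morphisms
(`HomotopyData.twist`).

For finite n the map α_D is φ ⊗ D, where φ : Λ_r^n → Λ_r is an ∞-morphism that collapses the
staircase: e_± goes to e_±, z_i to 0, and x_j to (-1)^{j + r - t_j} u in the component of index r -
t_j. The factor (-1)^{r - t_j} absorbs the sign in the relation for ∞-morphisms, and (-1)^j makes
the two differentials of each z_i cancel (`staircaseHom`). Postcomposition with α_D turns a strict
homotopy into one of ∞-morphisms with the same ends. -/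

noncomputable section

/-! ### ∞-morphisms of finite free multicomplexes, tensored with a multicomplex. -/

namespace FreeMulticomplex

variable {R : Type u} [CommRing R]

/-- An `∞`-morphism of free multicomplexes, given by integral matrices:
`f_m b = ∑ b', a m b b' • b'`. -/
structure Hom (Λ Λ' : FreeMulticomplex) where
  a : ℕ → Λ.B → Λ'.B → ℤ
  shape (m : ℕ) (b : Λ.B) (b' : Λ'.B)
    (h : ¬ (Λ'.degP b' = Λ.degP b - m ∧ Λ'.degQ b' = Λ.degQ b - m)) : a m b b' = 0
  comm (l : ℕ) (b : Λ.B) (b'' : Λ'.B) :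
    ∑ ij ∈ Finset.HasAntidiagonal.antidiagonal l, ∑ b', Λ'.c ij.1 b' b'' * a ij.2 b b' =
    ∑ ij ∈ Finset.HasAntidiagonal.antidiagonal l,
      (-1 : ℤ) ^ ij.1 * ∑ b', a ij.1 b' b'' * Λ.c ij.2 b b'

namespace Hom

variable {Λ Λ' : FreeMulticomplex} (φ : Hom Λ Λ')

/-- The components of `φ ⊗ A`. -/
def tensorF (A : Multicomplex.{u, v} R) (m : ℕ) (p q p' q' : ℤ) :
    (∀ b, A.X (p - Λ.degP b) (q - Λ.degQ b)) →ₗ[R] (∀ b, A.X (p' - Λ'.degP b) (q' - Λ'.degQ b)) :=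
  LinearMap.pi fun b' => ∑ b, φ.a m b b' • (bigradedId A.X (p - Λ.degP b) (q - Λ.degQ b)
      (p' - Λ'.degP b') (q' - Λ'.degQ b') ∘ₗ LinearMap.proj b)

lemma tensorF_apply (A : Multicomplex.{u, v} R) (m : ℕ) (p q p' q' : ℤ)
    (x : ∀ b, A.X (p - Λ.degP b) (q - Λ.degQ b)) (b' : Λ'.B) :
    φ.tensorF A m p q p' q' x b' = ∑ b, φ.a m b b' • bigradedId A.X (p - Λ.degP b) (q - Λ.degQ b)
      (p' - Λ'.degP b') (q' - Λ'.degQ b') (x b) := by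
  simp [tensorF]

/-- Lowering both degrees of b by m changes ⟨b, d_i⟩ by m(2i - 1), which has the parity of m. The
resulting (-1)^m is the sign that the relation for ∞-morphisms asks for, so φ ⊗ A needs no sign of
its own. -/
lemma sign_eq (i m : ℕ) (b : Λ.B) (b' : Λ'.B) (h : Λ'.degP b' = Λ.degP b - m)
    (h' : Λ'.degQ b' = Λ.degQ b - m) : Λ'.sign i b' = (-1 : ℤ) ^ m * Λ.sign i b := by
  have e : (-1 : ℤ) ^ m = (Int.negOnePow m : ℤˣ) := by simp [Int.negOnePow_def]
  rw [e, sign, sign, ← Units.val_mul, ← Int.negOnePow_add, h, h']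
  congr 1
  rw [Int.negOnePow_eq_iff]
  exact ⟨m * (i - 1), by ring⟩

/-- In the part of the relation where the differential of A acts, the terms match one by one; no
summation over the antidiagonal is needed. -/
lemma tensorF_comm_d (A : Multicomplex.{u, v} R) (i j : ℕ) (p q p' q' : ℤ)
    (x : ∀ b, A.X (p - Λ.degP b) (q - Λ.degQ b)) (b : Λ.B) (b'' : Λ'.B) :
    (Λ'.sign i b'' * φ.a j b b'') •
      A.d i (p - j - Λ'.degP b'') (q - j - Λ'.degQ b'') (p' - Λ'.degP b'') (q' - Λ'.degQ b'')
        (bigradedId A.X (p - Λ.degP b) (q - Λ.degQ b) (p - j - Λ'.degP b'')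
          (q - j - Λ'.degQ b'') (x b)) =
    ((-1 : ℤ) ^ j * (φ.a j b b'' * Λ.sign i b)) •
      bigradedId A.X (p - i - Λ.degP b) (q + 1 - i - Λ.degQ b) (p' - Λ'.degP b'')
        (q' - Λ'.degQ b'') (A.d i (p - Λ.degP b) (q - Λ.degQ b) (p - i - Λ.degP b)
          (q + 1 - i - Λ.degQ b) (x b)) := by
  by_cases hc : Λ'.degP b'' = Λ.degP b - j ∧ Λ'.degQ b'' = Λ.degQ b - j
  · rw [sign_eq i j b b'' hc.1 hc.2]
    by_cases hd : p' = p - i - j ∧ q' = q + 1 - i - j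
    · rw [d_bigradedId A i _ _ _ _ (p - i - Λ.degP b) (q + 1 - i - Λ.degQ b) _ _
          (by omega) (by omega)]
      congr 1
      ring
    -- In the wrong bidegree the left side vanishes through d_i and the right side through the
    -- transport.
    · rw [A.shape i _ _ _ _ (by omega),
          bigradedId_ne (p - i - Λ.degP b) (q + 1 - i - Λ.degQ b) _ _ (by omega)]
      simp
  · rw [φ.shape _ _ _ hc]; simp

/-- The differential of a tensor product has a part from A and a part from the basis. The first
parts match by `tensorF_comm_d`; the second parts reduce, coefficient by coefficient, to the
relation `comm` of the matrices of φ. -/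
lemma tensorF_comm (A : Multicomplex.{u, v} R) (l : ℕ) (p q p' q' : ℤ)
    (x : ∀ b, A.X (p - Λ.degP b) (q - Λ.degQ b)) (b'' : Λ'.B) :
    ∑ ij ∈ Finset.HasAntidiagonal.antidiagonal l,
      Λ'.tensorD A ij.1 (p - ij.2) (q - ij.2) p' q'
        (φ.tensorF A ij.2 p q (p - ij.2) (q - ij.2) x) b'' =
    ∑ ij ∈ Finset.HasAntidiagonal.antidiagonal l, (-1 : ℤ) ^ ij.1 •
      φ.tensorF A ij.1 (p - ij.2) (q + 1 - ij.2) p' q'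
        (Λ.tensorD A ij.2 p q (p - ij.2) (q + 1 - ij.2) x) b'' := by
  simp only [tensorD_apply, tensorF_apply, map_add, map_sum, map_zsmul, smul_add, Finset.smul_sum,
    smul_smul, Finset.sum_add_distrib]
  congr 1
  -- The index of the differential is the first entry of the pair on the left and the second on the
  -- right.
  · rw [← Finset.Nat.sum_antidiagonal_swap]
    refine Finset.sum_congr rfl fun ij _ => Finset.sum_congr rfl fun b _ => ?_
    exact φ.tensorF_comm_d A ij.2 ij.1 p q p' q' x b b''
  · have hL : ∀ ij ∈ Finset.HasAntidiagonal.antidiagonal l, (∑ b', ∑ b,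
        (Λ'.c ij.1 b' b'' * φ.a ij.2 b b') •
          bigradedId A.X (p - ij.2 - Λ'.degP b') (q - ij.2 - Λ'.degQ b') (p' - Λ'.degP b'')
            (q' - Λ'.degQ b'') (bigradedId A.X (p - Λ.degP b) (q - Λ.degQ b)
              (p - ij.2 - Λ'.degP b') (q - ij.2 - Λ'.degQ b') (x b))) =
        ∑ b, (∑ b', Λ'.c ij.1 b' b'' * φ.a ij.2 b b') •
          bigradedId A.X (p - Λ.degP b) (q - Λ.degQ b) (p' - Λ'.degP b'')
            (q' - Λ'.degQ b'') (x b) := by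
      intro ij _
      rw [Finset.sum_comm]
      refine Finset.sum_congr rfl fun b _ => ?_
      rw [Finset.sum_smul]
      refine Finset.sum_congr rfl fun b' _ => ?_
      -- The two transports compose to one only if the intermediate bidegree is right; otherwise the
      -- matrix entry is zero.
      by_cases hc : Λ'.degP b' = Λ.degP b - ij.2 ∧ Λ'.degQ b' = Λ.degQ b - ij.2
      · rw [bigradedId_trans _ _ _ _ _ _ (by omega)]
      · rw [φ.shape _ _ _ hc]; simp
    have hR : ∀ ij ∈ Finset.HasAntidiagonal.antidiagonal l, (∑ b', ∑ b,
        ((-1 : ℤ) ^ ij.1 * (φ.a ij.1 b' b'' * Λ.c ij.2 b b')) •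
          bigradedId A.X (p - ij.2 - Λ.degP b') (q + 1 - ij.2 - Λ.degQ b') (p' - Λ'.degP b'')
            (q' - Λ'.degQ b'') (bigradedId A.X (p - Λ.degP b) (q - Λ.degQ b)
              (p - ij.2 - Λ.degP b') (q + 1 - ij.2 - Λ.degQ b') (x b))) =
        ∑ b, ((-1 : ℤ) ^ ij.1 * ∑ b', φ.a ij.1 b' b'' * Λ.c ij.2 b b') •
          bigradedId A.X (p - Λ.degP b) (q - Λ.degQ b) (p' - Λ'.degP b'')
            (q' - Λ'.degQ b'') (x b) := by
      intro ij _
      rw [Finset.sum_comm]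
      refine Finset.sum_congr rfl fun b _ => ?_
      rw [Finset.mul_sum, Finset.sum_smul]
      refine Finset.sum_congr rfl fun b' _ => ?_
      by_cases hc : Λ.degP b' = Λ.degP b - ij.2 ∧ Λ.degQ b' = Λ.degQ b + 1 - ij.2
      · rw [bigradedId_trans _ _ _ _ _ _ (by omega)]
      · rw [Λ.shape _ _ _ hc]; simp
    rw [Finset.sum_congr rfl hL, Finset.sum_congr rfl hR, Finset.sum_comm,
      Finset.sum_comm (s := Finset.HasAntidiagonal.antidiagonal l)]
    refine Finset.sum_congr rfl fun b _ => ?_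
    rw [← Finset.sum_smul, ← Finset.sum_smul, φ.comm]

/-- The `∞`-morphism `φ ⊗ A`. -/
def tensor (A : Multicomplex.{u, v} R) : Λ.tensor A ⟶ Λ'.tensor A where
  f m p q p' q' := φ.tensorF A m p q p' q'
  shape m p q p' q' h := by
    refine LinearMap.ext fun x => funext fun b' => (φ.tensorF_apply A m p q p' q' x b').trans ?_
    refine Finset.sum_eq_zero fun b _ => ?_
    by_cases hc : Λ'.degP b' = Λ.degP b - m ∧ Λ'.degQ b' = Λ.degQ b - m
    · rw [bigradedId_ne _ _ _ _ (by omega)]; simp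
    · rw [φ.shape _ _ _ hc]; simp
  comm l p q p' q' := by
    refine LinearMap.ext fun x => funext fun b'' => ?_
    have h := φ.tensorF_comm A l p q p' q' x b''
    simp only [LinearMap.sum_apply]
    have e : ∀ F : ℕ × ℕ → ∀ b, A.X (p' - Λ'.degP b) (q' - Λ'.degQ b),
        (∑ ij ∈ Finset.HasAntidiagonal.antidiagonal l, F ij) b'' =
          ∑ ij ∈ Finset.HasAntidiagonal.antidiagonal l, F ij b'' := fun F =>
      Finset.sum_apply b'' _ F
    exact (e _).trans (h.trans (Eq.symm ((e _).trans rfl)))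

/-- The map φ ⊗ A is built from integers and transports between summands, both of which commute with
any strict morphism. This gives the naturality of α. -/
lemma tensorF_naturality {A B : Multicomplex.{u, v} R} (f : A.StrictHom B) (m : ℕ)
    (p q p' q' : ℤ) (x : ∀ b, A.X (p - Λ.degP b) (q - Λ.degQ b)) (b' : Λ'.B) :
    φ.tensorF B m p q p' q' (fun b => f.f _ _ (x b)) b' =
      f.f _ _ (φ.tensorF A m p q p' q' x b') := by
  rw [tensorF_apply, tensorF_apply, map_sum]
  refine Finset.sum_congr rfl fun b _ => ?_
  rw [map_zsmul]
  congr 1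
  generalize p' - Λ'.degP b' = s
  generalize q' - Λ'.degQ b' = t
  by_cases h : p - Λ.degP b = s ∧ q - Λ.degQ b = t
  · obtain ⟨rfl, rfl⟩ := h
    simp
  · simp [bigradedId_ne _ _ _ _ h]

end Hom

end FreeMulticomplex

/-! ### Composition of ∞-morphisms with strict morphisms. -/

namespace Multicomplex

variable {R : Type u} [CommRing R]

lemma Hom.ext_diagonal {A B : Multicomplex.{u, v} R} {f g : A ⟶ B}
    (h : ∀ (m : ℕ) (p q : ℤ), Hom.f f m p q (p - m) (q - m) = Hom.f g m p q (p - m) (q - m)) :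
    f = g := by
  refine Hom.ext (funext fun m => funext fun p => funext fun q => funext fun p' => funext fun q' =>
    ?_)
  by_cases hp : p' = p - m ∧ q' = q - m
  · obtain ⟨rfl, rfl⟩ := hp
    exact h m p q
  · rw [Hom.shape f _ _ _ _ _ hp, Hom.shape g _ _ _ _ _ hp]

/-- A strict morphism is concentrated in index 0, so a single summand of the convolution remains. -/
lemma toHom_comp_f {A B C : Multicomplex.{u, v} R} (f : A.StrictHom B) (g : B ⟶ C) (m : ℕ)
    (p q p' q' : ℤ) : Hom.f (f.toHom ≫ g) m p q p' q' = Hom.f g m p q p' q' ∘ₗ f.f p q := by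
  refine (congrArg (fun F : BiFamily A.X C.X => F m p q p' q')
    (Hom.comp_f f.toHom g)).trans ?_
  rw [conv_zero_index, Finset.sum_eq_single (m, 0)]
  · have h1 := BiFamily.comp_index (Hom.f g) (fun _ => bigradedId B.X) m 0 p q (p - (0 : ℕ))
      (q - (0 : ℕ)) p q p' q' (by simp) (by simp)
    simp only [StrictHom.toHom, if_true]
    rw [← LinearMap.comp_assoc, h1, bigradedId_self, LinearMap.comp_id]
  · rintro ⟨a, b⟩ h1 h2
    have : b ≠ 0 := by rintro rfl; simp at h1 h2; omega
    simp [this, StrictHom.toHom]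
  · simp

lemma comp_toHom_f {A B C : Multicomplex.{u, v} R} (f : A ⟶ B) (g : B.StrictHom C) (m : ℕ)
    (p q p' q' : ℤ) : Hom.f (f ≫ g.toHom) m p q p' q' = g.f p' q' ∘ₗ Hom.f f m p q p' q' := by
  -- The strict factor contains the transport from (p - m, q - m) to (p', q'), which is the identity
  -- only on this diagonal; elsewhere both sides vanish by `shape`.
  by_cases h : p' = p - m ∧ q' = q - m
  · obtain ⟨rfl, rfl⟩ := h
    refine (congrArg (fun F : BiFamily A.X C.X => F m p q (p - m) (q - m))
      (Hom.comp_f f g.toHom)).trans ?_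
    rw [conv_zero_index, Finset.sum_eq_single (0, m)]
    · simp [StrictHom.toHom]
    · rintro ⟨a, b⟩ h1 h2
      have : a ≠ 0 := by rintro rfl; simp at h1 h2; omega
      simp [this, StrictHom.toHom]
    · simp
  · rw [Hom.shape _ _ _ _ _ _ h, Hom.shape _ _ _ _ _ _ h, LinearMap.comp_zero]

end Multicomplex

/-! ### The ∞-morphism that collapses the staircase Λ_r^n onto Λ_r. -/

namespace FreeMulticomplex

/-- The coefficients of the `∞`-morphism `Λ_r^n → Λ_r`, which maps `e_±` to `e_±`, `x_j` to
`(-1)^{j + r - t_j} u` and `z_i` to zero. -/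
def staircaseCoeff (n r m : ℕ) : (staircase n r).B → (interval r).B → ℤ
  | .inl ε, .inl ε' => if m = 0 ∧ ε = ε' then 1 else 0
  | .inr (.inr j), .inr _ =>
      if m + stairPos n r j = r then (-1) ^ (j.1 + (r - stairPos n r j)) else 0
  | _, _ => 0

lemma stairPos_le (n r j : ℕ) : stairPos n r j ≤ r := min_le_right _ _

/-- Each family summed below is a sum of families supported at one pair of indices, so a sum over
the antidiagonal only tests whether that pair has the right total. -/
lemma sum_antidiagonal_eq_ite (l s t : ℕ) (F : ℕ × ℕ → ℤ) (h : ∀ ij, ij ≠ (s, t) → F ij = 0) :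
    ∑ ij ∈ Finset.HasAntidiagonal.antidiagonal l, F ij = if s + t = l then F (s, t) else 0 := by
  by_cases hl : s + t = l
  · rw [if_pos hl, Finset.sum_eq_single (s, t) (fun ij _ hij => h ij hij)]
    intro hn
    exact absurd (Finset.HasAntidiagonal.mem_antidiagonal.2 hl) hn
  · rw [if_neg hl]
    refine Finset.sum_eq_zero fun ij hij => h ij ?_
    rintro rfl
    exact hl (Finset.HasAntidiagonal.mem_antidiagonal.1 hij)

lemma neg_one_pow_mul_add (a b : ℕ) : (-1 : ℤ) ^ a * (-1) ^ (b + a) = (-1) ^ b := by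
  rw [pow_add, mul_left_comm, ← mul_pow]
  simp

/-- Both sides are ±u and occur only for l = r: the left is d_r f_0, the right is f_{r - t_0}
d_{t_0}. The coefficient (-1)^{r - t_0} of x_0 cancels the sign (-1)^i of the relation. -/
lemma staircaseCoeff_comm_end (n r l : ℕ) (ε : Bool) :
    ∑ ij ∈ Finset.HasAntidiagonal.antidiagonal l, ∑ b', (interval r).c ij.1 b' (.inr ()) *
      staircaseCoeff n r ij.2 (.inl ε) b' =
    ∑ ij ∈ Finset.HasAntidiagonal.antidiagonal l, (-1 : ℤ) ^ ij.1 *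
      ∑ b', staircaseCoeff n r ij.1 b' (.inr ()) * (staircase n r).c ij.2 (.inl ε) b' := by
  have hL : ∀ ij : ℕ × ℕ, ∑ b', (interval r).c ij.1 b' (.inr ()) *
      staircaseCoeff n r ij.2 (.inl ε) b' =
      if ij.1 = r ∧ ij.2 = 0 then (if ε then 1 else -1) else 0 := by
    intro ij
    -- The image of e_ε is e_ε itself, so no other basis element intervenes.
    refine (Finset.sum_eq_single (.inl ε : (interval r).B) ?_ ?_).trans ?_
    rotate_left 2
    · by_cases h1 : ij.1 = r <;> by_cases h2 : ij.2 = 0 <;>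
        simp [interval, staircaseCoeff, h1, h2]
    · rintro (ε' | _) - hne
      · have : ε ≠ ε' := fun e => hne (by rw [e])
        simp [staircaseCoeff, this]
      · simp [interval]
    · exact fun h => absurd (Finset.mem_univ _) h
  have hR : ∀ ij : ℕ × ℕ, ∑ b', staircaseCoeff n r ij.1 b' (.inr ()) *
      (staircase n r).c ij.2 (.inl ε) b' =
      if ij.1 = r - stairPos n r 0 ∧ ij.2 = stairPos n r 0 then
        (-1) ^ ij.1 * (if ε then 1 else -1) else 0 := by
    intro ij
    -- The differentials of e_ε reach only x_0.
    refine (Finset.sum_eq_single (.inr (.inr 0) : (staircase n r).B) ?_ ?_).trans ?_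
    rotate_left 2
    · have h0 := stairPos_le n r 0
      by_cases h1 : ij.1 = r - stairPos n r 0 <;> by_cases h2 : ij.2 = stairPos n r 0 <;>
        simp [staircase, staircaseCoeff, h1, h2, h0]
      omega
    · rintro (ε' | i' | j') - hne
      · simp [staircase]
      · simp [staircase]
      · have : j'.1 ≠ 0 := fun e => hne (by rw [Fin.ext (b := 0) e])
        simp [staircase, this]
    · exact fun h => absurd (Finset.mem_univ _) h
  simp only [hL, hR]
  rw [sum_antidiagonal_eq_ite l r 0 _ (fun ij hij => if_neg fun h => hij (Prod.ext h.1 h.2)),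
    sum_antidiagonal_eq_ite l (r - stairPos n r 0) (stairPos n r 0) _
      (fun ij hij => by rw [if_neg fun h => hij (Prod.ext h.1 h.2), mul_zero])]
  have h0 := stairPos_le n r 0
  simp [h0, ← mul_pow]

/-- The left side is zero because z is sent to 0. On the right the two differentials of z lead to
consecutive x's, whose images in u have opposite signs once (-1)^{r - t_j} has absorbed the sign of
the relation. The index is zero-based: i stands for z_{i+1}, with differentials to x_i and x_{i+1}.
-/
lemma staircaseCoeff_comm_step (n r l : ℕ) (i : Fin ((r - 1) / (n - 1))) :
    ∑ ij ∈ Finset.HasAntidiagonal.antidiagonal l, ∑ b', (interval r).c ij.1 b' (.inr ()) *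
      staircaseCoeff n r ij.2 (.inr (.inl i)) b' =
    ∑ ij ∈ Finset.HasAntidiagonal.antidiagonal l, (-1 : ℤ) ^ ij.1 *
      ∑ b', staircaseCoeff n r ij.1 b' (.inr ()) *
        (staircase n r).c ij.2 (.inr (.inl i)) b' := by
  -- The existence of z_{i+1} forces (i + 1)N ≤ r - 1, so x_i is not yet the truncated last step and
  -- t_i = (i + 1)N.
  have hi : (i.1 + 1) * (n - 1) ≤ r - 1 :=
    (Nat.mul_le_mul_right _ i.2).trans (Nat.div_mul_le_self _ _)
  have hr : r ≠ 0 := by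
    rintro rfl
    have := i.2
    simp at this
  have hN : (i.1 + 1) * (n - 1) ≤ (i.1 + 1 + 1) * (n - 1) :=
    Nat.mul_le_mul_right _ (Nat.le_succ _)
  have ht : stairPos n r i = (i.1 + 1) * (n - 1) := min_eq_left (by omega)
  have ht' : (i.1 + 1) * (n - 1) ≤ stairPos n r (i.1 + 1) := le_min hN (by omega)
  have h1 := stairPos_le n r (i.1 + 1)
  set t := (i.1 + 1) * (n - 1) with htdef
  have hR : ∀ ij : ℕ × ℕ, (-1 : ℤ) ^ ij.1 * ∑ b', staircaseCoeff n r ij.1 b' (.inr ()) *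
      (staircase n r).c ij.2 (.inr (.inl i)) b' =
      (if ij.1 = r - t ∧ ij.2 = 0 then (-1) ^ i.1 else 0) +
      (if ij.1 = r - stairPos n r (i.1 + 1) ∧ ij.2 = stairPos n r (i.1 + 1) - t then
        (-1) ^ (i.1 + 1) else 0) := by
    intro ij
    refine (congrArg _ (Finset.sum_eq_add (.inr (.inr i.castSucc) : (staircase n r).B)
      (.inr (.inr i.succ)) (by simp [Fin.ext_iff]) ?_ ?_ ?_)).trans ?_
    rotate_left 3
    · rw [mul_add]
      congr 1
      · by_cases h2 : ij.1 = r - t <;> by_cases h3 : ij.2 = 0 <;>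
          simp [staircase, staircaseCoeff, h2, h3, ht]
        · rw [if_pos (by omega), neg_one_pow_mul_add]
        · omega
      · by_cases h2 : ij.1 = r - stairPos n r (i.1 + 1) <;>
          by_cases h3 : ij.2 = stairPos n r (i.1 + 1) - t <;>
          simp [staircase, staircaseCoeff, h2, h3, h1, ← htdef]
        · exact neg_one_pow_mul_add _ _
        · omega
    · rintro (ε' | i' | j') - hne
      · simp [staircase]
      · simp [staircase]
      · have : j'.1 ≠ i.1 := fun e => hne.1 (by rw [Fin.ext (a := j') (b := i.castSucc) e])
        have : j'.1 ≠ i.1 + 1 := fun e => hne.2 (by rw [Fin.ext (a := j') (b := i.succ) e])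
        simp [staircase, *]
    · exact fun h => absurd (Finset.mem_univ _) h
    · exact fun h => absurd (Finset.mem_univ _) h
  refine (Finset.sum_eq_zero fun ij _ => Finset.sum_eq_zero fun b' _ => ?_).trans ?_
  · rcases b' with ε' | _ <;> simp [interval, staircaseCoeff]
  · simp only [hR, Finset.sum_add_distrib]
    rw [sum_antidiagonal_eq_ite l (r - t) 0 _
        (fun ij hij => if_neg fun h => hij (Prod.ext h.1 h.2)),
      sum_antidiagonal_eq_ite l (r - stairPos n r (i.1 + 1)) (stairPos n r (i.1 + 1) - t) _
        (fun ij hij => if_neg fun h => hij (Prod.ext h.1 h.2))]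
    -- Both contributions occur for the same l, namely r - t, so they can cancel.
    rw [show r - stairPos n r (i.1 + 1) + (stairPos n r (i.1 + 1) - t) = r - t + 0 by omega]
    simp only [and_self, if_true]
    split_ifs <;> simp [pow_succ]

/-- The `∞`-morphism `Λ_r^n → Λ_r`. -/
def staircaseHom (n r : ℕ) : Hom (staircase n r) (interval r) where
  a m b b' := staircaseCoeff n r m b b'
  shape m b b' h := by
    rcases b with ε | i | j <;> rcases b' with ε' | _ <;>
      simp only [staircaseCoeff, staircase, interval, Sum.elim_inl, Sum.elim_inr] at h ⊢
    · rw [if_neg]; rintro ⟨rfl, -⟩; simp at h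
    · rw [if_neg]; omega
  comm l b b'' := by
    rcases b'' with ε'' | _
    · refine Eq.trans (Finset.sum_eq_zero fun ij _ => Finset.sum_eq_zero fun b' _ => ?_)
        (Finset.sum_eq_zero fun ij _ => ?_).symm
      · rcases b' with ε' | _ <;> simp [interval]
      · rw [Finset.sum_eq_zero, mul_zero]
        rintro (ε' | i' | j') - <;> rcases b with ε | i | j <;> simp [staircase, staircaseCoeff]
    · rcases b with ε | i | j
      · exact staircaseCoeff_comm_end n r l ε
      · exact staircaseCoeff_comm_step n r l i
      · refine Eq.trans (Finset.sum_eq_zero fun ij _ => Finset.sum_eq_zero fun b' _ => ?_)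
          (Finset.sum_eq_zero fun ij _ => ?_).symm
        · rcases b' with ε' | _ <;> simp [interval, staircaseCoeff]
        · rw [Finset.sum_eq_zero, mul_zero]
          rintro (ε' | i' | j') - <;> simp [staircase]

end FreeMulticomplex

/-! ### The comparison of path functors and its compatibility with the ends. -/

namespace NMulticomplex

variable {R : Type u} [CommRing R]

lemma staircaseHom_tensor_naturality (n r : ℕ) {A B : Multicomplex.{u, v} R} (f : A.StrictHom B) :
    ((FreeMulticomplex.staircase n r).tensorMap f).toHom ≫
        (FreeMulticomplex.staircaseHom n r).tensor B =
      (FreeMulticomplex.staircaseHom n r).tensor A ≫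
        ((FreeMulticomplex.interval r).tensorMap f).toHom := by
  refine Multicomplex.Hom.ext_diagonal fun m p q => ?_
  rw [Multicomplex.toHom_comp_f, Multicomplex.comp_toHom_f]
  refine LinearMap.ext fun x => funext fun b' => ?_
  exact (FreeMulticomplex.staircaseHom n r).tensorF_naturality f m p q _ _ x b'

/-- Among all basis elements only e_ε has a component along e_ε, and that component is the identity
in index 0. Hence the projection after φ ⊗ D is again the strict projection. -/
lemma staircaseHom_tensor_pathEnd (n : ℕ) (hn : 2 ≤ n) (r : ℕ) (ε : Bool)
    (D : NMulticomplex.{u, v} R n) :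
    (FreeMulticomplex.staircaseHom n r).tensor D.toMulticomplex ≫
        Multicomplex.pathEnd r ε D.toMulticomplex =
      (incl n).map (pathEnd n hn r ε D) := by
  refine Multicomplex.Hom.ext_diagonal fun m p q => ?_
  refine (Multicomplex.comp_toHom_f _ _ m p q _ _).trans ?_
  refine LinearMap.ext fun (x : ∀ b, D.X (p - (FreeMulticomplex.staircase n r).degP b)
    (q - (FreeMulticomplex.staircase n r).degQ b)) => ?_
  change bigradedId D.X (p - m - 0) (q - m - 0) (p - m) (q - m)
      ((FreeMulticomplex.staircaseHom n r).tensorF D.toMulticomplex m p q (p - m) (q - m) x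
        (.inl ε)) = (if m = 0 then bigradedId D.X p q (p - m) (q - m) ∘ₗ
      (bigradedId D.X (p - 0) (q - 0) p q ∘ₗ
        LinearMap.proj (φ := fun b => D.X (p - (FreeMulticomplex.staircase n r).degP b)
          (q - (FreeMulticomplex.staircase n r).degQ b)) (.inl ε)) else 0) x
  refine (congrArg (bigradedId D.X (p - m - 0) (q - m - 0) (p - m) (q - m))
    (((FreeMulticomplex.staircaseHom n r).tensorF_apply D.toMulticomplex m p q (p - m) (q - m) x
      (.inl ε)).trans (Finset.sum_eq_single (.inl ε : (FreeMulticomplex.staircase n r).B)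
        ?_ ?_))).trans ?_
  · rintro (ε' | i | j) - hne
    · have : ε' ≠ ε := fun e => hne (by rw [e])
      simp [FreeMulticomplex.staircaseHom, FreeMulticomplex.staircaseCoeff, this]
    · simp [FreeMulticomplex.staircaseHom, FreeMulticomplex.staircaseCoeff]
    · simp [FreeMulticomplex.staircaseHom, FreeMulticomplex.staircaseCoeff]
  · exact fun h => absurd (Finset.mem_univ _) h
  · change bigradedId D.X (p - m - 0) (q - m - 0) (p - m) (q - m)
      ((if m = 0 ∧ ε = ε then 1 else 0 : ℤ) • bigradedId D.X (p - 0) (q - 0) (p - m - 0)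
        (q - m - 0) (x (.inl ε))) = _
    by_cases hm : m = 0
    · subst hm
      -- What remains on each side is a chain of transports between equal bidegrees, written
      -- differently because the degree 0 of e_ε is subtracted.
      simp only [and_self, if_true, one_smul, LinearMap.comp_apply]
      exact (FreeMulticomplex.bigradedId_trans (p - 0) (q - 0) _ _ _ _ (by simp) _).trans
        (FreeMulticomplex.bigradedId_trans (p - 0) (q - 0) _ _ _ _ (by simp) _).symm
    · simp [hm]

/-- The natural `∞`-morphisms `P_r^n(D) → P_r(D)`. -/
def pathComparison (n : ℕ) (hn : 2 ≤ n) (r : ℕ) : path.{u, v} n hn r ⋙ incl n ⟶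
    inclTop n ⋙ pathTop r ⋙ incl (R := R) ⊤ where
  app D := (FreeMulticomplex.staircaseHom n r).tensor D.toMulticomplex
  naturality _ _ f := staircaseHom_tensor_naturality n r f

end NMulticomplex

/-! ### Morphisms into the path of a spectral sequence, from their middle components. -/

namespace SpSe

open FilteredComplex (rel_up' rel_up'')

variable {R : Type u} [CommRing R]

lemma hom_d {κ : Type*} {c : ComplexShape κ} {K L : HomologicalComplex (ModuleCat.{v} R) c}
    (f : K ⟶ L) (i j : κ) (x : K.X i) :
    (f.f j).hom ((K.d i j).hom x) = (L.d i j).hom ((f.f i).hom x) :=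
  (congrArg (fun φ => φ.hom x) (f.comm i j)).symm

/-- This is the compatibility of a morphism with the characteristic maps, read on cycles instead of
homology classes. -/
lemma charMap_comm {A B : SpSe.{u, v} R} (f : A ⟶ B) (m m' : ℤ) (h : m + 1 = m') (hm : 0 ≤ m)
    (i j : ℤ × ℤ) (hij : (ComplexShape.up' ((-m, 1 - m) : ℤ × ℤ)).Rel i j)
    (x : LinearMap.ker ((A.page m).d i j).hom)
    (hx : ((f.hom m hm).f i).hom x.1 ∈ LinearMap.ker ((B.page m hm).d i j).hom) :
    B.charMap m m' h hm i j hij ⟨((f.hom m hm).f i).hom x.1, hx⟩ =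
      ((f.hom m' (by lia)).f i).hom (A.charMap m m' h hm i j hij x) := by
  have h4 := homologyMap_homologyClass (f.hom m hm) i j hij x hx
  have h5 := congrArg (fun φ => φ.hom (homologyClass (A.page m hm) i j hij x)) (f.comm m m' i h hm)
  exact (congrArg (B.iso m m' i h hm).hom.hom h4).symm.trans h5

lemma pathIsoLT_class (r : ℕ) (A : SpSe.{u, v} R) (m m' : ℤ) (h : m + 1 = m') (hm : 0 ≤ m)
    (s s' : ℤˣ) (hs : m = r → s = -1) (hs' : m' = r → s' = -1) (hr : m ≠ r) (i : ℤ × ℤ)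
    (x : LinearMap.ker ((A.page m hm).d i (i.1 - m, i.2 + 1 - m)).hom)
    (y : LinearMap.ker
      ((A.page m hm).d (shiftIdx r i) (shiftIdx r (i.1 - m, i.2 + 1 - m))).hom)
    (z : LinearMap.ker ((A.page m hm).d i (i.1 - m, i.2 + 1 - m)).hom) :
    (A.pathIsoLT r m m' h hm s s' hs hs' hr i).hom.hom
      (homologyClass (pathComplex r s (A.page m) hs) i
      (i.1 - m, i.2 + 1 - m) (rel_up' m i.1 i.2)
      (pathCycles r s (A.page m) hs hr i (i.1 - m, i.2 + 1 - m) (x, y, z))) =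
      (A.charMap m m' h hm i (i.1 - m, i.2 + 1 - m) (rel_up' m i.1 i.2) x,
       A.charMap m m' h hm (shiftIdx r i) (shiftIdx r (i.1 - m, i.2 + 1 - m))
        (rel_shift r (rel_up' m i.1 i.2)) y,
       A.charMap m m' h hm i (i.1 - m, i.2 + 1 - m) (rel_up' m i.1 i.2) z) :=
  isoOfSurjective_hom_apply _ _ _ _ _ (x, y, z)

/-- The middle components of a morphism `A → P(r; B)` from `f` to `g`. -/
structure HomotopyData (r : ℕ) (s : ℤ → ℤˣ) {A B : SpSe.{u, v} R} (f g : A ⟶ B) where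
  y (m : ℤ) (hm : 0 ≤ m) (hr : m ≤ r) (i : ℤ × ℤ) :
    (A.page m hm).X i →ₗ[R] (B.page m hm).X (shiftIdx r i)
  y_d (m : ℤ) (hm : 0 ≤ m) (hr : m ≤ r) (i j : ℤ × ℤ)
    (hij : (ComplexShape.up' ((-m, 1 - m) : ℤ × ℤ)).Rel i j) (x : (A.page m hm).X i) :
    y m hm hr j (((A.page m hm).d i j).hom x) =
      (s m : ℤ) • ((B.page m hm).d (shiftIdx r i) (shiftIdx r j)).hom (y m hm hr i x) +
        if m = r then transport (B.page m hm) i (shiftIdx r j)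
          (((g.hom m hm).f i).hom x - ((f.hom m hm).f i).hom x) else 0
  y_char (m m' : ℤ) (h : m + 1 = m') (hm : 0 ≤ m) (hr : m' ≤ r) (i j : ℤ × ℤ)
    (hij : (ComplexShape.up' ((-m, 1 - m) : ℤ × ℤ)).Rel i j)
    (x : LinearMap.ker ((A.page m hm).d i j).hom)
    (hx : y m hm (by lia) i x.1 ∈
      LinearMap.ker ((B.page m hm).d (shiftIdx r i) (shiftIdx r j)).hom) :
    B.charMap m m' h hm (shiftIdx r i) (shiftIdx r j) (rel_shift r hij) ⟨_, hx⟩ =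
      y m' (by lia) hr i (A.charMap m m' h hm i j hij x)
  eq_of_lt (m : ℤ) (hm : 0 ≤ m) (hr : r < m) : f.hom m hm = g.hom m hm

namespace HomotopyData

variable {r : ℕ} {s : ℤ → ℤˣ} (hs : s r = -1) {A B : SpSe.{u, v} R} {f g : A ⟶ B}
  (H : HomotopyData r s f g)

/-- The map `x ↦ (f x, y x, g x)` on the pages `m ≤ r`. -/
def toPathComplex (m : ℤ) (hm : 0 ≤ m) (hr : m ≤ r) :
    A.page m hm ⟶ pathComplex r (s m) (B.page m hm) (sign_eq hs) where
  f i := ModuleCat.ofHom (LinearMap.prod ((f.hom m hm).f i).hom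
    (LinearMap.prod (H.y m hm hr i) ((g.hom m hm).f i).hom))
  comm' i j hij := by
    refine ModuleCat.hom_ext (LinearMap.ext fun x => ?_)
    refine (pathD_apply r (s m) (B.page m hm) i j _).trans ?_
    exact Prod.ext (hom_d _ _ _ _).symm (Prod.ext (H.y_d m hm hr i j hij x).symm
      (hom_d _ _ _ _).symm)

/-- Below page r the correction g - f is absent, and the remaining sign is invertible. -/
lemma y_mem_ker (m : ℤ) (hm : 0 ≤ m) (hr : m < r) (i j : ℤ × ℤ)
    (hij : (ComplexShape.up' ((-m, 1 - m) : ℤ × ℤ)).Rel i j)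
    (x : LinearMap.ker ((A.page m hm).d i j).hom) :
    H.y m hm hr.le i x.1 ∈
      LinearMap.ker ((B.page m hm).d (shiftIdx r i) (shiftIdx r j)).hom := by
  have h := H.y_d m hm hr.le i j hij x.1
  rw [LinearMap.mem_ker.1 x.2, map_zero, if_neg hr.ne, add_zero] at h
  exact LinearMap.mem_ker.2 ((smul_eq_zero_iff_eq (s m)).1 h.symm)

lemma hom_mem_ker (f : A ⟶ B) (m : ℤ) (hm : 0 ≤ m) (i j : ℤ × ℤ)
    (x : LinearMap.ker ((A.page m hm).d i j).hom) :
    ((f.hom m hm).f i).hom x.1 ∈ LinearMap.ker ((B.page m hm).d i j).hom := by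
  rw [LinearMap.mem_ker, ← hom_d, LinearMap.mem_ker.1 x.2, map_zero]

/-- Up to page r the characteristic map of the path is that of B on each of the three summands. The
outer components are handled by f and g being morphisms, the middle one by `y_char`. -/
lemma toPathComplex_comm_lt (m m' : ℤ) (h : m + 1 = m') (hm : 0 ≤ m) (hr : m' ≤ r) (i : ℤ × ℤ) :
    HomologicalComplex.homologyMap (H.toPathComplex hs m hm (by lia)) i ≫
        (B.pathIsoLT r m m' h hm (s m) (s m') (sign_eq hs) (sign_eq hs) (by lia) i).hom =
      (A.iso m m' i h hm).hom ≫ (H.toPathComplex hs m' (by lia) hr).f i := by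
  refine ModuleCat.hom_ext (LinearMap.ext fun w => ?_)
  obtain ⟨x, rfl⟩ := homologyClass_surjective (A.page m) i (i.1 - m, i.2 + 1 - m)
    (rel_up' m i.1 i.2) w
  have hfx := hom_mem_ker f m hm i (i.1 - m, i.2 + 1 - m) x
  have hgx := hom_mem_ker g m hm i (i.1 - m, i.2 + 1 - m) x
  have hyx := H.y_mem_ker m hm (by lia) i (i.1 - m, i.2 + 1 - m) (rel_up' m i.1 i.2) x
  have h1 : (HomologicalComplex.homologyMap (H.toPathComplex hs m hm (by lia)) i).hom
      (homologyClass (A.page m hm) i (i.1 - m, i.2 + 1 - m) (rel_up' m i.1 i.2) x) =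
      homologyClass (pathComplex r (s m) (B.page m hm) (sign_eq hs)) i (i.1 - m, i.2 + 1 - m)
        (rel_up' m i.1 i.2) (pathCycles r (s m) (B.page m hm) (sign_eq hs) (by lia) i
          (i.1 - m, i.2 + 1 - m) (⟨_, hfx⟩, ⟨_, hyx⟩, ⟨_, hgx⟩)) :=
    homologyMap_homologyClass (H.toPathComplex hs m hm (by lia)) i
      (i.1 - m, i.2 + 1 - m) (rel_up' m i.1 i.2) x _
  have h2 := B.pathIsoLT_class r m m' h hm (s m) (s m') (sign_eq hs) (sign_eq hs) (by lia) i
    ⟨_, hfx⟩ ⟨_, hyx⟩ ⟨_, hgx⟩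
  refine (congrArg (B.pathIsoLT r m m' h hm (s m) (s m') (sign_eq hs) (sign_eq hs)
    (by lia) i).hom.hom h1).trans (h2.trans ?_)
  rw [charMap_comm f m m' h hm i _ (rel_up' m i.1 i.2) x hfx,
    charMap_comm g m m' h hm i _ (rel_up' m i.1 i.2) x hgx,
    H.y_char m m' h hm hr i _ (rel_up' m i.1 i.2) x hyx]
  rfl

/-- From page r to page r + 1 the characteristic map of the path factors through ∂^-. Only f is
involved, and the middle component needs no condition here. -/
lemma toPathComplex_comm_eq (m m' : ℤ) (h : m + 1 = m') (hm : 0 ≤ m) (hr : m = r) (i : ℤ × ℤ) :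
    HomologicalComplex.homologyMap (H.toPathComplex hs m hm hr.le) i ≫
        (B.pathIsoEQ r m m' h hm (s m) (sign_eq hs) hr i).hom =
      (A.iso m m' i h hm).hom ≫ (f.hom m' (by lia)).f i := by
  rw [← B.pathIsoEQ_comm r m m' h hm (s m) (sign_eq hs) false hr i, ← Category.assoc,
    ← HomologicalComplex.homologyMap_comp]
  exact f.comm m m' i h hm

/-- The components of the morphism `A → P(r; B)`. -/
def toPathPage (m : ℤ) (hm : 0 ≤ m) :
    (δ : Decidable (m ≤ r)) → (A.page m hm ⟶ pathPage r s hs B m hm δ)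
  | .isTrue h => H.toPathComplex hs m hm h
  | .isFalse _ => f.hom m hm

/-- The morphism `A → P(r; B)`. -/
def toPath : A ⟶ path r s hs B where
  hom m hm := H.toPathPage hs m hm inferInstance
  comm m m' i h hm := by
    have key : ∀ (δ : Decidable (m ≤ r)) (δ' : Decidable (m' ≤ r)),
        HomologicalComplex.homologyMap (H.toPathPage hs m hm δ) i ≫
            (pathIso r s hs B m m' h hm i δ δ').hom =
          (A.iso m m' i h hm).hom ≫ (H.toPathPage hs m' (by lia) δ').f i := by
      rintro (h₁ | h₁) (h₂ | h₂)
      · exact f.comm m m' i h hm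
      · omega
      · exact H.toPathComplex_comm_eq hs m m' h hm (by omega) i
      · exact H.toPathComplex_comm_lt hs m m' h hm h₂ i
    exact key _ _

/-- On pages m ≤ r the two ends are the outer components by construction; only the pages beyond r
need an argument. -/
lemma toPathPage_end (ε : Bool) (m : ℤ) (hm : 0 ≤ m) (δ : Decidable (m ≤ r)) :
    H.toPathPage hs m hm δ ≫ pathPageEnd r s hs B ε m hm δ =
      (if ε then g else f).hom m hm := by
  rcases δ with h | h
  · refine (Category.comp_id (f.hom m hm)).trans ?_
    cases ε
    · rfl
    -- Past page r the morphism was chosen to be f, so for the end ∂^+ the equality of f and g on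
    -- these pages is needed.
    · exact H.eq_of_lt m hm (by omega)
  · cases ε <;> rfl

lemma rHomotopicWith (H : HomotopyData r s f g) : RHomotopicWith r s hs f g :=
  ⟨H.toPath hs, SpectralSequence.hom_ext fun m hm => H.toPathPage_end hs false m hm _,
    SpectralSequence.hom_ext fun m hm => H.toPathPage_end hs true m hm _⟩

end HomotopyData

end SpSe

/-! ### The sign twist T: from total to bigraded homotopies. -/

namespace SpSe

open FilteredComplex (rel_up' rel_up'')

variable {R : Type u} [CommRing R]

lemma transport_twist {m : ℤ}
    (K : HomologicalComplex (ModuleCat.{v} R) (ComplexShape.up' ((-m, 1 - m) : ℤ × ℤ)))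
    (i j : ℤ × ℤ) (x : K.X i) : transport (twistComplex K) i j x = transport K i j x := by
  by_cases h : i = j
  · subst h
    rw [transport_self, transport_self]
    rfl
  · rw [transport_ne _ h, transport_ne _ h]
    rfl

lemma charMap_twist (A : SpSe.{u, v} R) (m m' : ℤ) (h : m + 1 = m') (hm : 0 ≤ m)
    (i j : ℤ × ℤ) (hij : (ComplexShape.up' ((-m, 1 - m) : ℤ × ℤ)).Rel i j)
    (x : LinearMap.ker ((twistComplex (A.page m hm)).d i j).hom) :
    (twist.obj A).charMap m m' h hm i j hij x =
      A.charMap m m' h hm i j hij (untwistCycles (A.page m hm) i j x) := by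
  -- The isomorphism of the twisted sequence was built with this particular expression for the
  -- target bidegree.
  obtain rfl : j = (i.1 - m, i.2 + 1 - m) := Prod.ext ((rel_iff i j).1 hij).1 ((rel_iff i j).1 hij).2
  exact isoOfSurjective_hom_apply _ _ (homologyClass_surjective _ _ _ _)
    (A.twistCharMap_surjective m m' h hm i (i.1 - m, i.2 + 1 - m) (rel_up' m i.1 i.2)) (A.twistCharMap_iff m m' h hm (i.1 + m, i.2 + m - 1) i
    (i.1 - m, i.2 + 1 - m) (rel_up'' m i.1 i.2) (rel_up' m i.1 i.2)) x

namespace HomotopyData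

variable {r : ℕ} {A B : SpSe.{u, v} R} {f g : A ⟶ B}

/-- The sign by which the middle component of a homotopy is twisted in total degree
`n = q - p`. -/
def twistSign (r : ℕ) (i : ℤ × ℤ) : ℤˣ := Int.negOnePow (r * (i.2 - i.1 - 1))

/-- A differential raises the total degree by one, so the shift by -1 in the exponent disappears at
its target. -/
lemma twistSign_rel {m : ℤ} {i j : ℤ × ℤ}
    (hij : (ComplexShape.up' ((-m, 1 - m) : ℤ × ℤ)).Rel i j) :
    twistSign r j = Int.negOnePow (r * (i.2 - i.1)) := by
  rw [rel_iff] at hij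
  rw [twistSign, show j.2 - j.1 - 1 = i.2 - i.1 by omega]

/-- Here n is the total degree of x. The left side collects the total sign -1, the twist of d_m at x
and that of the homotopy at d x; the right side collects the bigraded sign, the twist of d_m in
degree n - 1, and that of the homotopy at x. Both exponents equal rn + mn + 1. -/
lemma twistSign_mul (m n : ℤ) : -(Int.negOnePow (r * n) * Int.negOnePow (m * n)) =
    Int.negOnePow (m + r + 1) * (Int.negOnePow (m * (n - 1)) * Int.negOnePow (r * (n - 1))) := by
  rw [← Int.negOnePow_add, ← Int.negOnePow_add, ← Int.negOnePow_add, ← Int.negOnePow_succ,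
    Int.negOnePow_eq_iff]
  exact ⟨0, by ring⟩

/-- A total homotopy, twisted by the signs `(-1)^{r (n - 1)}` in total degree `n`, is a bigraded
homotopy of the twisted morphisms. -/
def twist (H : HomotopyData r (fun _ => -1) f g) :
    HomotopyData r (fun m => Int.negOnePow (m + r + 1)) (SpSe.twist.map f) (SpSe.twist.map g) where
  y m hm hr i := (twistSign r i : ℤ) • H.y m hm hr i
  y_d m hm hr i j hij x := by
    have hx := H.y_d m hm hr i j hij x
    -- The modules of the twisted complex are those of B only by unfolding, so the type of the
    -- equation is fixed explicitly.
    have hT : @Eq ((B.page m hm).X (shiftIdx r j))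
        (if m = r then transport (twistComplex (B.page m hm)) i (shiftIdx r j)
          (((g.hom m hm).f i).hom x - ((f.hom m hm).f i).hom x) else 0)
        (if m = r then transport (B.page m hm) i (shiftIdx r j)
          (((g.hom m hm).f i).hom x - ((f.hom m hm).f i).hom x) else 0) := by
      by_cases hmr : m = r
      · rw [if_pos hmr]
        exact (if_pos hmr).trans (transport_twist (B.page m hm) _ _ _)
      · rw [if_neg hmr]
        exact if_neg hmr
    refine Eq.trans ?_ (congrArg (fun w : (B.page m hm).X (shiftIdx r j) =>
      (((m + r + 1).negOnePow : ℤˣ) : ℤ) •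
        ((Int.negOnePow (m * ((i.2 + r - 1) - (i.1 + r))) : ℤˣ) : ℤ) •
        ((B.page m hm).d (shiftIdx r i) (shiftIdx r j)).hom ((twistSign r i : ℤ) • H.y m hm hr i x)
          + w) hT).symm
    change (twistSign r j : ℤ) • H.y m hm hr j
        (((Int.negOnePow (m * (i.2 - i.1)) : ℤˣ) : ℤ) • ((A.page m hm).d i j).hom x) = _
    rw [map_zsmul, map_zsmul, hx, smul_add, smul_add]
    congr 1
    · rw [smul_smul, smul_smul, smul_smul, smul_smul, twistSign_rel hij, twistSign]
      congr 1
      simp only [← Units.val_mul]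
      rw [show i.2 + r - 1 - (i.1 + r) = i.2 - i.1 - 1 by ring, mul_assoc, mul_assoc,
        ← twistSign_mul]
      simp
    · split_ifs with hmr
      -- On page r the twist of d_r and that of the homotopy at the target are both (-1)^{rn}, so g
      -- - f keeps its coefficient 1. This dictates the choice of `twistSign`.
      · rw [smul_smul, twistSign_rel hij, ← Units.val_mul,
          show Int.negOnePow (m * (i.2 - i.1)) = Int.negOnePow (r * (i.2 - i.1)) by rw [hmr],
          Int.units_mul_self, Units.val_one, one_smul]
      · simp
  y_char m m' h hm hr i j hij x hx := by
    have hy := H.y_mem_ker m hm (by lia) i j hij (untwistCycles (A.page m hm) i j x)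
    have h1 := H.y_char m m' h hm hr i j hij (untwistCycles (A.page m hm) i j x) hy
    refine (charMap_twist B m m' h hm (shiftIdx r i) (shiftIdx r j) (rel_shift r hij) _).trans ?_
    refine Eq.trans ?_ (congrArg (fun w => (twistSign r i : ℤ) • H.y m' (by lia) hr i w)
      (charMap_twist A m m' h hm i j hij x)).symm
    refine Eq.trans ?_ (congrArg (fun w => (twistSign r i : ℤ) • w) h1)
    -- The sign depends on the total degree but not on the page, so it passes through the linear
    -- characteristic map.
    refine Eq.trans ?_ (map_zsmul (B.charMap m m' h hm (shiftIdx r i) (shiftIdx r j)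
      (rel_shift r hij)) (twistSign r i : ℤ) ⟨_, hy⟩)
    rfl
  eq_of_lt m hm hr := by
    change twistComplexMap (f.hom m hm) = twistComplexMap (g.hom m hm)
    rw [H.eq_of_lt m hm hr]

end HomotopyData

end SpSe

/-! ### The action of a filtered homotopy on cycles, boundaries and pages. -/

namespace FilteredComplex

variable {R : Type u} [CommRing R]

/-- A homotopy of morphisms of filtered complexes which raises the filtration by at most `r`. -/
structure Homotopy (r : ℕ) {A B : FilteredComplex.{u, v} R} (f g : A ⟶ B) where
  s (n n' : ℤ) (h : n' + 1 = n) : A.K.X n →ₗ[R] B.K.X n'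
  map_mem (p n n' : ℤ) (h : n' + 1 = n) (x : A.K.X n) (hx : x ∈ A.F p n) :
    s n n' h x ∈ B.F (p + r) n'
  comm (n n' n'' : ℤ) (h : n' + 1 = n) (h' : n + 1 = n'') (x : A.K.X n) :
    (B.K.d n' n).hom (s n n' h x) + s n'' n h' ((A.K.d n n'').hom x) =
      (Hom.f g).f n x - (Hom.f f).f n x

namespace Homotopy

variable {r : ℕ} {A B : FilteredComplex.{u, v} R} {f g : A ⟶ B} (H : Homotopy r f g)

lemma d_s (n n' n'' : ℤ) (h : n' + 1 = n) (h' : n + 1 = n'') (x : A.K.X n) :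
    (B.K.d n' n).hom (H.s n n' h x) =
      ((Hom.f g).f n x - (Hom.f f).f n x) - H.s n'' n h' ((A.K.d n n'').hom x) :=
  eq_sub_of_add_eq (H.comm n n' n'' h h' x)

lemma s_d (n n' n'' : ℤ) (h : n' + 1 = n) (h' : n + 1 = n'') (x : A.K.X n) :
    H.s n'' n h' ((A.K.d n n'').hom x) =
      ((Hom.f g).f n x - (Hom.f f).f n x) - (B.K.d n' n).hom (H.s n n' h x) :=
  eq_sub_of_add_eq' (H.comm n n' n'' h h' x)

lemma map_mem' {p p' n n' : ℤ} (h : n' + 1 = n) (hp : p + r ≤ p') {x : A.K.X n}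
    (hx : x ∈ A.F p n) : H.s n n' h x ∈ B.F p' n' :=
  B.mono_of_le hp _ (H.map_mem p n n' h x hx)

lemma sub_mem {p p' n : ℤ} (hp : p ≤ p') {x : A.K.X n} (hx : x ∈ A.F p n) (f g : A ⟶ B) :
    (Hom.f g).f n x - (Hom.f f).f n x ∈ B.F p' n :=
  B.mono_of_le hp _ (Submodule.sub_mem _ (Hom.map_mem g p n x hx) (Hom.map_mem f p n x hx))

/-- In d s x = (g - f)x - s d x the first term lies in F_p and the second in F_{p-m+r}. Both are
contained in F_{p+r-m} precisely because m ≤ r. -/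
lemma map_Z {m p n n' : ℤ} (hm : m ≤ r) (h : n' + 1 = n) {x : A.K.X n} (hx : x ∈ A.Z m p n) :
    H.s n n' h x ∈ B.Z m (p + r) n' := by
  refine (B.mem_Z' h).2 ⟨H.map_mem _ _ _ _ _ hx.1, ?_⟩
  rw [H.d_s n n' (n + 1) h rfl]
  exact Submodule.sub_mem _ (sub_mem (by omega) hx.1 f g) (H.map_mem' _ (by omega) hx.2)

/-- The map induced by a homotopy on `m`-cycles, `m ≤ r`. -/
def mapZ (m p n p' n' : ℤ) (hm : m ≤ r) (h : n' + 1 = n) (hp : p' = p + r) :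
    A.Z m p n →ₗ[R] B.Z m p' n' :=
  (H.s n n' h).restrict fun _ hx => by
    subst hp
    exact H.map_Z hm h hx

/-- The map `[a] ↦ [s a]` induced by a homotopy on `E_m`, `m ≤ r`. -/
def mapE (m p n p' n' : ℤ) (hm : m ≤ r) (h : n' + 1 = n) (hp : p' = p + r) :
    A.E m p n →ₗ[R] B.E m p' n' :=
  Submodule.mapQ _ _ (H.mapZ m p n p' n' hm h hp) (by
    subst hp
    rintro ⟨x, hx⟩ hxB
    obtain ⟨w, hw, v, hv, rfl⟩ := (A.mem_B' h).1 hxB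
    have hv2 := ((A.mem_Z' h).1 hv).2
    -- For a boundary w + dv one has s(w + dv) = (s w + (g - f)v) - d s v. The bracket lies in
    -- Z_{m-1} of filtration p + r - 1, where (g - f)v needs m ≤ r.
    refine (B.mem_B' (n' := n' - 1) (by omega)).2
      ⟨H.s n n' h w + ((Hom.f g).f n' v - (Hom.f f).f n' v), ?_, -H.s n' (n' - 1) (by omega) v,
        ?_, ?_⟩
    · refine Submodule.add_mem _ ?_ ?_
      · have := H.map_Z (by omega) h hw
        rwa [show p - 1 + r = p + r - 1 by ring] at this
      · refine (B.mem_Z' h).2 ⟨sub_mem (by omega) hv.1 f g, ?_⟩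
        rw [map_sub, ← Hom.map_d, ← Hom.map_d]
        exact sub_mem (by omega) hv2 f g
    · refine Submodule.neg_mem _ ?_
      have := H.map_Z (by omega) (show n' - 1 + 1 = n' by omega) hv
      rwa [show p + m - 1 + r = p + r + m - 1 by ring] at this
    · change _ = H.s n n' h (w + (A.K.d n' n).hom v)
      rw [map_add, H.s_d n' (n' - 1) n (by omega) h, map_neg]
      abel)

/-- In (g - f)x = s d x + d s x with m > r, s d x lies in F_{p-m+r}, hence in F_{p-1}, and s x lies
in F_{p+r}, hence in F_{p+m-1}. These are the two summands of an m-boundary. -/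
lemma mapE_eq (H : Homotopy r f g) (m p n : ℤ) (hm : r < m) : Hom.mapE f m p n = Hom.mapE g m p n := by
  refine LinearMap.ext fun x => ?_
  obtain ⟨⟨x, hx⟩, rfl⟩ := Submodule.Quotient.mk_surjective _ x
  refine ((Submodule.Quotient.eq _).2 ?_).symm
  have h1 : H.s (n + 1) n rfl ((A.K.d n (n + 1)).hom x) ∈ B.F (p - 1) n :=
    H.map_mem' _ (by omega) hx.2
  refine (B.mem_B' (n' := n - 1) (by omega)).2
    ⟨H.s (n + 1) n rfl ((A.K.d n (n + 1)).hom x), ⟨h1, ?_⟩, H.s n (n - 1) (by omega) x, ?_, ?_⟩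
  -- Since d d x = 0, the differential of s d x is (g - f) d x, which lies in F_{p-m}.
  · rw [SetLike.mem_coe, Submodule.mem_comap, H.d_s (n + 1) n (n + 2) rfl (by omega), A.d_d,
      map_zero, sub_zero]
    exact sub_mem (by omega) hx.2 f g
  · refine (B.mem_Z' (n' := n) (by omega)).2 ⟨H.map_mem' _ (by omega) hx.1, ?_⟩
    rw [H.d_s n (n - 1) (n + 1) (by omega) rfl]
    exact Submodule.sub_mem _ (sub_mem (by omega) hx.1 f g) (B.mono_of_le (by omega) _ h1)
  · rw [add_comm]
    exact H.comm n (n - 1) (n + 1) (by omega) rfl x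

end Homotopy

end FilteredComplex

/-! ### Characteristic maps on representatives, and the induced total homotopy. -/

namespace FilteredComplex

variable {R : Type u} [CommRing R]

lemma Z_mono (A : FilteredComplex.{u, v} R) {m m' : ℤ} (h : m ≤ m') (p n : ℤ) :
    A.Z m' p n ≤ A.Z m p n :=
  fun _ hx => ⟨hx.1, A.mono_of_le (by omega) _ hx.2⟩

/-- If [x] is a cycle of E_m then d x = w + d v is a boundary. The element x - v is an (m + 1)-cycle
of the same class, because v lies in Z_{m-1} of filtration p - 1, hence in B_m. -/
lemma toKer_surjective (A : FilteredComplex.{u, v} R) (m m' p q : ℤ) (h : m + 1 = m') :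
    Function.Surjective (A.toKer m m' p q h) := by
  rintro ⟨y, hy⟩
  have hy' := LinearMap.mem_ker.1 hy
  rw [A.page_d m p q _ _ rfl (by omega)] at hy'
  obtain ⟨⟨x, hx⟩, rfl⟩ := Submodule.Quotient.mk_surjective _ y
  have hB := (Submodule.Quotient.mk_eq_zero _).1 hy'
  obtain ⟨w, hw, v, hv, hwv⟩ := (A.mem_B' (n' := q - p) (by omega)).1 hB
  change w + _ = (A.K.d (q - p) (q + 1 - m - (p - m))).hom x at hwv
  have hv1 : v ∈ A.F (p - 1) (q - p) := A.mono_of_le (by omega) _ hv.1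
  have hv2 : (A.K.d (q - p) (q - p + 1)).hom v ∈ A.F (p - 1 - (m - 1)) (q - p + 1) :=
    A.mono_of_le (by omega) _ hv.2
  have hxv : x - v ∈ A.Z m' p (q - p) := by
    refine (A.mem_Z' (show q - p + 1 = q + 1 - m - (p - m) by omega)).2 ⟨?_, ?_⟩
    · exact Submodule.sub_mem _ hx.1 (A.mono_of_le (by omega) _ hv1)
    · rw [map_sub, ← hwv, add_sub_cancel_right]
      exact A.mono_of_le (by omega) _ hw.1
  refine ⟨⟨x - v, hxv⟩, Subtype.ext ((Submodule.Quotient.eq _).2 ?_)⟩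
  refine (A.mem_B' (n' := q - p - 1) (by omega)).2
    ⟨-v, Submodule.neg_mem _ ⟨hv1, hv2⟩, 0, Submodule.zero_mem _, ?_⟩
  change -v + _ = x - v - x
  simp

/-- With this the characteristic map is computed on representatives: it changes only the page in
which the class is taken. -/
lemma charMap_mk (A : FilteredComplex.{u, v} R) (m m' p q : ℤ) (h : m + 1 = m') (hm : 0 ≤ m)
    (j : ℤ × ℤ) (hij : (ComplexShape.up' ((-m, 1 - m) : ℤ × ℤ)).Rel (p, q) j)
    (x : A.Z m' p (q - p)) (z : LinearMap.ker ((A.page m).d (p, q) j).hom)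
    (hz : z.1 = Submodule.Quotient.mk ⟨x.1, A.Z_mono (by omega) _ _ x.2⟩) :
    SpSe.charMap A.spectralSequence m m' h hm (p, q) j hij z =
      (Submodule.Quotient.mk x : A.E m' p (q - p)) := by
  obtain rfl : j = (p - m, q + 1 - m) :=
    Prod.ext ((SpSe.rel_iff (p, q) j).1 hij).1 ((SpSe.rel_iff (p, q) j).1 hij).2
  obtain rfl : z = A.toKer m m' p q h x := Subtype.ext hz
  exact isoOfSurjective_hom_apply _ _ (A.toHomology_surjective m m' p q h)
    (Submodule.mkQ_surjective _) (A.toHomology_eq_zero_iff m m' p q h) x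

namespace Homotopy

variable {r : ℕ} {A B : FilteredComplex.{u, v} R} {f g : A ⟶ B} (H : Homotopy r f g)

/-- The sum of the two terms is represented by (g - f)x, which lies in F_p. The classes are taken in
filtration p + r - m > p, where such an element is an m-boundary. -/
lemma mapE_dE_lt (m p n p₁ n₁ p₂ n₂ p₀ n₀ : ℤ) (hm : m < r) (hp₁ : p₁ = p - m) (hn₁ : n + 1 = n₁)
    (hp₂ : p₂ = p₁ + r) (hn₂ : n₂ + 1 = n₁) (hp₀ : p₀ = p + r) (hn₀ : n₀ + 1 = n)
    (hp : p₂ = p₀ - m) (hn : n₀ + 1 = n₂) (x : A.E m p n) :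
    H.mapE m p₁ n₁ p₂ n₂ hm.le hn₂ hp₂ (A.dE m p n p₁ n₁ hp₁ hn₁ x) =
      -B.dE m p₀ n₀ p₂ n₂ hp hn (H.mapE m p n p₀ n₀ hm.le hn₀ hp₀ x) := by
  obtain rfl : n = n₂ := by omega
  obtain ⟨⟨x, hx⟩, rfl⟩ := Submodule.Quotient.mk_surjective _ x
  rw [eq_neg_iff_add_eq_zero]
  refine (Submodule.Quotient.mk_eq_zero _).2 ?_
  refine (B.mem_B' hn₀).2 ⟨(Hom.f g).f n x - (Hom.f f).f n x, ?_, 0, Submodule.zero_mem _, ?_⟩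
  -- The strict inequality m < r is what gives p ≤ p₂ - 1.
  · refine (B.mem_Z' hn₁).2 ⟨sub_mem (by omega) hx.1 f g, ?_⟩
    rw [map_sub, ← Hom.map_d, ← Hom.map_d]
    exact sub_mem (by omega) ((A.mem_Z' hn₁).1 hx).2 f g
  · rw [map_zero, add_zero, ← H.comm n n₀ n₁ hn₀ hn₁ x, add_comm]
    rfl

/-- For m = r the shifts by -m and +r cancel, so (g - f)x is seen in its own filtration p and the
identity already holds for representatives. -/
lemma mapE_dE_eq (m p n p₁ n₁ p₀ n₀ : ℤ) (hm : m = r) (hp₁ : p₁ = p - m) (hn₁ : n + 1 = n₁)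
    (hp₂ : p = p₁ + r) (hp₀ : p₀ = p + r) (hn₀ : n₀ + 1 = n)
    (hp : p = p₀ - m) (x : A.E m p n) :
    H.mapE m p₁ n₁ p n hm.le hn₁ hp₂ (A.dE m p n p₁ n₁ hp₁ hn₁ x) =
      -B.dE m p₀ n₀ p n hp hn₀ (H.mapE m p n p₀ n₀ hm.le hn₀ hp₀ x) +
        (Hom.mapE g m p n x - Hom.mapE f m p n x) := by
  obtain ⟨⟨x, hx⟩, rfl⟩ := Submodule.Quotient.mk_surjective _ x
  rw [neg_add_eq_sub]
  exact congrArg Submodule.Quotient.mk (Subtype.ext (H.s_d n n₀ n₁ hn₀ hn₁ x))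

/-- A homotopy of morphisms of filtered complexes induces a total homotopy of morphisms of
spectral sequences. -/
def homotopyData : SpSe.HomotopyData r (fun _ => -1) (toSpSe.map f) (toSpSe.map g) where
  y m _ hr i := H.mapE m i.1 (i.2 - i.1) (i.1 + r) (i.2 + r - 1 - (i.1 + r)) hr (by omega) rfl
  y_d m hm hr i j hij x := by
    -- The target bidegree is made a variable k, so that for m = r it can be replaced by i, turning
    -- the transport into the identity.
    have key : ∀ (k : ℤ × ℤ) (hk : k = SpSe.shiftIdx r j) (h1 : k.2 - k.1 + 1 = j.2 - j.1)
        (h2 : k.1 = j.1 + r), H.mapE m j.1 (j.2 - j.1) k.1 (k.2 - k.1) hr h1 h2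
          (((A.page m).d i j).hom x) =
        ((-1 : ℤˣ) : ℤ) • ((B.page m).d (SpSe.shiftIdx r i) k).hom (H.mapE m i.1 (i.2 - i.1)
          (i.1 + r) (i.2 + r - 1 - (i.1 + r)) hr (by omega) rfl x) +
        if m = r then SpSe.transport (B.page m) i k
          (Hom.mapE g m i.1 (i.2 - i.1) x - Hom.mapE f m i.1 (i.2 - i.1) x) else 0 := by
      intro k hk h1 h2
      have hj := (SpSe.rel_iff i j).1 hij
      rw [A.page_d m i.1 i.2 j.1 j.2 hj.1 (by omega),
        B.page_d m (i.1 + r) (i.2 + r - 1) k.1 k.2 (by omega) (by omega), Units.val_neg,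
        Units.val_one, neg_smul, one_smul]
      by_cases hmr : m = r
      · obtain rfl : i = k := (SpSe.shiftIdx_eq r hij hmr).trans hk.symm
        rw [if_pos hmr, SpSe.transport_self]
        exact H.mapE_dE_eq m i.1 (i.2 - i.1) j.1 (j.2 - j.1) (i.1 + r) (i.2 + r - 1 - (i.1 + r))
          hmr hj.1 (by omega) h2 rfl (by omega) (by omega) x
      · rw [if_neg hmr, add_zero]
        exact H.mapE_dE_lt m i.1 (i.2 - i.1) j.1 (j.2 - j.1) k.1 (k.2 - k.1) (i.1 + r)
          (i.2 + r - 1 - (i.1 + r)) (by omega) hj.1 (by omega) h2 h1 rfl (by omega) (by omega)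
          (by omega) x
    exact key (SpSe.shiftIdx r j) rfl (by simp only; omega) rfl
  y_char m m' h hm hr i j hij x hx := by
    obtain ⟨p, q⟩ := i
    obtain rfl : j = (p - m, q + 1 - m) :=
      Prod.ext ((SpSe.rel_iff (p, q) j).1 hij).1 ((SpSe.rel_iff (p, q) j).1 hij).2
    -- Once the cycle is represented by an (m + 1)-cycle, both sides are the class of s x on the
    -- next page.
    obtain ⟨x, rfl⟩ := A.toKer_surjective m m' p q h x
    refine (B.charMap_mk m m' (p + r) (q + r - 1) h hm _ _
      (H.mapZ m' p (q - p) (p + r) (q + r - 1 - (p + r)) hr (by omega) rfl x) ⟨_, hx⟩ rfl).trans ?_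
    exact (congrArg (H.mapE m' p (q - p) (p + r) (q + r - 1 - (p + r)) hr (by omega) rfl)
      (A.charMap_mk m m' p q h hm _ hij x (A.toKer m m' p q h x) rfl)).symm
  eq_of_lt m hm hr := HomologicalComplex.hom_ext _ _ fun i =>
    ModuleCat.hom_ext (H.mapE_eq m i.1 (i.2 - i.1) hr)

end Homotopy

end FilteredComplex

/-! ### The universal homotopy between the two ends on the totalization of P_r(D). -/

namespace FreeMulticomplex

variable {R : Type u} [CommRing R]

lemma interval_tensorD_apply (r : ℕ) (A : Multicomplex.{u, v} R) (m : ℕ) (p q p' q' : ℤ)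
    (x : ∀ b, A.X (p - (interval r).degP b) (q - (interval r).degQ b)) :
    (interval r).tensorD A m p q p' q' x (.inr ()) =
      (interval r).sign m (.inr ()) • A.d m (p - -r) (q - (1 - r)) (p' - -r) (q' - (1 - r))
        (x (.inr ())) +
      if m = r then bigradedId A.X (p - 0) (q - 0) (p' - -r) (q' - (1 - r)) (x (.inl true)) -
        bigradedId A.X (p - 0) (q - 0) (p' - -r) (q' - (1 - r)) (x (.inl false)) else 0 := by
  refine ((interval r).tensorD_apply A m p q p' q' x (.inr ())).trans ?_
  refine congrArg _ ((Fintype.sum_sum_type _).trans ?_)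
  rw [Fintype.sum_bool, Finset.univ_unique, Finset.sum_singleton]
  -- The entries of the matrix of Λ_r in the column of u are abstracted, so that they can be
  -- identified by unfolding.
  have key : ∀ (c₁ c₂ c₃ : ℤ) (y₁ y₂ y₃ : A.X (p' - -r) (q' - (1 - r))),
      c₁ = (if m = r then 1 else 0) → c₂ = (if m = r then -1 else 0) → c₃ = 0 →
        c₁ • y₁ + c₂ • y₂ + c₃ • y₃ = if m = r then y₁ - y₂ else 0 := by
    rintro _ _ _ y₁ y₂ y₃ rfl rfl rfl
    split_ifs <;> simp [sub_eq_add_neg]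
  exact key _ _ _ _ _ _ rfl rfl rfl

end FreeMulticomplex

namespace SpSe

variable {R : Type u} [CommRing R]

/-- This reduces the theorem to the single pair ∂^-, ∂^+. -/
lemma RHomotopicWith.precomp {r : ℕ} {s : ℤ → ℤˣ} {hs : s r = -1} {A B C : SpSe.{u, v} R}
    {f g : A ⟶ B} (h : RHomotopicWith r s hs f g) (k : C ⟶ A) :
    RHomotopicWith r s hs (k ≫ f) (k ≫ g) := by
  obtain ⟨h, rfl, rfl⟩ := h
  exact ⟨k ≫ h, Category.assoc _ _ _, Category.assoc _ _ _⟩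

end SpSe

namespace Multicomplex

variable {R : Type u} [CommRing R]

lemma totMap_toHom {A B : Multicomplex.{u, v} R} (f : A.StrictHom B) (n : ℤ)
    (a : totModule A.X n) (j : ℤ) :
    (totMap (Hom.f f.toHom) n n a).1 j = f.f j (n + j) (a.1 j) := by
  rw [totMap_apply, finsum_eq_single _ 0 fun m hm => by simp [totTerm, hm, StrictHom.toHom]]
  have key : ∀ w, w = j → bigradedId B.X w (n + w) j (n + j) (f.f w (n + w) (a.1 w)) =
      f.f j (n + j) (a.1 j) := by
    rintro w rfl
    simp
  simpa [totTerm, StrictHom.toHom] using key (j + (0 : ℕ)) (by simp)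

/-- The map `a ↦ ((-1)^{r (n - 1)} (a_{j - r})_u)_j` from `Tot(P_r(D))^n` to `Tot(D)^{n - 1}`. -/
def totPathHomotopy (r : ℕ) (D : Multicomplex.{u, v} R) (n n' : ℤ) :
    totModule (path r D).X n →ₗ[R] totModule D.X n' where
  toFun a := ⟨fun j => ((Int.negOnePow (r * (n - 1)) : ℤˣ) : ℤ) •
    bigradedId D.X (j - r - -r) (n + (j - r) - (1 - r)) j (n' + j) (a.1 (j - r) (.inr ())), by
      obtain ⟨a, N, hN⟩ := a
      refine ⟨N + r, fun p hp => ?_⟩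
      have h : a (p - r) (.inr ()) = 0 := congrFun (hN (p - r) (by omega)) _
      exact (congrArg (fun y => _ • bigradedId D.X _ _ p (n' + p) y) h).trans (by simp)⟩
  map_add' a b := by
    refine Subtype.ext (funext fun j => ?_)
    refine Eq.trans ?_ (smul_add _ _ _)
    exact congrArg _ (map_add (bigradedId D.X _ _ j (n' + j)) _ _)
  map_smul' c a := by
    refine Subtype.ext (funext fun j => ?_)
    refine Eq.trans ?_ (smul_comm _ _ _)
    exact congrArg _ (map_smul (bigradedId D.X _ _ j (n' + j)) _ _)

/-- The exponent ⟨u, d_m⟩ = rm + (1 - r)(1 - m) has the parity of m + r + 1, which makes up for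
replacing n - 1 by n in both exponents and for the minus sign. -/
lemma totPathHomotopy_sign (r m : ℕ) (n : ℤ) :
    ((Int.negOnePow (m * (n - 1)) : ℤˣ) : ℤ) * ((Int.negOnePow (r * (n - 1)) : ℤˣ) : ℤ) =
      -(((Int.negOnePow (r * n) : ℤˣ) : ℤ) * (((Int.negOnePow (m * n) : ℤˣ) : ℤ) *
        (FreeMulticomplex.interval r).sign m (.inr ()))) := by
  have e : (FreeMulticomplex.interval r).sign m (.inr ()) =
    ((Int.negOnePow (-r * (-m) + (1 - r) * (1 - m)) : ℤˣ) : ℤ) := rfl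
  rw [e, ← Units.val_mul, ← Units.val_mul, ← Units.val_mul, ← Units.val_neg,
    ← Int.negOnePow_add, ← Int.negOnePow_add, ← Int.negOnePow_add, ← Int.negOnePow_succ]
  congr 1
  rw [Int.negOnePow_eq_iff]
  exact ⟨-(r * m) - 1, by ring⟩

/-- For each m, the contributions of d_m on the u-component to d s and to s d are the same element
with opposite signs. The indices w and w' are equal but arise as different expressions, so they are
separate variables. -/
lemma totPathHomotopy_cancel (r m : ℕ) (D : Multicomplex.{u, v} R) (n n' n'' j w w' : ℤ)
    (h : n' + 1 = n) (h' : n + 1 = n'') (hw : w = j - r + m) (hw' : w' = w)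
    (x : ∀ w : ℤ, D.X (w - -r) (n + w - (1 - r))) :
    ((Int.negOnePow (m * n') : ℤˣ) : ℤ) • D.d m (j + m) (n' + (j + m)) j (n + j)
      (((Int.negOnePow (r * (n - 1)) : ℤˣ) : ℤ) •
        bigradedId D.X (w' - -r) (n + w' - (1 - r)) (j + m) (n' + (j + m)) (x w')) +
    ((Int.negOnePow (r * (n'' - 1)) : ℤˣ) : ℤ) • bigradedId D.X (j - r - -r)
      (n'' + (j - r) - (1 - r)) j (n + j) (((Int.negOnePow (m * n) : ℤˣ) : ℤ) •
        (FreeMulticomplex.interval r).sign m (.inr ()) •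
          D.d m (w - -r) (n + w - (1 - r)) (j - r - -r) (n'' + (j - r) - (1 - r)) (x w)) = 0 := by
  subst hw'
  obtain rfl : n' = n - 1 := by omega
  obtain rfl : n'' = n + 1 := by omega
  rw [map_zsmul, map_zsmul, map_zsmul, FreeMulticomplex.d_bigradedId D m _ _ _ _ (j - r - -r)
    (n + 1 + (j - r) - (1 - r)) _ _ (by omega) (by omega), smul_smul, smul_smul, smul_smul,
    totPathHomotopy_sign, neg_smul, mul_assoc, add_sub_cancel_right, neg_add_cancel]

/-- The homotopy acts on d a, of degree n + 1, with sign (-1)^{rn}, the same sign with which d_r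
enters the total differential in degree n. Their product is 1. -/
lemma totPathHomotopy_ends (r : ℕ) (D : Multicomplex.{u, v} R) (n n'' j w : ℤ)
    (h' : n + 1 = n'') (hw : w = j) (x : ∀ w : ℤ, D.X (w - 0) (n + w - 0)) :
    ((Int.negOnePow (r * (n'' - 1)) : ℤˣ) : ℤ) • bigradedId D.X (j - r - -r)
      (n'' + (j - r) - (1 - r)) j (n + j) (((Int.negOnePow (r * n) : ℤˣ) : ℤ) •
        bigradedId D.X (w - 0) (n + w - 0) (j - r - -r) (n'' + (j - r) - (1 - r)) (x w)) =
      bigradedId D.X (j - 0) (n + j - 0) j (n + j) (x j) := by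
  subst hw
  obtain rfl : n'' = n + 1 := by omega
  rw [map_zsmul, FreeMulticomplex.bigradedId_trans _ _ _ _ _ _ (by omega), smul_smul,
    add_sub_cancel_right, ← Units.val_mul, Int.units_mul_self, Units.val_one, one_smul]

/-- Every index m ≠ r cancels completely; at m = r the e_±-components remain. The bound r < M only
ensures that this index occurs. -/
lemma totPathHomotopy_sum (r : ℕ) (D : Multicomplex.{u, v} R) (n n' n'' j : ℤ)
    (h : n' + 1 = n) (h' : n + 1 = n'') (M : ℕ) (hM : r < M)
    (x : ∀ w : ℤ, D.X (w - -r) (n + w - (1 - r))) (y z : ∀ w : ℤ, D.X (w - 0) (n + w - 0)) :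
    ∑ m ∈ Finset.range M, ((Int.negOnePow (m * n') : ℤˣ) : ℤ) •
      D.d m (j + m) (n' + (j + m)) j (n + j) (((Int.negOnePow (r * (n - 1)) : ℤˣ) : ℤ) •
        bigradedId D.X (j + m - r - -r) (n + (j + m - r) - (1 - r)) (j + m) (n' + (j + m))
          (x (j + m - r))) +
    ((Int.negOnePow (r * (n'' - 1)) : ℤˣ) : ℤ) • bigradedId D.X (j - r - -r)
      (n'' + (j - r) - (1 - r)) j (n + j) (∑ m ∈ Finset.range M,
        ((Int.negOnePow (m * n) : ℤˣ) : ℤ) •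
          ((FreeMulticomplex.interval r).sign m (.inr ()) • D.d m (j - r + m - -r)
            (n + (j - r + m) - (1 - r)) (j - r - -r) (n'' + (j - r) - (1 - r)) (x (j - r + m)) +
          if m = r then bigradedId D.X (j - r + m - 0) (n + (j - r + m) - 0) (j - r - -r)
              (n'' + (j - r) - (1 - r)) (y (j - r + m)) -
            bigradedId D.X (j - r + m - 0) (n + (j - r + m) - 0) (j - r - -r)
              (n'' + (j - r) - (1 - r)) (z (j - r + m)) else 0)) =
    bigradedId D.X (j - 0) (n + j - 0) j (n + j) (y j) -
      bigradedId D.X (j - 0) (n + j - 0) j (n + j) (z j) := by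
  rw [map_sum, Finset.smul_sum, ← Finset.sum_add_distrib, Finset.sum_eq_single r]
  · rw [smul_add, map_add, smul_add, ← add_assoc,
      totPathHomotopy_cancel r r D n n' n'' j _ _ h h' rfl (by ring), zero_add, if_pos rfl,
      smul_sub, map_sub, smul_sub, totPathHomotopy_ends r D n n'' j _ h' (by ring),
      totPathHomotopy_ends r D n n'' j _ h' (by ring)]
  · intro m _ hmr
    rw [if_neg hmr, add_zero]
    exact totPathHomotopy_cancel r m D n n' n'' j _ _ h h' rfl (by ring) x
  · intro hr
    exact absurd (Finset.mem_range.2 hM) hr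

lemma tensorD_totTerm_sum (r : ℕ) (D : Multicomplex.{u, v} R) (n n'' j : ℤ)
    (a : totModule (path r D).X n) (N : ℤ) (hN : ∀ p, N < p → a.1 p = 0) (M : ℕ)
    (hM : N < j + M) :
    (totMap (path r D).d n n'' a).1 j (.inr ()) =
      ∑ m ∈ Finset.range M, ((Int.negOnePow (m * n) : ℤˣ) : ℤ) •
        ((FreeMulticomplex.interval r).sign m (.inr ()) • D.d m (j + m - -r)
          (n + (j + m) - (1 - r)) (j - -r) (n'' + j - (1 - r)) (a.1 (j + m) (.inr ())) +
        if m = r then bigradedId D.X (j + m - 0) (n + (j + m) - 0) (j - -r)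
            (n'' + j - (1 - r)) (a.1 (j + m) (.inl true)) -
          bigradedId D.X (j + m - 0) (n + (j + m) - 0) (j - -r)
            (n'' + j - (1 - r)) (a.1 (j + m) (.inl false)) else 0) := by
  refine (congrFun (f := (totMap (path r D).d n n'' a).1 j) (finsum_totTerm (path r D).d n
    n'' a.1 j N hN M hM) (.inr ())).trans ?_
  refine (Finset.sum_apply (M := fun b => D.X (j - (FreeMulticomplex.interval r).degP b)
    (n'' + j - (FreeMulticomplex.interval r).degQ b)) (.inr ()) _ _).trans ?_
  exact Finset.sum_congr rfl fun m _ => congrArg _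
    (FreeMulticomplex.interval_tensorD_apply r D m _ _ _ _ _)

/-- The entry at p depends only on the entry of a at p - r, so the filtration rises by at most r. -/
lemma totPathHomotopy_eq_zero (r : ℕ) (D : Multicomplex.{u, v} R) (n n' : ℤ)
    (a : totModule (path r D).X n) (N : ℤ) (hN : ∀ p, N < p → a.1 p = 0) (p : ℤ)
    (hp : N + r < p) : (totPathHomotopy r D n n' a).1 p = 0 := by
  have h : a.1 (p - r) (.inr ()) = 0 := congrFun (hN (p - r) (by omega)) _
  exact (congrArg (fun y => _ • bigradedId D.X _ _ p (n' + p) y) h).trans (by simp)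

lemma totPathHomotopy_comm (r : ℕ) (D : Multicomplex.{u, v} R) (n n' n'' : ℤ) (h : n' + 1 = n)
    (h' : n + 1 = n'') (a : totModule (path r D).X n) :
    totMap D.d n' n (totPathHomotopy r D n n' a) +
        totPathHomotopy r D n'' n (totMap (path r D).d n n'' a) =
      totMap (Hom.f (pathEnd r true D)) n n a - totMap (Hom.f (pathEnd r false D)) n n a := by
  refine Subtype.ext (funext fun j => ?_)
  obtain ⟨N, hN⟩ := a.2
  -- One M serves three purposes: it bounds the finite sums for d s and for s d, and the j in the
  -- maximum gives r < M.
  obtain ⟨M, hM⟩ := exists_bound (max (N + r) j) (j - r)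
  have h1 := finsum_totTerm D.d n' n (totPathHomotopy r D n n' a).1 j (N + r)
    (totPathHomotopy_eq_zero r D n n' a N hN) M (by omega)
  have h2 := tensorD_totTerm_sum r D n n'' (j - r) a N hN M (by omega)
  have h3 := totPathHomotopy_sum r D n n' n'' j h h' M (by omega) (fun w => a.1 w (.inr ()))
    (fun w => a.1 w (.inl true)) (fun w => a.1 w (.inl false))
  refine (congrArg₂ (fun x y => x + ((Int.negOnePow (r * (n'' - 1)) : ℤˣ) : ℤ) •
    bigradedId D.X (j - r - -r) (n'' + (j - r) - (1 - r)) j (n + j) y) h1 h2).trans (h3.trans ?_)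
  exact (congrArg₂ (fun x y => x - y)
    (totMap_toHom _ n a j : (totMap (Hom.f (pathEnd r true D)) n n a).1 j = _)
    (totMap_toHom _ n a j : (totMap (Hom.f (pathEnd r false D)) n n a).1 j = _)).symm

/-- The homotopy from `Tot(∂^-)` to `Tot(∂^+)`. -/
def totPathEndHomotopy (r : ℕ) (D : Multicomplex.{u, v} R) :
    FilteredComplex.Homotopy r (tot.map (pathEnd r false D)) (tot.map (pathEnd r true D)) where
  s n n' _ := totPathHomotopy r D n n'
  map_mem p n n' _ a ha := totPathHomotopy_eq_zero r D n n' a p ha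
  comm n n' n'' h h' a := totPathHomotopy_comm r D n n' n'' h h' a

lemma RHomotopic.toSpSe_map {r : ℕ} {C D : Multicomplex.{u, v} R} {f g : C ⟶ D}
    (h : RHomotopic r f g) : SpSe.RHomotopic r (toSpSe.map f) (toSpSe.map g) := by
  obtain ⟨k, rfl, rfl⟩ := h
  rw [Functor.map_comp, Functor.map_comp]
  exact ((totPathEndHomotopy r D).homotopyData.rHomotopicWith rfl).precomp (toSpSe.map k)

/-- The same reduction to the ends works after twisting, since T is a functor. -/
lemma RHomotopic.twist_toSpSe_map {r : ℕ} {C D : Multicomplex.{u, v} R} {f g : C ⟶ D}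
    (h : RHomotopic r f g) : SpSe.BigradedRHomotopic r (SpSe.twist.map (toSpSe.map f))
      (SpSe.twist.map (toSpSe.map g)) := by
  obtain ⟨k, rfl, rfl⟩ := h
  rw [Functor.map_comp, Functor.map_comp, Functor.map_comp, Functor.map_comp]
  exact ((totPathEndHomotopy r D).homotopyData.twist.rHomotopicWith _).precomp
    (SpSe.twist.map (toSpSe.map k))

end Multicomplex

/-! ### Finite n: strict homotopies become homotopies of ∞-morphisms. -/

namespace NMulticomplex

variable {R : Type u} [CommRing R]

/-- The strict homotopy is postcomposed with α_D, which preserves both ends. -/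
lemma RHomotopic.incl_map {n : ℕ} {hn : 2 ≤ n} {r : ℕ} {C D : NMulticomplex.{u, v} R n}
    {f g : C ⟶ D} (h : RHomotopic n hn r f g) :
    Multicomplex.RHomotopic r ((incl n).map f) ((incl n).map g) := by
  obtain ⟨k, rfl, rfl⟩ := h
  refine ⟨(incl n).map k ≫ (pathComparison n hn r).app D, ?_, ?_⟩
  · rw [Functor.map_comp, ← staircaseHom_tensor_pathEnd]
    exact Category.assoc (obj := Multicomplex.{u, v} R) _ _ _
  · rw [Functor.map_comp, ← staircaseHom_tensor_pathEnd]
    exact Category.assoc (obj := Multicomplex.{u, v} R) _ _ _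

end NMulticomplex

end

theorem mainTheorem9 {R : Type u} [CommRing R] (r : ℕ) :
    -- the case `n = ∞`, for all `∞`-morphisms and in particular for strict morphisms
    (∀ {C D : Multicomplex.{u, v} R} (f g : C ⟶ D), Multicomplex.RHomotopic r f g →
      SpSe.RHomotopic r (Multicomplex.toSpSe.map f) (Multicomplex.toSpSe.map g) ∧
      SpSe.BigradedRHomotopic r (SpSe.twist.map (Multicomplex.toSpSe.map f))
        (SpSe.twist.map (Multicomplex.toSpSe.map g))) ∧
    (∀ {C D : NMulticomplex.{u, v} R ⊤} (f g : C ⟶ D),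
      Multicomplex.RHomotopic r ((NMulticomplex.incl ⊤).map f) ((NMulticomplex.incl ⊤).map g) →
      SpSe.RHomotopic r ((NMulticomplex.toSpSe ⊤).map f) ((NMulticomplex.toSpSe ⊤).map g) ∧
      SpSe.BigradedRHomotopic r (SpSe.twist.map ((NMulticomplex.toSpSe ⊤).map f))
        (SpSe.twist.map ((NMulticomplex.toSpSe ⊤).map g))) ∧
    -- the case `2 ≤ n < ∞`
    (∀ (n : ℕ) (hn : 2 ≤ n),
      (∃ α : NMulticomplex.path.{u, v} n hn r ⋙ NMulticomplex.incl n ⟶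
          NMulticomplex.inclTop n ⋙ NMulticomplex.pathTop r ⋙ NMulticomplex.incl (R := R) ⊤,
        ∀ (D : NMulticomplex.{u, v} R n) (ε : Bool),
          α.app D ≫ Multicomplex.pathEnd r ε D.toMulticomplex =
            (NMulticomplex.incl n).map (NMulticomplex.pathEnd n hn r ε D)) ∧
      (∀ {C D : NMulticomplex.{u, v} R n} (f g : C ⟶ D), NMulticomplex.RHomotopic n hn r f g →
        Multicomplex.RHomotopic r ((NMulticomplex.incl n).map f) ((NMulticomplex.incl n).map g) ∧
        SpSe.RHomotopic r ((NMulticomplex.toSpSe n).map f) ((NMulticomplex.toSpSe n).map g) ∧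
        SpSe.BigradedRHomotopic r (SpSe.twist.map ((NMulticomplex.toSpSe n).map f))
          (SpSe.twist.map ((NMulticomplex.toSpSe n).map g)))) := by
  -- The functor `NMulticomplex.toSpSe` unfolds to `Multicomplex.toSpSe` after the inclusion, so the
  -- strict case is an instance of the one for ∞-morphisms.
  refine ⟨fun f g h => ⟨h.toSpSe_map, h.twist_toSpSe_map⟩,
    fun f g h => ⟨h.toSpSe_map, h.twist_toSpSe_map⟩, fun n hn => ⟨?_, fun f g h => ?_⟩⟩
  · exact ⟨NMulticomplex.pathComparison n hn r,
      fun D ε => NMulticomplex.staircaseHom_tensor_pathEnd n hn r ε D⟩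
  · exact ⟨h.incl_map, h.incl_map.toSpSe_map, h.incl_map.twist_toSpSe_map⟩
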